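/- Let $R$ be a commutative ring, let $\Delta$ be a quiver with finitely many vertices $i$ and finitely many arrows $\alpha$, and let $\Lambda=R[\Delta]$ be its path algebra, that is, the associative unital $R$-algebra generated by symbols $e_i$ and $f_\alpha$ subject to $e_ie_j=\delta_{i,j}e_i$, $f_\alpha e_i=\delta_{\mathrm{source}(\alpha),i}f_\alpha$, $e_jf_\alpha=\delta_{j,\mathrm{target}(\alpha)}f_\alpha$ and $\sum_i e_i=1$. Let $\Lambda^{\mathrm{azu}}$ be an Azumaya $R$-algebra of degree $n\ge 1$ (so of rank $n^2$), and let $H=\operatorname{Aut}_{\Lambda^{\mathrm{azu}}/R}$ be its automorphism group scheme. For an $R$-algebra $A$, an $A$-valued Schur representation of $\Lambda$ in $\Lambda^{\mathrm{azu}}$ is a homomorphism of $A$-algebras $\rho:\Lambda\otimes_RA\to\Lambda^{\mathrm{azu}}\otimes_RA$ such that for each prime ideal $\mathfrak p\subset A$ the only elements of $\Lambda^{\mathrm{azu}}\otimes_R\kappa(\mathfrak p)$ commuting with the image of $\rho\otimes\kappa(\mathfrak p)$ are the scalars $\kappa(\mathfrak p)$. Let $X$ be the functor on $R$-algebras sending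 $A$ to the set of $A$-valued Schur representations. Furthermore let $$Y=\coprod_m\Bigl(\prod_{i}\operatorname{Grass}_{m_i}\times_R\prod_{\alpha}\mathbb A^1\otimes_R\Lambda^{\mathrm{azu}}\Bigr),$$ where the disjoint union runs over all tuples $m=(m_i)_i$ of natural numbers with $\sum_i m_i=n^2$, where $\operatorname{Grass}_{m_i}$ is the Grassmannian over $R$ whose $A$-valued points are the $A$-submodules of $\Lambda^{\mathrm{azu}}\otimes_RA$ whose quotient is locally free of rank $n^2-m_i$ (local direct summands of rank $m_i$), and where $\mathbb A^1\otimes_R\Lambda^{\mathrm{azu}}=\operatorname{Spec}\operatorname{Sym}^\bullet((\Lambda^{\mathrm{azu}})^\vee)$ is the vector bundle of $\Lambda^{\mathrm{azu}}$. The group scheme $H$ acts on $X$ by $\sigma\cdot\rho=\sigma\circ\rho$ and on $Y$ by $\sigma\cdot(\mathfrak a_i\mid f_\alpha)=(\sigma(\mathfrak a_i)\mid\sigma(f_\alpha))$; note that left multiplication by $\sigma(f_\alpha)$ is $\sigma\circ f_\alpha\circ\sigma^{-1}$, where $f_\alpha$ also denotes left multiplication by $f_\alpha$. **Proposition.** $X$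 and $Y$ are quasiprojective $R$-schemes (in particular the functor $X$ is representable), and the assignment $$\rho\longmapsto\bigl(\rho(e_i)\cdot(\Lambda^{\mathrm{azu}}\otimes_RA)\mid\rho(f_\alpha)\bigr)_{i,\alpha}$$ defines a morphism $X\to Y$ of $R$-schemes that is $H$-equivariant and an embedding, that is, it factors as a closed embedding into an open subscheme of $Y$. -/

import Mathlib

open CategoryTheory Limits AlgebraicGeometry TensorProduct Opposite

universe u

noncomputable section

namespace QuiverRep

/-! ### Path algebras and Azumaya algebras of a given degree -/

/-- The defining relations of the path algebra. The generator `Sum.inl i` is the idempotent `e i`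
of the vertex `i`, the generator `Sum.inr α` is the element `f α` of the arrow `α` with source
`α.left` and target `α.right`. The path algebra is unital with unit the sum of the idempotents
of the vertices, which in the presentation as a unital algebra is the relation `sum_e`. -/
inductive PathAlgebra.Rel (R : Type u) [CommRing R] (Δ : Type u) [Quiver.{u} Δ] [Fintype Δ] :
    FreeAlgebra R (Δ ⊕ Quiver.Total Δ) → FreeAlgebra R (Δ ⊕ Quiver.Total Δ) → Prop
  | e_mul_self (i : Δ) : PathAlgebra.Rel R Δ
      (FreeAlgebra.ι R (Sum.inl i) * FreeAlgebra.ι R (Sum.inl i)) (FreeAlgebra.ι R (Sum.inl i))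
  | e_mul_e (i j : Δ) (h : i ≠ j) : PathAlgebra.Rel R Δ
      (FreeAlgebra.ι R (Sum.inl i) * FreeAlgebra.ι R (Sum.inl j)) 0
  | f_mul_source (α : Quiver.Total Δ) : PathAlgebra.Rel R Δ
      (FreeAlgebra.ι R (Sum.inr α) * FreeAlgebra.ι R (Sum.inl α.left))
      (FreeAlgebra.ι R (Sum.inr α))
  | f_mul_e (α : Quiver.Total Δ) (i : Δ) (h : α.left ≠ i) : PathAlgebra.Rel R Δ
      (FreeAlgebra.ι R (Sum.inr α) * FreeAlgebra.ι R (Sum.inl i)) 0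
  | target_mul_f (α : Quiver.Total Δ) : PathAlgebra.Rel R Δ
      (FreeAlgebra.ι R (Sum.inl α.right) * FreeAlgebra.ι R (Sum.inr α))
      (FreeAlgebra.ι R (Sum.inr α))
  | e_mul_f (α : Quiver.Total Δ) (j : Δ) (h : j ≠ α.right) : PathAlgebra.Rel R Δ
      (FreeAlgebra.ι R (Sum.inl j) * FreeAlgebra.ι R (Sum.inr α)) 0
  | sum_e : PathAlgebra.Rel R Δ (∑ i : Δ, FreeAlgebra.ι R (Sum.inl i)) 1

/-- The path algebra of a quiver with finitely many vertices over a commutative ring. -/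
abbrev PathAlgebra (R : Type u) [CommRing R] (Δ : Type u) [Quiver.{u} Δ] [Fintype Δ] : Type u :=
  RingQuot (PathAlgebra.Rel R Δ)

/-- The idempotent of a vertex. -/
def PathAlgebra.e (R : Type u) [CommRing R] {Δ : Type u} [Quiver.{u} Δ] [Fintype Δ] (i : Δ) :
    PathAlgebra R Δ :=
  RingQuot.mkAlgHom R (PathAlgebra.Rel R Δ) (FreeAlgebra.ι R (Sum.inl i))

/-- The element of an arrow. -/
def PathAlgebra.f (R : Type u) [CommRing R] {Δ : Type u} [Quiver.{u} Δ] [Fintype Δ]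
    (α : Quiver.Total Δ) : PathAlgebra R Δ :=
  RingQuot.mkAlgHom R (PathAlgebra.Rel R Δ) (FreeAlgebra.ι R (Sum.inr α))

lemma PathAlgebra.e_mul_self (R : Type u) [CommRing R] {Δ : Type u} [Quiver.{u} Δ] [Fintype Δ]
    (i : Δ) : PathAlgebra.e R i * PathAlgebra.e R i = PathAlgebra.e R i := by
  simpa [PathAlgebra.e] using! RingQuot.mkAlgHom_rel R (PathAlgebra.Rel.e_mul_self (R := R) i)

lemma PathAlgebra.e_mul_e (R : Type u) [CommRing R] {Δ : Type u} [Quiver.{u} Δ] [Fintype Δ]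
    {i j : Δ} (h : i ≠ j) : PathAlgebra.e R i * PathAlgebra.e R j = 0 := by
  simpa [PathAlgebra.e] using! RingQuot.mkAlgHom_rel R (PathAlgebra.Rel.e_mul_e (R := R) i j h)

lemma PathAlgebra.sum_e (R : Type u) [CommRing R] (Δ : Type u) [Quiver.{u} Δ] [Fintype Δ] :
    ∑ i : Δ, PathAlgebra.e R i = 1 := by
  simpa [PathAlgebra.e] using! RingQuot.mkAlgHom_rel R (PathAlgebra.Rel.sum_e (R := R) (Δ := Δ))

/-- `L` is an Azumaya algebra of degree `n ≥ 1`: its rank is everywhere `n ^ 2`. -/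
class IsAzumayaOfDegree (R : Type u) [CommRing R] (L : Type u) [Ring L] [Algebra R L] (n : ℕ) :
    Prop extends IsAzumaya R L where
  one_le : 1 ≤ n
  rank_eq : ∀ p : PrimeSpectrum R, Module.rankAtStalk (R := R) L p = n ^ 2

/-! ### Base change of representations and of automorphisms -/

section BaseChange

variable {R : Type u} [CommRing R] {G L : Type u} [Ring G] [Algebra R G] [Ring L] [Algebra R L]
variable {A B C : Type u} [CommRing A] [Algebra R A] [CommRing B] [Algebra R B]
  [CommRing C] [Algebra R C]

variable (L) in
/-- The map `A ⊗ L → B ⊗ L` induced by a homomorphism `A → B` of `R`-algebras. -/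
def bc (φ : A →ₐ[R] B) : A ⊗[R] L →ₐ[R] B ⊗[R] L :=
  Algebra.TensorProduct.map φ (AlgHom.id R L)

@[simp] lemma bc_tmul (φ : A →ₐ[R] B) (a : A) (x : L) : bc L φ (a ⊗ₜ x) = φ a ⊗ₜ x := rfl

lemma bc_id (z : A ⊗[R] L) : bc L (AlgHom.id R A) z = z := by
  simp [bc]

lemma bc_comp (ψ : B →ₐ[R] C) (φ : A →ₐ[R] B) (z : A ⊗[R] L) :
    bc L (ψ.comp φ) z = bc L ψ (bc L φ z) := by
  induction z with
  | zero => simp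
  | tmul a x => simp
  | add x y hx hy => simp only [map_add, hx, hy]

lemma bc_smul (φ : A →ₐ[R] B) (a : A) (z : A ⊗[R] L) : bc L φ (a • z) = φ a • bc L φ z := by
  induction z with
  | zero => simp
  | tmul a x => simp [smul_tmul']
  | add x y hx hy => simp only [map_add, smul_add, hx, hy]

variable (G L) in
/-- The base change along `A → B` of an `A`-valued representation `A ⊗ G → A ⊗ L`. -/
def repMap (φ : A →ₐ[R] B) (ρ : A ⊗[R] G →ₐ[A] A ⊗[R] L) : B ⊗[R] G →ₐ[B] B ⊗[R] L :=
  Algebra.TensorProduct.lift (Algebra.ofId B (B ⊗[R] L))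
    ((bc L φ).comp ((ρ.restrictScalars R).comp Algebra.TensorProduct.includeRight))
    (fun b x => by rw [Algebra.ofId_apply]; exact Algebra.commutes b _)

lemma repMap_tmul (φ : A →ₐ[R] B) (ρ : A ⊗[R] G →ₐ[A] A ⊗[R] L) (b : B) (x : G) :
    repMap G L φ ρ (b ⊗ₜ x) = b • bc L φ (ρ (1 ⊗ₜ x)) := by
  rw [repMap, Algebra.TensorProduct.lift_tmul, Algebra.smul_def]
  rfl

@[simp] lemma repMap_bc (φ : A →ₐ[R] B) (ρ : A ⊗[R] G →ₐ[A] A ⊗[R] L) (z : A ⊗[R] G) :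
    repMap G L φ ρ (bc G φ z) = bc L φ (ρ z) := by
  induction z with
  | zero => simp
  | tmul a x =>
    have : a ⊗ₜ[R] x = a • ((1 : A) ⊗ₜ[R] x) := by simp [smul_tmul']
    rw [bc_tmul, repMap_tmul, this, map_smul, bc_smul]
  | add x y hx hy => simp only [map_add, hx, hy]

/-- A homomorphism out of `B ⊗ G` is determined by its values on the image of `A ⊗ G`. -/
lemma algHom_ext_bc (φ : A →ₐ[R] B) {M : Type*} [Ring M] [Algebra B M]
    {f g : B ⊗[R] G →ₐ[B] M} (h : ∀ z : A ⊗[R] G, f (bc G φ z) = g (bc G φ z)) : f = g := by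
  ext z
  induction z with
  | zero => simp
  | tmul b x =>
    have : b ⊗ₜ[R] x = b • bc G φ ((1 : A) ⊗ₜ[R] x) := by simp [smul_tmul']
    rw [this, map_smul, map_smul, h]
  | add x y hx hy => simp only [map_add, hx, hy]

lemma repMap_id (ρ : A ⊗[R] G →ₐ[A] A ⊗[R] L) : repMap G L (AlgHom.id R A) ρ = ρ :=
  algHom_ext_bc (AlgHom.id R A) fun z => by rw [repMap_bc, bc_id, bc_id]

lemma repMap_comp (ψ : B →ₐ[R] C) (φ : A →ₐ[R] B) (ρ : A ⊗[R] G →ₐ[A] A ⊗[R] L) :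
    repMap G L (ψ.comp φ) ρ = repMap G L ψ (repMap G L φ ρ) :=
  algHom_ext_bc (ψ.comp φ) fun z => by
    rw [repMap_bc, bc_comp, bc_comp, repMap_bc, repMap_bc]

lemma repMap_comp_algHom (φ : A →ₐ[R] B) (σ : A ⊗[R] L →ₐ[A] A ⊗[R] L)
    (ρ : A ⊗[R] G →ₐ[A] A ⊗[R] L) :
    repMap G L φ (σ.comp ρ) = (repMap L L φ σ).comp (repMap G L φ ρ) :=
  algHom_ext_bc φ fun z => by simp

variable (R L A) in
/-- The `A`-valued points of the group scheme of automorphisms of `L`. -/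
abbrev Aut : Type u := A ⊗[R] L ≃ₐ[A] A ⊗[R] L

/-- The base change along `A → B` of automorphisms. -/
def autMap (φ : A →ₐ[R] B) : Aut R L A →* Aut R L B where
  toFun σ := AlgEquiv.ofAlgHom (repMap L L φ σ.toAlgHom) (repMap L L φ σ.symm.toAlgHom)
    (by rw [← repMap_comp_algHom]; exact algHom_ext_bc φ fun z => by simp)
    (by rw [← repMap_comp_algHom]; exact algHom_ext_bc φ fun z => by simp)
  map_one' := by
    apply AlgEquiv.coe_toAlgHom_injective
    exact algHom_ext_bc φ fun z => (repMap_bc φ _ z).trans rfl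
  map_mul' σ τ := by
    apply AlgEquiv.coe_toAlgHom_injective
    exact repMap_comp_algHom φ σ.toAlgHom τ.toAlgHom

lemma autMap_toAlgHom (φ : A →ₐ[R] B) (σ : Aut R L A) :
    (autMap φ σ).toAlgHom = repMap L L φ σ.toAlgHom := rfl

@[simp] lemma autMap_bc (φ : A →ₐ[R] B) (σ : Aut R L A) (z : A ⊗[R] L) :
    autMap φ σ (bc L φ z) = bc L φ (σ z) :=
  repMap_bc φ σ.toAlgHom z

end BaseChange

/-- The group scheme of automorphisms of the algebra `L`, as a functor on `R`-algebras. -/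
def autFunctor (R : Type u) [CommRing R] (L : Type u) [Ring L] [Algebra R L] :
    CommAlgCat.{u} R ⥤ GrpCat.{u} where
  obj A := GrpCat.of (Aut R L A)
  map φ := GrpCat.ofHom (autMap φ.hom)
  map_id A := by
    ext σ : 2
    apply AlgEquiv.coe_toAlgHom_injective
    exact repMap_id _
  map_comp φ ψ := by
    ext σ : 2
    apply AlgEquiv.coe_toAlgHom_injective
    exact repMap_comp _ _ _

/-! ### Schur representations -/

section Schur

variable {R : Type u} [CommRing R] {G L : Type u} [Ring G] [Algebra R G] [Ring L] [Algebra R L]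
variable {A B C : Type u} [CommRing A] [Algebra R A] [CommRing B] [Algebra R B]
  [CommRing C] [Algebra R C]

/-- The elements of `A ⊗ L` that commute with all values of `ρ` are scalars. -/
def HasScalarCommutant (ρ : A ⊗[R] G →ₐ[A] A ⊗[R] L) : Prop :=
  ∀ z : A ⊗[R] L, (∀ x : A ⊗[R] G, z * ρ x = ρ x * z) → ∃ a : A, z = algebraMap A (A ⊗[R] L) a

/-- An `A`-valued representation `ρ` is a Schur representation if over the residue field of each
prime ideal of `A` the commutant of its image consists of scalars. -/
def IsSchur (ρ : A ⊗[R] G →ₐ[A] A ⊗[R] L) : Prop :=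
  ∀ p : PrimeSpectrum A, HasScalarCommutant
    (repMap G L (IsScalarTower.toAlgHom R A p.asIdeal.ResidueField) ρ)

lemma exists_scalar_of_commute {k K M : Type*} [Field k] [CommRing K] [Algebra k K] [Ring M]
    [Algebra k M] (S : Set M)
    (hS : ∀ m : M, (∀ s ∈ S, m * s = s * m) → ∃ a : k, m = algebraMap k M a)
    (t : K ⊗[k] M) (ht : ∀ s ∈ S, t * (1 ⊗ₜ s) = (1 ⊗ₜ s) * t) :
    ∃ c : K, t = algebraMap K (K ⊗[k] M) c := by
  classical
  let b := Module.Basis.ofVectorSpace k K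
  let e := TensorProduct.equivFinsuppOfBasisLeft (N := M) b
  have hright (s : M) (t : K ⊗[k] M) (i) : e (t * (1 ⊗ₜ s)) i = e t i * s := by
    induction t with
    | zero => simp
    | tmul c m => simp [e]
    | add x y hx hy => rw [add_mul, map_add, map_add, Finsupp.add_apply, hx, hy,
        Finsupp.add_apply, add_mul]
  have hleft (s : M) (t : K ⊗[k] M) (i) : e ((1 ⊗ₜ s) * t) i = s * e t i := by
    induction t with
    | zero => simp
    | tmul c m => simp [e]
    | add x y hx hy => rw [mul_add, map_add, map_add, Finsupp.add_apply, hx, hy,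
        Finsupp.add_apply, mul_add]
  have hsc (i) : ∃ a : k, e t i = algebraMap k M a := by
    refine hS _ fun s hs => ?_
    rw [← hright, ← hleft, ht s hs]
  choose a ha using hsc
  refine ⟨(e t).sum fun i _ => a i • b i, ?_⟩
  have h1 : t = e.symm (e t) := (e.symm_apply_apply t).symm
  conv_lhs => rw [h1]
  rw [TensorProduct.equivFinsuppOfBasisLeft_symm_apply, Finsupp.sum, Finsupp.sum, map_sum]
  refine Finset.sum_congr rfl fun i _ => ?_
  rw [ha, Algebra.TensorProduct.algebraMap_apply, Algebra.algebraMap_eq_smul_one, ← smul_tmul]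
  simp

lemma HasScalarCommutant.of_field {k K : Type u} [Field k] [Algebra R k] [Field K] [Algebra R K]
    (j : k →ₐ[R] K) {ρ : k ⊗[R] G →ₐ[k] k ⊗[R] L} (h : HasScalarCommutant ρ) :
    HasScalarCommutant (repMap G L j ρ) := by
  let : Algebra k K := j.toRingHom.toAlgebra
  have : IsScalarTower R k K := .of_algebraMap_eq' j.comp_algebraMap.symm
  intro z hz
  let e := AlgebraTensorModule.cancelBaseChange R k K K L
  have he (y : k ⊗[R] L) : e (1 ⊗ₜ y) = bc L j y := by
    induction y with
    | zero => simp
    | tmul c x =>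
      simp only [e, AlgebraTensorModule.cancelBaseChange_tmul, bc_tmul]
      rw [Algebra.smul_def, mul_one]; rfl
    | add x y hx hy => rw [tmul_add, map_add, map_add, hx, hy]
  let g : K ⊗[k] (k ⊗[R] L) →ₐ[K] K ⊗[R] L :=
    Algebra.TensorProduct.lift (Algebra.ofId K (K ⊗[R] L))
      (Algebra.TensorProduct.map (Algebra.ofId k K) (AlgHom.id R L))
      (fun b x => by rw [Algebra.ofId_apply]; exact Algebra.commutes b _)
  have hg1 (y : k ⊗[R] L) : g (1 ⊗ₜ y) = bc L j y := by
    rw [Algebra.TensorProduct.lift_tmul, map_one, one_mul]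
    rfl
  have hg (t : K ⊗[k] (k ⊗[R] L)) : e t = g t := by
    induction t with
    | zero => simp
    | tmul c y =>
      have : c ⊗ₜ[k] y = c • ((1 : K) ⊗ₜ[k] y) := by simp [smul_tmul']
      rw [this, map_smul, map_smul, hg1, he]
    | add x y hx hy => rw [map_add, map_add, hx, hy]
  obtain ⟨c, hc⟩ := exists_scalar_of_commute (k := k) (K := K) (Set.range ρ)
    (fun m hm => h m fun x => hm _ ⟨x, rfl⟩) (e.symm z) (by
      rintro _ ⟨x, rfl⟩
      apply e.injective
      rw [hg, hg, map_mul, map_mul, ← hg (e.symm z), hg1, e.apply_symm_apply, ← repMap_bc]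
      exact hz _)
  refine ⟨c, ?_⟩
  rw [← e.apply_symm_apply z, hc, hg, g.commutes]

lemma IsSchur.map (φ : A →ₐ[R] B) {ρ : A ⊗[R] G →ₐ[A] A ⊗[R] L} (h : IsSchur ρ) :
    IsSchur (repMap G L φ ρ) := by
  intro q
  let p : PrimeSpectrum A := q.comap φ.toRingHom
  let j : p.asIdeal.ResidueField →ₐ[R] q.asIdeal.ResidueField :=
    Ideal.ResidueField.mapₐ p.asIdeal q.asIdeal φ rfl
  have hj : (IsScalarTower.toAlgHom R B q.asIdeal.ResidueField).comp φ =
      j.comp (IsScalarTower.toAlgHom R A p.asIdeal.ResidueField) := by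
    ext a
    exact (Ideal.ResidueField.map_algebraMap (I := p.asIdeal) (J := q.asIdeal) φ.toRingHom rfl a).symm
  rw [← repMap_comp, hj, repMap_comp]
  exact (h p).of_field j

lemma HasScalarCommutant.comp (σ : Aut R L A) {ρ : A ⊗[R] G →ₐ[A] A ⊗[R] L}
    (h : HasScalarCommutant ρ) : HasScalarCommutant (σ.toAlgHom.comp ρ) := by
  intro z hz
  obtain ⟨a, ha⟩ := h (σ.symm z) fun x => by
    apply σ.injective
    simpa using hz x
  refine ⟨a, ?_⟩
  rw [← σ.apply_symm_apply z, ha, σ.commutes]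

lemma IsSchur.comp (σ : Aut R L A) {ρ : A ⊗[R] G →ₐ[A] A ⊗[R] L} (h : IsSchur ρ) :
    IsSchur (σ.toAlgHom.comp ρ) := by
  intro p
  rw [repMap_comp_algHom, ← autMap_toAlgHom]
  exact (h p).comp _

variable (R G L A) in
/-- The set of `A`-valued Schur representations of `G` in `L`. -/
def SchurRep : Type u := {ρ : A ⊗[R] G →ₐ[A] A ⊗[R] L // IsSchur ρ}

/-- The base change of Schur representations. -/
def SchurRep.map (φ : A →ₐ[R] B) (ρ : SchurRep R G L A) : SchurRep R G L B :=
  ⟨repMap G L φ ρ.1, ρ.2.map φ⟩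

/-- Automorphisms act on Schur representations by composition. -/
instance : MulAction (Aut R L A) (SchurRep R G L A) where
  smul σ ρ := ⟨σ.toAlgHom.comp ρ.1, ρ.2.comp σ⟩
  one_smul _ := Subtype.ext rfl
  mul_smul _ _ _ := Subtype.ext rfl

lemma SchurRep.smul_val (σ : Aut R L A) (ρ : SchurRep R G L A) :
    (σ • ρ).1 = σ.toAlgHom.comp ρ.1 := rfl

lemma SchurRep.map_smul (φ : A →ₐ[R] B) (σ : Aut R L A) (ρ : SchurRep R G L A) :
    SchurRep.map φ (σ • ρ) = autMap φ σ • SchurRep.map φ ρ :=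
  Subtype.ext (repMap_comp_algHom φ σ.toAlgHom ρ.1)

end Schur

/-- The functor of Schur representations of `G` in `L` on the category of `R`-algebras. -/
def schurFunctor (R : Type u) [CommRing R] (G L : Type u) [Ring G] [Algebra R G] [Ring L]
    [Algebra R L] : CommAlgCat.{u} R ⥤ Type u where
  obj A := SchurRep R G L A
  map φ := ↾SchurRep.map φ.hom
  map_id A := by
    ext ρ
    exact Subtype.ext (repMap_id _)
  map_comp φ ψ := by
    ext ρ
    exact Subtype.ext (repMap_comp _ _ _)

instance (R : Type u) [CommRing R] (G L : Type u) [Ring G] [Algebra R G] [Ring L] [Algebra R L]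
    (A : CommAlgCat.{u} R) :
    MulAction ((autFunctor R L).obj A) ((schurFunctor R G L).obj A) :=
  inferInstanceAs (MulAction (Aut R L A) (SchurRep R G L A))

/-! ### The disjoint union of products of Grassmannians and vector bundles -/

/-- An `A`-valued point of the disjoint union, over all tuples `m` of natural numbers with sum
`n ^ 2`, of the products of the Grassmannians of local direct summands of `L` of corank
`n ^ 2 - m i`, for the vertices `i`, and of copies of the vector bundle `L`, one for each arrow.
A morphism from the spectrum of `A` to a disjoint union is a decomposition of the spectrum into
open-and-closed parts together with morphisms from the parts to the summands. As the tuple `m` is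
determined by the ranks of the quotients, this amounts to local direct summands `sub i` such that
each point `p` of the spectrum belongs to the part of some `m`. -/
@[ext]
structure TargetPoint (R : Type u) [CommRing R] (L : Type u) [Ring L] [Algebra R L] (n : ℕ)
    (Δ : Type u) [Quiver.{u} Δ] [Fintype Δ] (A : Type u) [CommRing A] [Algebra R A] where
  sub : Δ → Submodule A (A ⊗[R] L)
  vec : Quiver.Total Δ → A ⊗[R] L
  finite_quotient : ∀ i, Module.Finite A ((A ⊗[R] L) ⧸ sub i)
  projective_quotient : ∀ i, Module.Projective A ((A ⊗[R] L) ⧸ sub i)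
  rank_eq : ∀ p : PrimeSpectrum A, ∃ m : Δ → ℕ, ∑ i, m i = n ^ 2 ∧
    ∀ i, Module.rankAtStalk (R := A) ((A ⊗[R] L) ⧸ sub i) p = n ^ 2 - m i

section Target

variable {R : Type u} [CommRing R] {L : Type u} [Ring L] [Algebra R L]
variable {A B C : Type u} [CommRing A] [Algebra R A] [CommRing B] [Algebra R B]
  [CommRing C] [Algebra R C]

/-- The base change along `A → B` of a submodule of `A ⊗ L`: the submodule of `B ⊗ L` generated
by its image. -/
def subMap (φ : A →ₐ[R] B) (N : Submodule A (A ⊗[R] L)) : Submodule B (B ⊗[R] L) :=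
  Submodule.span B (bc L φ '' N)

lemma subMap_id (N : Submodule A (A ⊗[R] L)) : subMap (AlgHom.id R A) N = N := by
  have : bc L (AlgHom.id R A) '' (N : Set (A ⊗[R] L)) = N := by
    ext z; simp [bc_id]
  rw [subMap, this, Submodule.span_eq]

lemma subMap_comp (ψ : B →ₐ[R] C) (φ : A →ₐ[R] B) (N : Submodule A (A ⊗[R] L)) :
    subMap (ψ.comp φ) N = subMap ψ (subMap φ N) := by
  apply le_antisymm
  · refine Submodule.span_le.2 ?_
    rintro _ ⟨z, hz, rfl⟩
    rw [bc_comp]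
    exact Submodule.subset_span ⟨_, Submodule.subset_span ⟨z, hz, rfl⟩, rfl⟩
  · refine Submodule.span_le.2 ?_
    rintro _ ⟨z, hz, rfl⟩
    refine Submodule.span_induction (p := fun z _ => bc L ψ z ∈ subMap (ψ.comp φ) N)
      ?_ ?_ ?_ ?_ hz
    · rintro _ ⟨x, hx, rfl⟩
      rw [← bc_comp]
      exact Submodule.subset_span ⟨x, hx, rfl⟩
    · simp
    · intro x y _ _ hx hy
      rw [map_add]
      exact add_mem hx hy
    · intro b x _ hx
      rw [bc_smul]
      exact Submodule.smul_mem _ _ hx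

lemma subMap_map (φ : A →ₐ[R] B) (σ : Aut R L A) (N : Submodule A (A ⊗[R] L)) :
    subMap φ (N.map σ.toLinearMap) = (subMap φ N).map (autMap φ σ).toLinearMap := by
  rw [subMap, subMap, Submodule.map_span]
  congr 1
  ext z
  simp

lemma subMap_eq_ker (φ : A →ₐ[R] B) (N : Submodule A (A ⊗[R] L)) :
    letI : Algebra A B := φ.toAlgebra
    letI : IsScalarTower R A B := .of_algebraMap_eq' φ.comp_algebraMap.symm
    subMap φ N = (Module.Grassmannian.baseChangeMkQ B N).ker := by
  let : Algebra A B := φ.toAlgebra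
  have : IsScalarTower R A B := .of_algebraMap_eq' φ.comp_algebraMap.symm
  let e := AlgebraTensorModule.cancelBaseChange R A B B L
  have he (y : A ⊗[R] L) : e (1 ⊗ₜ y) = bc L φ y := by
    induction y with
    | zero => simp
    | tmul c x =>
      simp only [e, AlgebraTensorModule.cancelBaseChange_tmul, bc_tmul]
      rw [Algebra.smul_def, mul_one]; rfl
    | add x y hx hy => rw [tmul_add, map_add, map_add, hx, hy]
  apply le_antisymm
  · refine Submodule.span_le.2 ?_
    rintro _ ⟨z, hz, rfl⟩
    change N.mkQ.baseChange B (e.symm (bc L φ z)) = 0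
    rw [← he, e.symm_apply_apply]
    have : N.mkQ z = 0 := by simpa using hz
    simp only [LinearMap.baseChange_tmul, this, tmul_zero]
  · intro z hz
    change N.mkQ.lTensor B (e.symm z) = 0 at hz
    obtain ⟨t, ht⟩ := (lTensor_exact B (LinearMap.exact_subtype_mkQ N)
      (Submodule.mkQ_surjective N) (e.symm z)).1 hz
    rw [← e.apply_symm_apply z, ← ht]
    clear hz ht
    induction t with
    | zero => simp
    | tmul b x =>
      have : N.subtype.lTensor B (b ⊗ₜ x) = b • ((1 : B) ⊗ₜ[A] (x : A ⊗[R] L)) := by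
        simp [smul_tmul']
      rw [this, map_smul, he]
      exact Submodule.smul_mem _ _ (Submodule.subset_span ⟨_, x.2, rfl⟩)
    | add x y hx hy =>
      rw [map_add, map_add]
      exact add_mem hx hy

variable {n : ℕ} {Δ : Type u} [Quiver.{u} Δ] [Fintype Δ]

/-- The base change along `A → B` of `A`-valued points. -/
def TargetPoint.map (φ : A →ₐ[R] B) (t : TargetPoint R L n Δ A) : TargetPoint R L n Δ B :=
  letI : Algebra A B := φ.toAlgebra
  letI : IsScalarTower R A B := .of_algebraMap_eq' φ.comp_algebraMap.symm
  have e (i : Δ) : ((B ⊗[R] L) ⧸ subMap φ (t.sub i)) ≃ₗ[B] B ⊗[A] ((A ⊗[R] L) ⧸ t.sub i) :=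
    (Submodule.quotEquivOfEq _ _ (subMap_eq_ker φ (t.sub i))).trans
      (Module.Grassmannian.baseChangeMkQEquiv (t.sub i))
  have := t.finite_quotient
  have := t.projective_quotient
  { sub := fun i => subMap φ (t.sub i)
    vec := fun α => bc L φ (t.vec α)
    finite_quotient := fun i => Module.Finite.equiv (e i).symm
    projective_quotient := fun i => Module.Projective.of_equiv (e i).symm
    rank_eq := fun p => by
      obtain ⟨m, hm, h⟩ := t.rank_eq (p.comap (algebraMap A B))
      refine ⟨m, hm, fun i => ?_⟩
      rw [Module.rankAtStalk_eq_of_equiv (e i), Module.rankAtStalk_baseChange, h] }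

/-- Automorphisms `σ` act on `A`-valued points by `σ • (sub, vec) = (σ(sub), σ(vec))`. Identifying
an element `v` of `A ⊗ L` with left multiplication `f` by `v`, the element `σ(v)` corresponds to
`σ ∘ f ∘ σ⁻¹`. -/
instance : MulAction (Aut R L A) (TargetPoint R L n Δ A) where
  smul σ t :=
    have e (i : Δ) : ((A ⊗[R] L) ⧸ t.sub i) ≃ₗ[A]
        ((A ⊗[R] L) ⧸ (t.sub i).map σ.toLinearMap) :=
      Submodule.Quotient.equiv _ _ σ.toLinearEquiv rfl
    have := t.finite_quotient
    have := t.projective_quotient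
    { sub := fun i => (t.sub i).map σ.toLinearMap
      vec := fun α => σ (t.vec α)
      finite_quotient := fun i => Module.Finite.equiv (e i)
      projective_quotient := fun i => Module.Projective.of_equiv (e i)
      rank_eq := fun p => by
        obtain ⟨m, hm, h⟩ := t.rank_eq p
        refine ⟨m, hm, fun i => ?_⟩
        rw [← Module.rankAtStalk_eq_of_equiv (e i), h] }
  one_smul t := by
    refine TargetPoint.ext (funext fun i => ?_) rfl
    exact Submodule.map_id _
  mul_smul σ τ t := by
    refine TargetPoint.ext (funext fun i => ?_) rfl
    exact Submodule.map_comp τ.toLinearMap σ.toLinearMap (t.sub i)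

lemma TargetPoint.smul_sub (σ : Aut R L A) (t : TargetPoint R L n Δ A) (i : Δ) :
    (σ • t).sub i = (t.sub i).map σ.toLinearMap := rfl

lemma TargetPoint.smul_vec (σ : Aut R L A) (t : TargetPoint R L n Δ A) (α : Quiver.Total Δ) :
    (σ • t).vec α = σ (t.vec α) := rfl

lemma TargetPoint.map_smul (φ : A →ₐ[R] B) (σ : Aut R L A) (t : TargetPoint R L n Δ A) :
    TargetPoint.map φ (σ • t) = autMap φ σ • TargetPoint.map φ t :=
  TargetPoint.ext (funext fun i => subMap_map φ σ (t.sub i))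
    (funext fun α => (autMap_bc φ σ (t.vec α)).symm)

end Target

/-- The disjoint union of products of Grassmannians and vector bundles, as a functor on
`R`-algebras. -/
def targetFunctor (R : Type u) [CommRing R] (L : Type u) [Ring L] [Algebra R L] (n : ℕ)
    (Δ : Type u) [Quiver.{u} Δ] [Fintype Δ] : CommAlgCat.{u} R ⥤ Type u where
  obj A := TargetPoint R L n Δ A
  map φ := ↾TargetPoint.map φ.hom
  map_id A := by
    ext t : 3
    refine TargetPoint.ext (funext fun i => ?_) (funext fun α => ?_)
    · exact subMap_id _
    · exact bc_id _
  map_comp φ ψ := by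
    ext t : 3
    refine TargetPoint.ext (funext fun i => ?_) (funext fun α => ?_)
    · exact subMap_comp _ _ _
    · exact bc_comp _ _ _

instance (R : Type u) [CommRing R] (L : Type u) [Ring L] [Algebra R L] (n : ℕ)
    (Δ : Type u) [Quiver.{u} Δ] [Fintype Δ] (A : CommAlgCat.{u} R) :
    MulAction ((autFunctor R L).obj A) ((targetFunctor R L n Δ).obj A) :=
  inferInstanceAs (MulAction (Aut R L A) (TargetPoint R L n Δ A))

/-! ### The morphism from Schur representations to right ideals and arrow elements -/

section Morphism

variable {R : Type u} [CommRing R] {L : Type u} [Ring L] [Algebra R L]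
variable {A B : Type u} [CommRing A] [Algebra R A] [CommRing B] [Algebra R B]

/-- The right ideal `x · (A ⊗ L)`, as an `A`-submodule. -/
def rightIdeal (x : A ⊗[R] L) : Submodule A (A ⊗[R] L) := (LinearMap.mulLeft A x).range

lemma mem_rightIdeal {x z : A ⊗[R] L} : z ∈ rightIdeal x ↔ ∃ y, x * y = z := Iff.rfl

lemma subMap_rightIdeal (φ : A →ₐ[R] B) (x : A ⊗[R] L) :
    subMap φ (rightIdeal x) = rightIdeal (bc L φ x) := by
  apply le_antisymm
  · refine Submodule.span_le.2 ?_
    rintro _ ⟨_, ⟨y, rfl⟩, rfl⟩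
    exact ⟨bc L φ y, by simp⟩
  · rintro _ ⟨y, rfl⟩
    induction y with
    | zero => simp
    | tmul b l =>
      have : b ⊗ₜ[R] l = b • bc L φ ((1 : A) ⊗ₜ[R] l) := by simp [smul_tmul']
      rw [this, map_smul, LinearMap.mulLeft_apply, ← map_mul]
      exact Submodule.smul_mem _ _ (Submodule.subset_span ⟨_, ⟨_, rfl⟩, rfl⟩)
    | add y z hy hz =>
      rw [map_add]
      exact add_mem hy hz

lemma map_rightIdeal (σ : Aut R L A) (x : A ⊗[R] L) :
    (rightIdeal x).map σ.toLinearMap = rightIdeal (σ x) := by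
  ext z
  constructor
  · rintro ⟨_, ⟨y, rfl⟩, rfl⟩
    exact ⟨σ y, by simp⟩
  · rintro ⟨y, rfl⟩
    exact ⟨_, ⟨σ.symm y, rfl⟩, by simp⟩

lemma projective_rightIdeal [Module.Projective R L] {x : A ⊗[R] L} (hx : x * x = x) :
    Module.Projective A (rightIdeal x) := by
  refine Module.Projective.of_split (rightIdeal x).subtype (LinearMap.mulLeft A x).rangeRestrict ?_
  ext ⟨_, ⟨y, rfl⟩⟩
  change x * (x * y) = x * y
  rw [← mul_assoc, hx]

lemma projective_quotient_rightIdeal [Module.Projective R L] {x : A ⊗[R] L} (hx : x * x = x) :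
    Module.Projective A ((A ⊗[R] L) ⧸ rightIdeal x) := by
  refine Module.Projective.of_split
    ((rightIdeal x).liftQ (LinearMap.mulLeft A (1 - x)) ?_) (rightIdeal x).mkQ ?_
  · rintro _ ⟨y, rfl⟩
    simp [← mul_assoc, sub_mul, hx]
  · refine LinearMap.ext fun z => ?_
    obtain ⟨z, rfl⟩ := Submodule.mkQ_surjective _ z
    change Submodule.Quotient.mk ((1 - x) * z) = Submodule.Quotient.mk z
    rw [Submodule.Quotient.eq]
    exact ⟨-z, by rw [LinearMap.mulLeft_apply, sub_mul, one_mul, sub_sub_cancel_left, mul_neg]⟩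

lemma finite_rightIdeal [Module.Finite R L] (x : A ⊗[R] L) : Module.Finite A (rightIdeal x) :=
  Module.Finite.range _

lemma rankAtStalk_quotient_rightIdeal [Module.Finite R L] [Module.Projective R L]
    {x : A ⊗[R] L} (hx : x * x = x) (p : PrimeSpectrum A) :
    Module.rankAtStalk (R := A) ((A ⊗[R] L) ⧸ rightIdeal x) p +
      Module.rankAtStalk (R := A) (rightIdeal x) p = Module.rankAtStalk (R := A) (A ⊗[R] L) p := by
  have := projective_rightIdeal hx
  have := projective_quotient_rightIdeal hx
  have := finite_rightIdeal x
  have hr : rightIdeal x = (LinearMap.mulLeft A (1 - x)).ker := by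
    ext z
    simp only [mem_rightIdeal, LinearMap.mem_ker, LinearMap.mulLeft_apply, sub_mul, one_mul,
      sub_eq_zero]
    constructor
    · rintro ⟨y, rfl⟩
      rw [← mul_assoc, hx]
    · intro h
      exact ⟨z, h.symm⟩
  let e : (A ⊗[R] L) ≃ₗ[A] ((A ⊗[R] L) ⧸ rightIdeal x) × rightIdeal x :=
    LinearEquiv.ofBijective ((rightIdeal x).mkQ.prod (LinearMap.mulLeft A x).rangeRestrict) (by
      constructor
      · rw [← LinearMap.ker_eq_bot, LinearMap.ker_eq_bot']
        intro z hz
        obtain ⟨h1, h2⟩ := Prod.ext_iff.1 hz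
        obtain ⟨y, rfl⟩ : z ∈ rightIdeal x := by simpa using h1
        have h3 : x * (x * y) = 0 := congrArg Subtype.val h2
        rwa [← mul_assoc, hx] at h3
      · rintro ⟨a, ⟨_, ⟨y, rfl⟩⟩⟩
        obtain ⟨a, rfl⟩ := Submodule.mkQ_surjective _ a
        refine ⟨(1 - x) * a + x * y, Prod.ext ?_ (Subtype.ext ?_)⟩
        · change Submodule.Quotient.mk _ = Submodule.Quotient.mk _
          rw [Submodule.Quotient.eq]
          refine ⟨y - a, ?_⟩
          rw [LinearMap.mulLeft_apply]
          noncomm_ring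
        · change x * _ = x * y
          rw [mul_add, ← mul_assoc, ← mul_assoc, mul_sub, hx, mul_one, sub_self, zero_mul,
            zero_add])
  rw [Module.rankAtStalk_eq_of_equiv e, Module.rankAtStalk_prod]
  rfl

lemma sum_rankAtStalk_rightIdeal [Module.Finite R L] [Module.Projective R L]
    {I : Type*} [Fintype I] {x : I → A ⊗[R] L}
    (hx : ∀ i, x i * x i = x i) (hx0 : ∀ i j, i ≠ j → x i * x j = 0) (hx1 : ∑ i, x i = 1)
    (p : PrimeSpectrum A) :
    ∑ i, Module.rankAtStalk (R := A) (rightIdeal (x i)) p =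
      Module.rankAtStalk (R := A) (A ⊗[R] L) p := by
  classical
  have := fun i => projective_rightIdeal (hx i)
  have := fun i => finite_rightIdeal (x i)
  have hmul (i j : I) (y : A ⊗[R] L) : x i * (x j * y) = if i = j then x i * y else 0 := by
    split_ifs with h
    · subst h
      rw [← mul_assoc, hx]
    · rw [← mul_assoc, hx0 i j h, zero_mul]
  let e : (A ⊗[R] L) ≃ₗ[A] (∀ i, rightIdeal (x i)) :=
    LinearEquiv.ofBijective (LinearMap.pi fun i => (LinearMap.mulLeft A (x i)).rangeRestrict) (by
      constructor
      · rw [← LinearMap.ker_eq_bot, LinearMap.ker_eq_bot']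
        intro z hz
        have h (i : I) : x i * z = 0 := congrArg Subtype.val (congrFun hz i)
        rw [← one_mul z, ← hx1, Finset.sum_mul]
        exact Finset.sum_eq_zero fun i _ => h i
      · intro a
        choose y hy using fun i => (a i).2
        refine ⟨∑ j, x j * y j, funext fun i => Subtype.ext ?_⟩
        change x i * ∑ j, x j * y j = (a i).1
        rw [Finset.mul_sum, ← hy i]
        simp [hmul])
  rw [Module.rankAtStalk_eq_of_equiv e, Module.rankAtStalk_pi, finsum_eq_sum_of_fintype]

end Morphism

section Morphism

variable {R : Type u} [CommRing R] {L : Type u} [Ring L] [Algebra R L] {n : ℕ}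
  [IsAzumayaOfDegree R L n] {Δ : Type u} [Quiver.{u} Δ] [Fintype Δ]
variable {A : Type u} [CommRing A] [Algebra R A]

variable (n) in
/-- The point given by the right ideals `ρ(e i) · (A ⊗ L)` and the elements `ρ(f α)`. -/
def toTarget (ρ : A ⊗[R] PathAlgebra R Δ →ₐ[A] A ⊗[R] L) : TargetPoint R L n Δ A :=
  haveI : IsAzumaya R L := IsAzumayaOfDegree.toIsAzumaya n
  have hx (i : Δ) : ρ (1 ⊗ₜ PathAlgebra.e R i) * ρ (1 ⊗ₜ PathAlgebra.e R i) =
      ρ (1 ⊗ₜ PathAlgebra.e R i) := by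
    rw [← map_mul, Algebra.TensorProduct.tmul_mul_tmul, PathAlgebra.e_mul_self, one_mul]
  { sub := fun i => rightIdeal (ρ (1 ⊗ₜ PathAlgebra.e R i))
    vec := fun α => ρ (1 ⊗ₜ PathAlgebra.f R α)
    finite_quotient := fun i => inferInstance
    projective_quotient := fun i => projective_quotient_rightIdeal (hx i)
    rank_eq := fun p => by
      have hA : Module.rankAtStalk (R := A) (A ⊗[R] L) p = n ^ 2 := by
        rw [Module.rankAtStalk_baseChange, IsAzumayaOfDegree.rank_eq (n := n)]
      refine ⟨fun i => Module.rankAtStalk (R := A)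
        (rightIdeal (ρ (1 ⊗ₜ PathAlgebra.e R i))) p, ?_, fun i => ?_⟩
      · rw [sum_rankAtStalk_rightIdeal hx ?_ ?_, hA]
        · intro i j h
          rw [← map_mul, Algebra.TensorProduct.tmul_mul_tmul, PathAlgebra.e_mul_e R h, tmul_zero,
            map_zero]
        · rw [← map_sum, ← tmul_sum, PathAlgebra.sum_e]
          exact map_one ρ
      · have := rankAtStalk_quotient_rightIdeal (hx i) p
        dsimp only
        omega }

end Morphism

/-- The natural transformation that sends a Schur representation `ρ` of the path algebra to the
right ideals `ρ(e i) · (A ⊗ L)` and the elements `ρ(f α)`. -/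
def quiverMorphism (R : Type u) [CommRing R] (L : Type u) [Ring L] [Algebra R L] (n : ℕ)
    [IsAzumayaOfDegree R L n] (Δ : Type u) [Quiver.{u} Δ] [Fintype Δ] :
    schurFunctor R (PathAlgebra R Δ) L ⟶ targetFunctor R L n Δ where
  app A := ↾fun ρ : SchurRep R (PathAlgebra R Δ) L A => toTarget n ρ.1
  naturality A B φ := by
    ext ρ
    have h (x : PathAlgebra R Δ) :
        repMap (PathAlgebra R Δ) L φ.hom ρ.1 (1 ⊗ₜ x) = bc L φ.hom (ρ.1 (1 ⊗ₜ x)) := by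
      rw [repMap_tmul, one_smul]
    refine TargetPoint.ext (funext fun i => ?_) (funext fun α => h _)
    exact (congrArg rightIdeal (h _)).trans (subMap_rightIdeal _ _).symm

/-! ### Schemes -/

/-- The functor of points of an `R`-scheme on the category of `R`-algebras: the value at `A` is
the set of morphisms from the spectrum of `A` over the spectrum of `R`. -/
def points {R : Type u} [CommRing R] (S : Over (Spec (.of R))) : CommAlgCat.{u} R ⥤ Type u :=
  (algSpec (.of R)).rightOp ⋙ yoneda.obj S

/-- The map on functors of points induced by a morphism of `R`-schemes. -/
def pointsMap {R : Type u} [CommRing R] {S T : Over (Spec (.of R))} (f : S ⟶ T) :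
    points S ⟶ points T :=
  Functor.whiskerLeft (algSpec (.of R)).rightOp (yoneda.map f)

/-- The vector bundle of an `R`-module `E`: the spectrum of the symmetric algebra of the dual. -/
def vectorBundle (R : Type u) [CommRing R] (E : Type u) [AddCommGroup E] [Module R E] :
    Over (Spec (.of R)) :=
  (algSpec (.of R)).obj (op (CommAlgCat.of R (SymmetricAlgebra R (Module.Dual R E))))

/-- The `A`-valued point of the vector bundle of `E` given by an element `a` of `A ⊗ E`: on the
dual of `E` it is the evaluation `l ↦ (id ⊗ l) a`. -/
def bundlePoint {R : Type u} [CommRing R] {E : Type u} [AddCommGroup E] [Module R E]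
    (A : CommAlgCat.{u} R) (a : A ⊗[R] E) : (points (vectorBundle R E)).obj A :=
  (algSpec (.of R)).map (CommAlgCat.ofHom (SymmetricAlgebra.lift
    ((TensorProduct.rid R A).toLinearMap ∘ₗ
      LinearMap.applyₗ a ∘ₗ LinearMap.lTensorHom A))).op

attribute [local instance] MvPolynomial.gradedAlgebra in
/-- The projective space of dimension `N` over `R`, with homogeneous coordinate ring the
polynomial ring in `N + 1` variables. -/
def projectiveSpace (R : Type u) [CommRing R] (N : ℕ) : Over (Spec (.of R)) :=
  Over.mk (Proj.toSpecZero (MvPolynomial.homogeneousSubmodule (Fin (N + 1)) R) ≫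
    Spec.map (CommRingCat.ofHom
      (algebraMap R (MvPolynomial.homogeneousSubmodule (Fin (N + 1)) R 0))))

/-- An `R`-scheme is quasiprojective if it admits a quasicompact immersion into some projective
space over `R`. -/
def IsQuasiProjective {R : Type u} [CommRing R] (S : Over (Spec (.of R))) : Prop :=
  ∃ (N : ℕ) (i : S ⟶ projectiveSpace R N), IsImmersion i.left ∧ QuasiCompact i.left

section TargetScheme

variable {R : Type u} [CommRing R] (L : Type u) [Ring L] [Algebra R L] {n : ℕ}
  {Δ : Type u} [Quiver.{u} Δ] [Fintype Δ] [Finite (Quiver.Total Δ)]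

/-- Tuples of natural numbers, indexed by the vertices, with sum `n ^ 2`. -/
def RankVector (n : ℕ) (Δ : Type u) [Fintype Δ] : Type u := {m : Δ → ℕ // ∑ i, m i = n ^ 2}

/-- Given the Grassmannian schemes `𝒢 d` of local direct summands of `L` of corank `d`, the product
over `R` of the `𝒢 (n ^ 2 - m i)`, for the vertices `i`, and of copies of the vector bundle of
`L`, for the arrows. -/
def targetComponent (𝒢 : ℕ → Over (Spec (.of R))) (m : RankVector n Δ) : Over (Spec (.of R)) :=
  (∏ᶜ fun i : Δ => 𝒢 (n ^ 2 - m.1 i)) ⨯ (∏ᶜ fun _ : Quiver.Total Δ => vectorBundle R L)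

variable (n Δ) in
/-- The disjoint union of the `targetComponent`. -/
def targetScheme (𝒢 : ℕ → Over (Spec (.of R))) : Over (Spec (.of R)) :=
  ∐ fun m : RankVector n Δ => targetComponent L 𝒢 m

/-- An identification `e` of the functor of points of the disjoint union with the functor
`targetFunctor` is the canonical one if on each summand it extracts the local direct summands
and the vectors that are the components of a point of the product. -/
def IsCanonical {𝒢 : ℕ → Over (Spec (.of R))}
    (γ : ∀ d, points (𝒢 d) ≅ Module.Grassmannian.functor.{u, u, u} (R := R) (M := L) d)
    (e : points (targetScheme L n Δ 𝒢) ≅ targetFunctor R L n Δ) : Prop :=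
  ∀ (A : CommAlgCat.{u} R) (m : RankVector n Δ)
    (y : (algSpec (.of R)).obj (op A) ⟶ targetComponent L 𝒢 m),
    letI t : TargetPoint R L n Δ A := e.hom.app A (y ≫ Sigma.ι (targetComponent L 𝒢) m)
    (∀ i : Δ, t.sub i =
      Module.Grassmannian.toSubmodule ((γ (n ^ 2 - m.1 i)).hom.app A
        (y ≫ prod.fst ≫ Pi.π (fun i : Δ => 𝒢 (n ^ 2 - m.1 i)) i))) ∧
    (∀ α : Quiver.Total Δ,
      y ≫ prod.snd ≫ Pi.π (fun _ : Quiver.Total Δ => vectorBundle R L) α =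
        bundlePoint A (t.vec α))

end TargetScheme

end QuiverRep

end

noncomputable section

namespace QuiverRep

/-! ### Functors of points -/

section Points

variable {R : Type u} [CommRing R]

/-! Equivariance is immediate, since an automorphism carries the right ideal of `x` to the right
ideal of its image. Everything else is done on points with values in `R`-algebras: natural maps
between functors of points are morphisms (`exists_hom_of_natural`), and conditions that are open on
every spectrum cut out open subschemes (`IsOpenCondition.exists_opens`).

Why the morphism is an immersion: on the target, consider the open locus where the given submodules
of `L` together span `L`. Their ranks add up to `n ^ 2`, the rank of `L`, so on this locus `L` is
their direct sum and `1` decomposes uniquely as a sum of elements of the submodules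
(`TargetPoint.existsUnique_decomposition`). At the image of a representation this decomposition can
only be the one by the idempotents `ρ(e i)`. Hence the values of `ρ` on all generators are recovered
algebraically: the coordinates of the components of `1` and of the arrow elements define a morphism
from the locus to an affine space, and its composite with the map from the Schur representations is
an open immersion followed by a closed one. The first factor of an immersion is an immersion
(`isImmersion_of_quiverMorphism`).

Why the Schur representations form a quasiprojective scheme: `L` is a direct summand of a free
module of rank `r`, so representations of the path algebra are the solutions of polynomial equations
in finitely many unknowns (`exists_universal_rep`). Over a field, choose a linear form `l` with `l 1
≠ 0`. The commutant consists of scalars exactly if it meets the kernel of `l` in zero, which is the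
nonvanishing of an `r × r` minor of a commutator matrix (`hasScalarCommutant_iff`). So the Schur
locus is a finite union of basic open sets in an affine scheme of finite type
(`exists_schurScheme`).

Why the target is a quasiprojective scheme: the condition on the tuples `m` says only that the ranks
of the quotients of `L` have a fixed sum `D` (`exists_sum_eq_iff`). The direct sum of the quotients
is generated by `r` elements for each vertex, and locally some `D` of them form a basis
(`exists_generators_of_rankAtStalk`). Expressing all generators in this basis gives a matrix with a
unit submatrix, and these matrices, together with the coordinates of the arrow elements, fill affine
charts given by equations (`IsChart`). The maximal minors, and their products with the coordinates
of the arrow elements, are homogeneous coordinates (`chartEquiv_iff`, `adjoin_range_plucker`), and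
`exists_isQuasiProjective` turns such data into a scheme immersed in projective space. The
Grassmannians are the case of one submodule and no vectors. Because ranks are locally constant, the
scheme obtained is the disjoint union of the products (`exists_targetScheme_iso`). -/

/-- The spectrum of an `R`-algebra as an `R`-scheme. -/
abbrev specOver (A : CommAlgCat.{u} R) : Over (Spec (.of R)) := (algSpec (.of R)).obj (op A)

/-- The morphism of spectra induced by a homomorphism of `R`-algebras. -/
abbrev specOverMap {A B : CommAlgCat.{u} R} (φ : A ⟶ B) : specOver B ⟶ specOver A :=
  (algSpec (.of R)).map φ.op

lemma specOverMap_comp {A B C : CommAlgCat.{u} R} (φ : A ⟶ B) (ψ : B ⟶ C) :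
    specOverMap (φ ≫ ψ) = specOverMap ψ ≫ specOverMap φ := by
  simp [specOverMap]

lemma exists_specOverMap {A B : CommAlgCat.{u} R} (x : specOver B ⟶ specOver A) :
    ∃ φ : A ⟶ B, x = specOverMap φ :=
  ⟨((algSpec.fullyFaithful (R := .of R)).preimage x).unop,
    ((algSpec.fullyFaithful (R := .of R)).map_preimage x).symm⟩

lemma specOverMap_injective {A B : CommAlgCat.{u} R} {φ ψ : A ⟶ B}
    (h : specOverMap φ = specOverMap ψ) : φ = ψ :=
  Quiver.Hom.op_inj ((algSpec.fullyFaithful (R := .of R)).map_injective h)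

/-- The ring `B` as an `R`-algebra, by means of a morphism from its spectrum. -/
def algebraOfHom (B : CommRingCat.{u}) (g : Spec B ⟶ Spec (.of R)) : CommAlgCat.{u} R :=
  letI := (Spec.preimage g).hom.toAlgebra
  CommAlgCat.of R B

lemma algebraOfHom_hom (B : CommRingCat.{u}) (g : Spec B ⟶ Spec (.of R)) :
    (specOver (algebraOfHom B g)).hom = g :=
  Spec.map_preimage g

/-- A morphism from an affine scheme to an `R`-scheme as a point of the `R`-scheme. -/
def pointOfHom (S : Over (Spec (.of R))) {B : CommRingCat.{u}} (x : Spec B ⟶ S.left) :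
    specOver (algebraOfHom B (x ≫ S.hom)) ⟶ S :=
  Over.homMk x (algebraOfHom_hom B (x ≫ S.hom)).symm

/-- The members of an affine open cover of the source are themselves points with values in algebras.
-/
lemma hom_ext_of_points {S T : Over (Spec (.of R))} {f g : S ⟶ T}
    (h : ∀ (A : CommAlgCat.{u} R) (x : specOver A ⟶ S), x ≫ f = x ≫ g) : f = g := by
  refine Over.OverMorphism.ext (S.left.affineOpenCover.openCover.hom_ext _ _ fun i => ?_)
  exact congrArg CommaMorphism.left (h _ (pointOfHom S (S.left.affineOpenCover.f i)))

lemma Over.hom_ext_of_cover {S T : Over (Spec (.of R))} {ι : Type*} {U : ι → Over (Spec (.of R))}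
    (u : ∀ i, U i ⟶ S) (hu : ∀ i, IsOpenImmersion (u i).left)
    (hcov : ∀ s : S.left, ∃ i, s ∈ Set.range (u i).left) {f g : S ⟶ T}
    (h : ∀ i, u i ≫ f = u i ≫ g) : f = g := by
  let 𝒰 : S.left.OpenCover := Scheme.Cover.mkOfCovers ι (fun i => (U i).left)
    (fun i => (u i).left) hcov hu
  exact Over.OverMorphism.ext (𝒰.hom_ext _ _ fun i => congrArg CommaMorphism.left (h i))

/-- Morphisms on the members of an open cover that agree on points glue. -/
lemma Over.exists_hom_of_cover {S T : Over (Spec (.of R))} {ι : Type*}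
    {U : ι → Over (Spec (.of R))}
    (u : ∀ i, U i ⟶ S) (hu : ∀ i, IsOpenImmersion (u i).left)
    (hcov : ∀ s : S.left, ∃ i, s ∈ Set.range (u i).left) (x : ∀ i, U i ⟶ T)
    (h : ∀ (i j) (A : CommAlgCat.{u} R) (a : specOver A ⟶ U i) (b : specOver A ⟶ U j),
      a ≫ u i = b ≫ u j → a ≫ x i = b ≫ x j) :
    ∃ f : S ⟶ T, ∀ i, u i ≫ f = x i := by
  let 𝒰 : S.left.OpenCover := Scheme.Cover.mkOfCovers ι (fun i => (U i).left)
    (fun i => (u i).left) hcov hu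
  -- The overlaps need not be affine, so agreement on them is tested on their points.
  have hc (i j) : pullback.fst (𝒰.f i) (𝒰.f j) ≫ (x i).left =
      pullback.snd (𝒰.f i) (𝒰.f j) ≫ (x j).left := by
    let P : Over (Spec (.of R)) := Over.mk (pullback.fst (𝒰.f i) (𝒰.f j) ≫ (U i).hom)
    let a : P ⟶ U i := Over.homMk (pullback.fst (𝒰.f i) (𝒰.f j)) rfl
    let b : P ⟶ U j := Over.homMk (pullback.snd (𝒰.f i) (𝒰.f j)) (by
      change _ ≫ (U j).hom = pullback.fst (𝒰.f i) (𝒰.f j) ≫ (U i).hom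
      rw [← Over.w (u i), ← Over.w (u j)]
      exact (pullback.condition_assoc (f := 𝒰.f i) (g := 𝒰.f j) S.hom).symm)
    have hab : a ≫ u i = b ≫ u j :=
      Over.OverMorphism.ext (pullback.condition (f := 𝒰.f i) (g := 𝒰.f j))
    have : a ≫ x i = b ≫ x j := hom_ext_of_points fun A y => by
      simpa using h i j A (y ≫ a) (y ≫ b) (by simp [hab])
    exact congrArg CommaMorphism.left this
  have hg (i) : (u i).left ≫ 𝒰.glueMorphisms (fun i => (x i).left) hc = (x i).left :=
    𝒰.ι_glueMorphisms (fun i => (x i).left) hc i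
  refine ⟨Over.homMk (𝒰.glueMorphisms (fun i => (x i).left) hc) ?_, fun i => ?_⟩
  · refine 𝒰.hom_ext _ _ fun i => ?_
    change (u i).left ≫ _ = (u i).left ≫ _
    rw [reassoc_of% (hg i), Over.w, Over.w]
  · exact Over.OverMorphism.ext (hg i)

/-- The localization of an `R`-algebra at the powers of an element. -/
abbrev away (A : CommAlgCat.{u} R) (f : A) : CommAlgCat.{u} R :=
  CommAlgCat.of R (Localization.Away f)

/-- The localization homomorphism. -/
abbrev toAway (A : CommAlgCat.{u} R) (f : A) : A ⟶ away A f :=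
  CommAlgCat.ofHom (IsScalarTower.toAlgHom R A (Localization.Away f))

instance (A : CommAlgCat.{u} R) (f : A) : IsOpenImmersion (specOverMap (toAway A f)).left :=
  inferInstanceAs (IsOpenImmersion (Spec.map (CommRingCat.ofHom
    (algebraMap A (Localization.Away f)))))

lemma range_specOverMap_toAway (A : CommAlgCat.{u} R) (f : A) :
    Set.range (specOverMap (toAway A f)).left = {p : PrimeSpectrum A | f ∉ p.asIdeal} :=
  PrimeSpectrum.localization_away_comap_range (Localization.Away f) f

lemma points_ext_of_local {T : Over (Spec (.of R))} {A : CommAlgCat.{u} R}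
    {x y : specOver A ⟶ T} (h : ∀ p : PrimeSpectrum A, ∃ f ∉ p.asIdeal,
      specOverMap (toAway A f) ≫ x = specOverMap (toAway A f) ≫ y) : x = y := by
  choose f hf hxy using h
  refine Over.hom_ext_of_cover (fun p => specOverMap (toAway A (f p))) (fun p => inferInstance)
    (fun p => ⟨p, ?_⟩) hxy
  rw [range_specOverMap_toAway]
  exact hf p

lemma exists_lift_of_range_subset {S U V : Over (Spec (.of R))} (u : U ⟶ S)
    [IsOpenImmersion u.left] (x : V ⟶ S)
    (hx : Set.range x.left ⊆ Set.range u.left) : ∃ a : V ⟶ U, a ≫ u = x := by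
  refine ⟨Over.homMk (IsOpenImmersion.lift u.left x.left hx) ?_, ?_⟩
  · rw [← Over.w u, IsOpenImmersion.lift_fac_assoc, Over.w]
  · exact Over.OverMorphism.ext (IsOpenImmersion.lift_fac _ _ _)

lemma exists_basicOpen_of_isOpen {A : Type*} [CommRing A] {U : Set (PrimeSpectrum A)}
    (hU : IsOpen U) {p : PrimeSpectrum A} (hp : p ∈ U) :
    ∃ f ∉ p.asIdeal, ∀ q : PrimeSpectrum A, f ∉ q.asIdeal → q ∈ U := by
  obtain ⟨_, ⟨f, rfl⟩, hpf, hf⟩ :=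
    PrimeSpectrum.isTopologicalBasis_basic_opens.exists_subset_of_mem_open hp hU
  exact ⟨f, hpf, fun q hq => hf hq⟩

/-- Locally around a preimage of the image of an open immersion, a point lifts. -/
lemma exists_lift_of_mem_range {S U : Over (Spec (.of R))} (u : U ⟶ S)
    [IsOpenImmersion u.left] {A : CommAlgCat.{u} R} (x : specOver A ⟶ S) (p : PrimeSpectrum A)
    (hp : x.left p ∈ Set.range u.left) :
    ∃ f ∉ p.asIdeal, ∃ a : specOver (away A f) ⟶ U, specOverMap (toAway A f) ≫ x = a ≫ u := by
  have ho : IsOpen (x.left ⁻¹' Set.range u.left) :=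
    u.left.isOpenEmbedding.isOpen_range.preimage x.left.continuous
  obtain ⟨f, hpf, hf⟩ := exists_basicOpen_of_isOpen (A := A) ho hp
  obtain ⟨a, ha⟩ := exists_lift_of_range_subset u (specOverMap (toAway A f) ≫ x) (by
    rintro _ ⟨q, rfl⟩
    rw [Over.comp_left, Scheme.Hom.comp_apply]
    refine hf _ ?_
    have : (specOverMap (toAway A f)).left q ∈ Set.range (specOverMap (toAway A f)).left := ⟨q, rfl⟩
    rwa [range_specOverMap_toAway] at this)
  exact ⟨f, hpf, a, ha.symm⟩

/-- A family of maps on points that is natural comes from a morphism. -/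
lemma exists_hom_of_natural {S T : Over (Spec (.of R))}
    (θ : ∀ A : CommAlgCat.{u} R, (specOver A ⟶ S) → (specOver A ⟶ T))
    (hθ : ∀ (A B : CommAlgCat.{u} R) (φ : A ⟶ B) (y : specOver A ⟶ S),
      θ B (specOverMap φ ≫ y) = specOverMap φ ≫ θ A y) :
    ∃ f : S ⟶ T, ∀ (A : CommAlgCat.{u} R) (y : specOver A ⟶ S), y ≫ f = θ A y := by
  -- Every morphism between spectra comes from a homomorphism of algebras, so naturality holds for
  -- all of them. Applied to the affine cover `u`, it shows that the images of the members of the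
  -- cover agree on overlaps.
  have he (A B : CommAlgCat.{u} R) (a : specOver A ⟶ specOver B) (y : specOver B ⟶ S) :
      θ A (a ≫ y) = a ≫ θ B y := by
    obtain ⟨φ, rfl⟩ := exists_specOverMap a
    exact hθ _ _ φ y
  obtain ⟨ι, B, u, hu, hcov⟩ : ∃ (ι : Type u) (B : ι → CommAlgCat.{u} R)
      (u : ∀ i, specOver (B i) ⟶ S), (∀ i, IsOpenImmersion (u i).left) ∧
      ∀ s : S.left, ∃ i, s ∈ Set.range (u i).left :=
    ⟨_, _, fun i => pointOfHom S (S.left.affineOpenCover.f i),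
      fun i => S.left.affineOpenCover.map_prop i, fun s => ⟨_, S.left.affineOpenCover.covers s⟩⟩
  obtain ⟨f, hf⟩ := Over.exists_hom_of_cover u hu hcov (fun i => θ _ (u i))
    (fun i j A a b hab => by rw [← he, ← he, hab])
  refine ⟨f, fun A y => points_ext_of_local fun p => ?_⟩
  obtain ⟨i, hi⟩ := hcov (y.left p)
  have := hu i
  obtain ⟨g, hg, a, ha⟩ := exists_lift_of_mem_range (u i) y p hi
  refine ⟨g, hg, ?_⟩
  rw [← hθ, reassoc_of% ha, hf, ← he, ha]

/-! ### Zariski sheaves on the category of algebras -/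

lemma exists_away_lift {A B : CommAlgCat.{u} R} (φ : A ⟶ B) (f : A) (hf : IsUnit (φ.hom f)) :
    ∃ φ' : away A f ⟶ B, toAway A f ≫ φ' = φ := by
  have hg : ∀ y : Submonoid.powers f, IsUnit (φ.hom y) := by
    rintro ⟨_, n, rfl⟩
    exact (map_pow φ.hom f n) ▸ hf.pow n
  refine ⟨CommAlgCat.ofHom (IsLocalization.liftAlgHom (S := Localization.Away f) hg), ?_⟩
  ext a
  exact IsLocalization.lift_eq hg a

lemma isUnit_toAway (A : CommAlgCat.{u} R) (f : A) : IsUnit ((toAway A f).hom f) :=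
  IsLocalization.Away.algebraMap_isUnit (S := Localization.Away f) f

lemma exists_awayMap {A B : CommAlgCat.{u} R} (φ : A ⟶ B) (f : A) :
    ∃ φ' : away A f ⟶ away B (φ.hom f), toAway A f ≫ φ' = φ ≫ toAway B (φ.hom f) :=
  exists_away_lift _ f (isUnit_toAway B (φ.hom f))

/-- Elements with restrictions that agree on a cover by basic open sets are equal. -/
def IsZariskiSeparated (F : CommAlgCat.{u} R ⥤ Type u) : Prop :=
  ∀ (A : CommAlgCat.{u} R) (x y : F.obj A), (∀ p : PrimeSpectrum A, ∃ f ∉ p.asIdeal,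
    F.map (toAway A f) x = F.map (toAway A f) y) → x = y

/-- Compatible elements on a cover by basic open sets glue. -/
def IsZariskiGluing (F : CommAlgCat.{u} R ⥤ Type u) : Prop :=
  ∀ (A : CommAlgCat.{u} R) (f : PrimeSpectrum A → A) (_ : ∀ p, f p ∉ p.asIdeal)
    (x : ∀ p, F.obj (away A (f p))),
    (∀ (p q) (B : CommAlgCat.{u} R) (φ : away A (f p) ⟶ B) (ψ : away A (f q) ⟶ B),
      toAway A (f p) ≫ φ = toAway A (f q) ≫ ψ → F.map φ (x p) = F.map ψ (x q)) →
    ∃ y : F.obj A, ∀ p, F.map (toAway A (f p)) y = x p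

lemma isZariskiSeparated_points (S : Over (Spec (.of R))) : IsZariskiSeparated (points S) :=
  fun _ _ _ h => points_ext_of_local h

lemma isZariskiGluing_points (S : Over (Spec (.of R))) : IsZariskiGluing (points S) :=
  fun A f hf x hx => Over.exists_hom_of_cover (fun p => specOverMap (toAway A (f p)))
    (fun p => inferInstance) (fun p => ⟨p, by rw [range_specOverMap_toAway]; exact hf p⟩) x
    (fun p q B a b hab => by
      obtain ⟨φ, rfl⟩ := exists_specOverMap a
      obtain ⟨ψ, rfl⟩ := exists_specOverMap b
      refine hx p q B φ ψ (specOverMap_injective ?_)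
      rw [specOverMap_comp, specOverMap_comp, hab])

/-- Every element comes locally from the source. -/
def IsLocallySurjective {C F : CommAlgCat.{u} R ⥤ Type u} (h : C ⟶ F) : Prop :=
  ∀ (A : CommAlgCat.{u} R) (x : F.obj A) (p : PrimeSpectrum A), ∃ f ∉ p.asIdeal,
    ∃ c : C.obj (away A f), h.app _ c = F.map (toAway A f) x

lemma natTrans_ext_of_isLocallySurjective {C F G : CommAlgCat.{u} R ⥤ Type u} {h : C ⟶ F}
    (hh : IsLocallySurjective h) (hG : IsZariskiSeparated G) {θ θ' : F ⟶ G}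
    (e : h ≫ θ = h ≫ θ') : θ = θ' := by
  ext A x
  refine hG A _ _ fun p => ?_
  obtain ⟨f, hf, c, hc⟩ := hh A x p
  refine ⟨f, hf, ?_⟩
  change G.map _ (θ.app A x) = G.map _ (θ'.app A x)
  rw [← NatTrans.naturality_apply, ← NatTrans.naturality_apply, ← hc]
  exact congrArg (fun η : C ⟶ G => η.app _ c) e

/-- Lift an element locally to the source, apply `z` and glue. By `hz` the result does not depend on
the lifts, which gives agreement on overlaps as well as naturality. -/
lemma exists_natTrans_of_isLocallySurjective {C F G : CommAlgCat.{u} R ⥤ Type u} {h : C ⟶ F}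
    (hh : IsLocallySurjective h) (hG : IsZariskiSeparated G) (hG' : IsZariskiGluing G)
    {z : C ⟶ G} (hz : ∀ (A : CommAlgCat.{u} R) (c c' : C.obj A),
      h.app A c = h.app A c' → z.app A c = z.app A c') :
    ∃ θ : F ⟶ G, h ≫ θ = z := by
  -- The value `y` is characterized by all lifts over all base changes, not only by the chosen ones.
  -- Naturality then needs no further choice.
  have key (A : CommAlgCat.{u} R) (x : F.obj A) : ∃ y : G.obj A,
      ∀ (B : CommAlgCat.{u} R) (φ : A ⟶ B) (c : C.obj B), h.app B c = F.map φ x →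
        z.app B c = G.map φ y := by
    choose f hf c hc using hh A x
    obtain ⟨y, hy⟩ := hG' A f hf (fun p => z.app _ (c p)) fun p q B φ ψ e => by
      rw [← NatTrans.naturality_apply, ← NatTrans.naturality_apply]
      refine hz _ _ _ ?_
      rw [NatTrans.naturality_apply, NatTrans.naturality_apply, hc, hc, ← Functor.map_comp_apply,
        ← Functor.map_comp_apply, e]
    refine ⟨y, fun B φ d hd => hG B _ _ fun q => ?_⟩
    -- The chosen cover of the spectrum of `A` is pulled back along `φ`.
    let p : PrimeSpectrum A := q.comap φ.hom.toRingHom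
    obtain ⟨φ', hφ'⟩ := exists_awayMap φ (f p)
    refine ⟨φ.hom (f p), hf p, ?_⟩
    rw [← Functor.map_comp_apply, ← hφ', Functor.map_comp_apply, hy,
      ← NatTrans.naturality_apply, ← NatTrans.naturality_apply]
    refine hz _ _ _ ?_
    rw [NatTrans.naturality_apply, NatTrans.naturality_apply, hd, hc, ← Functor.map_comp_apply,
      ← Functor.map_comp_apply, hφ']
  choose θ hθ using key
  refine ⟨{ app := fun A => ↾(θ A), naturality := fun A B φ => ?_ }, ?_⟩
  · ext x
    refine hG B _ _ fun p => ?_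
    obtain ⟨f, hf, c, hc⟩ := hh B (F.map φ x) p
    refine ⟨f, hf, ?_⟩
    have h1 := hθ B (F.map φ x) _ (toAway B f) c hc
    have h2 := hθ A x _ (φ ≫ toAway B f) c (by rw [hc, Functor.map_comp_apply])
    rw [Functor.map_comp_apply] at h2
    exact h1.symm.trans h2
  · ext A c
    have := hθ A (h.app A c) A (𝟙 A) c (by simp)
    rw [Functor.map_id_apply] at this
    exact this.symm

/-- Both sheaves are the quotient of `C` by the same equivalence relation. -/
lemma exists_iso_of_isLocallySurjective {C F G : CommAlgCat.{u} R ⥤ Type u} {h : C ⟶ F}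
    {z : C ⟶ G} (hh : IsLocallySurjective h) (hz : IsLocallySurjective z)
    (hF : IsZariskiSeparated F) (hF' : IsZariskiGluing F)
    (hG : IsZariskiSeparated G) (hG' : IsZariskiGluing G)
    (H : ∀ (A : CommAlgCat.{u} R) (c c' : C.obj A),
      h.app A c = h.app A c' ↔ z.app A c = z.app A c') :
    ∃ e : F ≅ G, h ≫ e.hom = z := by
  obtain ⟨θ, hθ⟩ := exists_natTrans_of_isLocallySurjective hh hG hG' fun A c c' => (H A c c').1
  obtain ⟨θ', hθ'⟩ := exists_natTrans_of_isLocallySurjective hz hF hF' fun A c c' => (H A c c').2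
  refine ⟨⟨θ, θ', natTrans_ext_of_isLocallySurjective hh hF ?_,
    natTrans_ext_of_isLocallySurjective hz hG ?_⟩, hθ⟩
  · rw [reassoc_of% hθ, hθ', Category.comp_id]
  · rw [reassoc_of% hθ', hθ, Category.comp_id]

/-! ### Open conditions -/

/-- A condition on points that defines, on the spectrum of each algebra, an open subset. -/
def IsOpenCondition {T : Over (Spec (.of R))}
    (P : ∀ A : CommAlgCat.{u} R, (specOver A ⟶ T) → Prop) : Prop :=
  ∀ (A : CommAlgCat.{u} R) (x : specOver A ⟶ T), ∃ U : Set (PrimeSpectrum A), IsOpen U ∧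
    ∀ (B : CommAlgCat.{u} R) (φ : A ⟶ B), P B (specOverMap φ ≫ x) ↔
      ∀ q : PrimeSpectrum B, q.comap φ.hom.toRingHom ∈ U

/-- The open set is the union of the images of the open sets belonging to an affine cover. That
these are compatible is checked one point at a time. -/
lemma IsOpenCondition.exists_opens {T : Over (Spec (.of R))}
    {P : ∀ A : CommAlgCat.{u} R, (specOver A ⟶ T) → Prop} (hP : IsOpenCondition P) :
    ∃ V : T.left.Opens, ∀ (A : CommAlgCat.{u} R) (x : specOver A ⟶ T),
      P A x ↔ Set.range x.left ⊆ V := by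
  choose U hU hPU using hP
  obtain ⟨ι, B, u, hu, hcov⟩ : ∃ (ι : Type u) (B : ι → CommAlgCat.{u} R)
      (u : ∀ i, specOver (B i) ⟶ T), (∀ i, IsOpenImmersion (u i).left) ∧
      ∀ s : T.left, ∃ i, s ∈ Set.range (u i).left :=
    ⟨_, _, fun i => pointOfHom T (T.left.affineOpenCover.f i),
      fun i => T.left.affineOpenCover.map_prop i, fun s => ⟨_, T.left.affineOpenCover.covers s⟩⟩
  refine ⟨⟨⋃ i, (u i).left '' U _ (u i), isOpen_iUnion fun i =>
    (u i).left.isOpenEmbedding.isOpenMap _ (hU _ (u i))⟩, fun A x => ?_⟩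
  have key (p : PrimeSpectrum A) (i : ι) (hi : x.left p ∈ Set.range (u i).left) :
      p ∈ U A x ↔ x.left p ∈ (u i).left '' U _ (u i) := by
    have := hu i
    obtain ⟨f, hf, a, ha⟩ := exists_lift_of_mem_range (u i) x p hi
    obtain ⟨ψ, rfl⟩ := exists_specOverMap a
    obtain ⟨p', rfl⟩ : p ∈ Set.range (specOverMap (toAway A f)).left := by
      rw [range_specOverMap_toAway]; exact hf
    let p' : PrimeSpectrum (away A f) := p'
    -- Over a residue field the spectrum is a single point, so the condition says just that this
    -- point lies in the open set. As the condition depends only on the morphism to `T`, the open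
    -- sets of `x` and of `u i` agree there.
    let K : CommAlgCat.{u} R := CommAlgCat.of R p'.asIdeal.ResidueField
    let κ : away A f ⟶ K :=
      CommAlgCat.ofHom (IsScalarTower.toAlgHom R (away A f) p'.asIdeal.ResidueField)
    have hκ (q : PrimeSpectrum K) : q.comap κ.hom.toRingHom = p' := by
      ext1
      change q.asIdeal.comap (algebraMap (away A f) p'.asIdeal.ResidueField) = p'.asIdeal
      rw [(q.asIdeal : Ideal p'.asIdeal.ResidueField).eq_bot_of_prime]
      exact Ideal.ker_algebraMap_residueField _
    have h1 := hPU A x K (toAway A f ≫ κ)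
    have h2 := hPU _ (u i) K (ψ ≫ κ)
    rw [specOverMap_comp, Category.assoc, ha] at h1
    rw [specOverMap_comp, Category.assoc, h1] at h2
    have hq : Nonempty (PrimeSpectrum K) :=
      inferInstanceAs (Nonempty (PrimeSpectrum p'.asIdeal.ResidueField))
    have h3 : (∀ q : PrimeSpectrum K, q.comap (toAway A f ≫ κ).hom.toRingHom ∈ U A x) ↔
        (specOverMap (toAway A f)).left p' ∈ U A x := by
      have (q : PrimeSpectrum K) : q.comap (toAway A f ≫ κ).hom.toRingHom =
        (specOverMap (toAway A f)).left p' := congrArg (specOverMap (toAway A f)).left (hκ q)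
      simp only [this, forall_const]
      exact Iff.rfl
    have h4 : (∀ q : PrimeSpectrum K, q.comap (ψ ≫ κ).hom.toRingHom ∈ U _ (u i)) ↔
        (specOverMap ψ).left p' ∈ U _ (u i) := by
      have (q : PrimeSpectrum K) : q.comap (ψ ≫ κ).hom.toRingHom =
        (specOverMap ψ).left p' := congrArg (specOverMap ψ).left (hκ q)
      simp only [this, forall_const]
      exact Iff.rfl
    have h5 : x.left ((specOverMap (toAway A f)).left p') = (u i).left ((specOverMap ψ).left p') :=
      congrArg (fun y : specOver (away A f) ⟶ T => y.left p') ha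
    rw [h5]
    exact (h3.symm.trans (h2.trans h4)).trans
      (u i).left.isOpenEmbedding.injective.mem_set_image.symm
  have h0 := hPU A x A (𝟙 A)
  rw [show specOverMap (𝟙 A) ≫ x = x by simp [specOverMap]] at h0
  rw [h0]
  constructor
  · rintro h _ ⟨p, rfl⟩
    obtain ⟨i, hi⟩ := hcov (x.left p)
    exact Set.mem_iUnion.2 ⟨i, (key p i hi).1 (h p)⟩
  · intro h p
    obtain ⟨i, hi⟩ := Set.mem_iUnion.1 (h ⟨p, rfl⟩)
    exact (key p i (Set.image_subset_range _ _ hi)).2 hi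

end Points

/-! ### Points of projective space -/

section ProjectiveSpace

open HomogeneousLocalization MvPolynomial

attribute [local instance] MvPolynomial.gradedAlgebra

variable {R : Type u} [CommRing R] {N : ℕ}

lemma aeval_smul_of_isHomogeneous {σ A : Type*} [CommRing A] [Algebra R A] {F : MvPolynomial σ R}
    {n : ℕ} (hF : F.IsHomogeneous n) (u : A) (c : σ → A) :
    aeval (u • c) F = u ^ n * aeval c F := by
  rw [aeval_def, aeval_def, eval₂_eq, eval₂_eq, Finset.mul_sum]
  refine Finset.sum_congr rfl fun d hd => ?_
  have : ∏ i ∈ d.support, (u • c) i ^ d i = u ^ n * ∏ i ∈ d.support, c i ^ d i := by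
    simp only [Pi.smul_apply, smul_eq_mul, mul_pow, Finset.prod_mul_distrib, Finset.prod_pow_eq_pow_sum]
    rw [← hF.degree_eq_sum_deg_support hd]
  rw [this]
  ring

variable (R N) in
/-- The grading of the homogeneous coordinate ring of projective space. -/
abbrev coordGrading : ℕ → Submodule R (MvPolynomial (Fin (N + 1)) R) :=
  homogeneousSubmodule (Fin (N + 1)) R

/-! ### Values of fractions of degree zero at homogeneous coordinates -/

section Eval

variable {A : Type u} [CommRing A] [Algebra R A]

/-- Evaluation of fractions of degree zero at homogeneous coordinates where the denominator
is invertible. -/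
def awayEval (c : Fin (N + 1) → A) (F : MvPolynomial (Fin (N + 1)) R) (hF : IsUnit (aeval c F)) :
    Away (coordGrading R N) F →+* A :=
  (IsLocalization.Away.lift (S := Localization.Away F) F (g := (aeval c).toRingHom) hF).comp
    (algebraMap (Away (coordGrading R N) F) (Localization.Away F))

lemma awayEval_mk_mul (c : Fin (N + 1) → A) {F : MvPolynomial (Fin (N + 1)) R}
    (hF : IsUnit (aeval c F)) {m : ℕ} (hm : F ∈ coordGrading R N m) (n : ℕ)
    (x : MvPolynomial (Fin (N + 1)) R) (hx : x ∈ coordGrading R N (n • m)) :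
    awayEval c F hF (Away.mk (coordGrading R N) hm n x hx) * aeval c F ^ n = aeval c x := by
  rw [awayEval, RingHom.comp_apply, HomogeneousLocalization.algebraMap_apply, Away.val_mk, Localization.mk_eq_mk']
  have h1 : aeval c F ^ n = IsLocalization.Away.lift (S := Localization.Away F) F
      (g := (aeval c).toRingHom) hF (algebraMap _ _ (F ^ n)) := by
    rw [IsLocalization.Away.lift_eq]; simp
  rw [h1, ← map_mul, IsLocalization.mk'_spec_mk, IsLocalization.Away.lift_eq]
  rfl

/-- Each fraction of degree zero is `x / F ^ n`, and the value of `F` is a unit. -/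
lemma ringHom_away_ext {F : MvPolynomial (Fin (N + 1)) R} {m : ℕ} (hm : F ∈ coordGrading R N m)
    {c : Fin (N + 1) → A} {hF : IsUnit (aeval c F)}
    {g : Away (coordGrading R N) F →+* A}
    (h : ∀ (n : ℕ) (x : MvPolynomial (Fin (N + 1)) R) (hx : x ∈ coordGrading R N (n • m)),
      g (Away.mk (coordGrading R N) hm n x hx) * aeval c F ^ n = aeval c x) :
    g = awayEval c F hF := by
  ext z
  obtain ⟨n, x, hx, rfl⟩ := Away.mk_surjective _ hm z
  refine (hF.pow n).mul_right_cancel ?_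
  rw [h, awayEval_mk_mul]

/-- Numerator and denominator have the same degree, so the powers of `u` cancel. -/
lemma awayEval_smul {u : A} (hu : IsUnit u) (c : Fin (N + 1) → A)
    {F : MvPolynomial (Fin (N + 1)) R} {m : ℕ} (hm : F ∈ coordGrading R N m)
    (hF : IsUnit (aeval c F)) (hF' : IsUnit (aeval (u • c) F)) :
    awayEval (u • c) F hF' = awayEval c F hF := by
  refine ringHom_away_ext hm fun n x hx => ?_
  have h := awayEval_mk_mul (u • c) hF' hm n x hx
  rw [aeval_smul_of_isHomogeneous hm, aeval_smul_of_isHomogeneous hx, mul_pow, ← pow_mul,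
    smul_eq_mul, mul_comm m n] at h
  refine (hu.pow (n * m)).mul_left_cancel ?_
  rw [← h]
  ring

lemma awayEval_comp_awayMap (c : Fin (N + 1) → A) {F G : MvPolynomial (Fin (N + 1)) R} {m k : ℕ}
    (hm : F ∈ coordGrading R N m) (hk : G ∈ coordGrading R N k) (hF : IsUnit (aeval c F))
    (hFG : IsUnit (aeval c (F * G))) :
    (awayEval c (F * G) hFG).comp (awayMap (coordGrading R N) hk rfl) = awayEval c F hF := by
  refine ringHom_away_ext hm fun n x hx => ?_
  rw [RingHom.comp_apply, awayMap_mk]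
  have hG : IsUnit (aeval c G) := by
    rw [map_mul] at hFG
    exact isUnit_of_mul_isUnit_right hFG
  have h := awayEval_mk_mul c hFG (SetLike.mul_mem_graded hm hk) n (x * G ^ n) (by
    rw [smul_add]
    exact SetLike.mul_mem_graded hx (SetLike.pow_mem_graded n hk))
  rw [map_mul, map_mul, map_pow, mul_pow, ← mul_assoc] at h
  exact (hG.pow n).mul_right_cancel h

lemma comp_awayEval {B : Type u} [CommRing B] [Algebra R B] (φ : A →ₐ[R] B)
    (c : Fin (N + 1) → A) {F : MvPolynomial (Fin (N + 1)) R} {m : ℕ}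
    (hm : F ∈ coordGrading R N m) (hF : IsUnit (aeval c F))
    (hF' : IsUnit (aeval (φ ∘ c) F)) :
    φ.toRingHom.comp (awayEval c F hF) = awayEval (φ ∘ c) F hF' := by
  have h (x : MvPolynomial (Fin (N + 1)) R) : aeval (φ ∘ c) x = φ (aeval c x) := by
    rw [← AlgHom.comp_apply, comp_aeval]; rfl
  refine ringHom_away_ext hm fun n x hx => ?_
  rw [h, h, ← awayEval_mk_mul c hF hm n x hx, map_mul, map_pow]
  rfl

lemma awayEval_fromZero (c : Fin (N + 1) → A) {F : MvPolynomial (Fin (N + 1)) R}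
    (hF : IsUnit (aeval c F)) (r : R) :
    awayEval c F hF (fromZeroRingHom (coordGrading R N) _
      (algebraMap R (coordGrading R N 0) r)) = algebraMap R A r := by
  rw [awayEval, RingHom.comp_apply, HomogeneousLocalization.algebraMap_apply]
  have h : (fromZeroRingHom (coordGrading R N) (Submonoid.powers F)
      (algebraMap R (coordGrading R N 0) r)).val =
      algebraMap _ (Localization.Away F) (algebraMap R _ r) :=
    Localization.mk_one_eq_algebraMap _
  rw [h, IsLocalization.Away.lift_eq]
  exact (aeval c).commutes r

end Eval

variable (R N) in
/-- The structure of an `R`-algebra on the ring of fractions of degree zero. -/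
@[reducible] def awayAlgebra (k : Fin (N + 1)) : Algebra R (Away (coordGrading R N) (X k)) :=
  ((fromZeroRingHom (coordGrading R N) _).comp (algebraMap R (coordGrading R N 0))).toAlgebra

attribute [local instance] awayAlgebra

variable (R N) in
/-- The coordinate ring of an affine chart of projective space. -/
def chartRing (k : Fin (N + 1)) : CommAlgCat.{u} R :=
  CommAlgCat.of R (Away (coordGrading R N) (X k))

lemma X_mem_coordGrading (k : Fin (N + 1)) : (X k : MvPolynomial _ R) ∈ coordGrading R N 1 :=
  isHomogeneous_X R k

variable (R N) in
/-- The inclusion of an affine chart of projective space. -/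
def chartι (k : Fin (N + 1)) : specOver (chartRing R N k) ⟶ projectiveSpace R N :=
  Over.homMk (Proj.awayι (coordGrading R N) (X k) (X_mem_coordGrading k) one_pos) (by
    change Proj.awayι _ _ _ _ ≫ Proj.toSpecZero _ ≫ _ = _
    rw [Proj.awayι_toSpecZero_assoc, ← Spec.map_comp]
    rfl)

instance (k : Fin (N + 1)) : IsOpenImmersion (chartι R N k).left :=
  inferInstanceAs (IsOpenImmersion (Proj.awayι _ _ _ _))

/-- The homomorphism from the coordinate ring of a chart given by homogeneous coordinates, as a
homomorphism of algebras. -/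
def chartEvalAlgHom {A : Type u} [CommRing A] [Algebra R A] (c : Fin (N + 1) → A)
    (k : Fin (N + 1)) (hk : IsUnit (c k)) : Away (coordGrading R N) (X k) →ₐ[R] A :=
  AlgHom.mk (awayEval c (X k) (by rwa [aeval_X])) (awayEval_fromZero c _)

/-- The homomorphism from the coordinate ring of a chart given by homogeneous coordinates. -/
def chartEval {A : CommAlgCat.{u} R} (c : Fin (N + 1) → A) (k : Fin (N + 1)) (hk : IsUnit (c k)) :
    chartRing R N k ⟶ A :=
  CommAlgCat.ofHom (chartEvalAlgHom c k hk)

/-- The point of projective space with given homogeneous coordinates, one of them invertible. -/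
def projPoint {A : CommAlgCat.{u} R} (c : Fin (N + 1) → A) (k : Fin (N + 1)) (hk : IsUnit (c k)) :
    specOver A ⟶ projectiveSpace R N :=
  specOverMap (chartEval c k hk) ≫ chartι R N k

lemma specOverMap_projPoint {A B : CommAlgCat.{u} R} (φ : A ⟶ B) (c : Fin (N + 1) → A)
    (k : Fin (N + 1)) (hk : IsUnit (c k)) :
    specOverMap φ ≫ projPoint c k hk = projPoint (φ.hom ∘ c) k (hk.map φ.hom) := by
  rw [projPoint, projPoint, ← Category.assoc, ← specOverMap_comp]
  congr 2
  ext z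
  exact RingHom.congr_fun (comp_awayEval φ.hom c (X_mem_coordGrading k)
    (by rwa [aeval_X]) (by rw [aeval_X]; exact hk.map φ.hom)) z

lemma projPoint_smul {A : CommAlgCat.{u} R} {a : A} (ha : IsUnit a) (c : Fin (N + 1) → A)
    (k : Fin (N + 1)) (hk : IsUnit (c k)) (hk' : IsUnit ((a • c) k)) :
    projPoint (a • c) k hk' = projPoint c k hk := by
  rw [projPoint, projPoint]
  congr 2
  ext z
  exact RingHom.congr_fun (awayEval_smul ha c (X_mem_coordGrading k)
    (by rwa [aeval_X]) (by rwa [aeval_X])) z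

/-- Both points factor through the chart where `X k * X l` is invertible, and the resulting
description is symmetric in `k` and `l`. -/
lemma projPoint_eq {A : CommAlgCat.{u} R} (c : Fin (N + 1) → A) (k l : Fin (N + 1))
    (hk : IsUnit (c k)) (hl : IsUnit (c l)) : projPoint c k hk = projPoint c l hl := by
  have key (F : MvPolynomial (Fin (N + 1)) R) (k l : Fin (N + 1)) (hF : F = X k * X l)
      (hk : IsUnit (c k)) (hF' : IsUnit (aeval c F)) :
      (projPoint c k hk).left = Spec.map (CommRingCat.ofHom (awayEval c F hF')) ≫
        Proj.awayι (coordGrading R N) F (m := 2)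
          (hF ▸ SetLike.mul_mem_graded (X_mem_coordGrading k) (X_mem_coordGrading l)) two_pos := by
    subst hF
    rw [← Proj.SpecMap_awayMap_awayι (coordGrading R N) (X_mem_coordGrading k) one_pos
      (X_mem_coordGrading l) rfl, ← Category.assoc, ← Spec.map_comp, ← CommRingCat.ofHom_comp,
      awayEval_comp_awayMap c (X_mem_coordGrading k) (X_mem_coordGrading l) (by rwa [aeval_X])]
    rfl
  have hF : IsUnit (aeval c (X k * X l : MvPolynomial _ R)) := by
    rw [map_mul, aeval_X, aeval_X]; exact hk.mul hl
  ext : 1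
  rw [key _ k l rfl hk hF, key _ l k (mul_comm _ _) hl hF]

lemma chartEvalAlgHom_mk_mul {A : Type u} [CommRing A] [Algebra R A] (c : Fin (N + 1) → A)
    (k : Fin (N + 1)) (hk : IsUnit (c k)) (n : ℕ) (x : MvPolynomial (Fin (N + 1)) R)
    (hx : x ∈ coordGrading R N (n • 1)) :
    chartEvalAlgHom c k hk (Away.mk (coordGrading R N) (X_mem_coordGrading k) n x hx) * c k ^ n =
      aeval c x := by
  have h : aeval c (X k : MvPolynomial (Fin (N + 1)) R) = c k := aeval_X _ _
  have := awayEval_mk_mul c (by rwa [aeval_X]) (X_mem_coordGrading k) n x hx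
  exact (congrArg (fun t => _ * t ^ n) h.symm).trans this

lemma chartEvalAlgHom_mk {A : Type u} [CommRing A] [Algebra R A] {c : Fin (N + 1) → A}
    {k : Fin (N + 1)} (hk : c k = 1) (n : ℕ) (x : MvPolynomial (Fin (N + 1)) R)
    (hx : x ∈ coordGrading R N (n • 1)) :
    chartEvalAlgHom c k (by simp [hk]) (Away.mk (coordGrading R N) (X_mem_coordGrading k) n x hx) =
      aeval c x := by
  refine Eq.trans ?_ (chartEvalAlgHom_mk_mul c k (by simp [hk]) n x hx)
  have h : c k ^ n = 1 := by rw [hk, one_pow]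
  exact (mul_one _).symm.trans (congrArg (fun t => _ * t) h.symm)

variable (R) in
/-- The affine coordinates on a chart of projective space. -/
def affineCoord (k j : Fin (N + 1)) : Away (coordGrading R N) (X k) :=
  Away.mk (coordGrading R N) (X_mem_coordGrading k) 1 (X j) (by simpa using X_mem_coordGrading j)

lemma chartEvalAlgHom_affineCoord {A : Type u} [CommRing A] [Algebra R A] {c : Fin (N + 1) → A}
    {k : Fin (N + 1)} (hk : c k = 1) (j : Fin (N + 1)) :
    chartEvalAlgHom c k (by simp [hk]) (affineCoord R k j) = c j :=
  (chartEvalAlgHom_mk (R := R) hk 1 (X j) _).trans (aeval_X _ _)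

/-- Inside chart `k`, chart `l` is the basic open set of `X l / X k`, whose value times the unit `c
k` is `c l`. -/
lemma mem_range_chartι_projPoint {A : CommAlgCat.{u} R} (c : Fin (N + 1) → A) (k l : Fin (N + 1))
    (hk : IsUnit (c k)) (p : PrimeSpectrum A) :
    (projPoint c k hk).left p ∈ Set.range (chartι R N l).left ↔ c l ∉ p.asIdeal := by
  have hrange : Set.range (chartι R N l).left =
      (Proj.basicOpen (coordGrading R N) (X l)).carrier :=
    congrArg TopologicalSpace.Opens.carrier
      (Proj.opensRange_awayι (coordGrading R N) (X l) (X_mem_coordGrading l) one_pos)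
  have hpre := Proj.awayι_preimage_basicOpen (coordGrading R N) (X_mem_coordGrading k) one_pos
    (X_mem_coordGrading (R := R) l) one_pos
  rw [hrange]
  have h1 : (projPoint c k hk).left p ∈ (Proj.basicOpen (coordGrading R N) (X l)).carrier ↔
      p.comap (chartEvalAlgHom c k hk).toRingHom ∈
        PrimeSpectrum.basicOpen (Away.isLocalizationElem (X_mem_coordGrading k)
          (X_mem_coordGrading (R := R) l)) := by
    rw [← hpre]
    rfl
  refine h1.trans ?_
  change ¬ (chartEvalAlgHom c k hk (Away.isLocalizationElem _ _) ∈ p.asIdeal) ↔ _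
  have h2 := chartEvalAlgHom_mk_mul (R := R) c k hk 1 (X l ^ 1) (by simpa using X_mem_coordGrading l)
  rw [map_pow, aeval_X] at h2
  have h3 := h2.trans (pow_one (c l))
  rw [not_iff_not, ← h3]
  exact ⟨fun h => Ideal.mul_mem_right _ _ h, fun h => (p.2.mem_or_mem h).resolve_right fun h' =>
    p.2.ne_top (Ideal.eq_top_of_isUnit_mem _ h' (hk.pow 1))⟩

lemma over_cancel_mono {S T U : Over (Spec (.of R))} {a b : S ⟶ T} (u : T ⟶ U) [Mono u.left]
    (h : a ≫ u = b ≫ u) : a = b :=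
  Over.OverMorphism.ext ((cancel_mono u.left).1 (congrArg CommaMorphism.left h))

/-- Chart inclusions are monomorphisms, and coordinates normalized by `c k = 1` are the values of
the affine coordinates of chart `k`. -/
lemma projPoint_injective {A : CommAlgCat.{u} R} {c c' : Fin (N + 1) → A} {k : Fin (N + 1)}
    (hk : c k = 1) (hk' : c' k = 1)
    (h : projPoint c k (by simp [hk]) = projPoint c' k (by simp [hk'])) : c = c' := by
  have h1 := specOverMap_injective (over_cancel_mono (chartι R N k) h)
  ext j
  have h2 : chartEvalAlgHom c k (by simp [hk]) (affineCoord R k j) =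
      chartEvalAlgHom c' k (by simp [hk']) (affineCoord R k j) :=
    congrArg (fun φ : chartRing R N k ⟶ A => φ.hom (affineCoord R k j)) h1
  rwa [chartEvalAlgHom_affineCoord hk, chartEvalAlgHom_affineCoord hk'] at h2

lemma chartEval_surjective {A : CommAlgCat.{u} R} (c : Fin (N + 1) → A) (k : Fin (N + 1))
    (hk : c k = 1) (hc : Algebra.adjoin R (Set.range c) = ⊤) :
    Function.Surjective (chartEval c k (by simp [hk])).hom := by
  refine (AlgHom.range_eq_top (chartEvalAlgHom c k (by simp [hk]))).1 ?_
  rw [← top_le_iff, ← hc]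
  refine Algebra.adjoin_le ?_
  rintro _ ⟨j, rfl⟩
  exact ⟨_, chartEvalAlgHom_affineCoord hk j⟩

lemma isSeparated_projectiveSpace : (projectiveSpace R N).left.IsSeparated :=
  inferInstanceAs ((Proj (coordGrading R N)).IsSeparated)

end ProjectiveSpace

/-! ### Immersed schemes from compatible affine closed subschemes of an open cover -/

section Immersed

/-- Vanishing is local, and small affine open neighbourhoods are among the test morphisms. The open
set `W` allows the tests to be confined to a neighbourhood of the point. -/
lemma section_eq_zero_of_affine {X : Scheme.{u}} {U : X.Opens} (t : Γ(X, U))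
    (h : ∀ x ∈ U, ∃ W : X.Opens, x ∈ W ∧ ∀ (A : CommRingCat.{u}) (c : Spec A ⟶ X)
      (hc : ⊤ ≤ c ⁻¹ᵁ U), ⊤ ≤ c ⁻¹ᵁ W → c.appLE U ⊤ hc t = 0) : t = 0 := by
  refine X.IsSheaf.section_ext fun x hx => ?_
  obtain ⟨W, hxW, hW⟩ := h x hx
  obtain ⟨_, ⟨V, hV' : IsAffineOpen (X := X) V, rfl⟩, hxV, hVW⟩ := X.isBasis_affineOpens.exists_subset_of_mem_open
    (show x ∈ ((W ⊓ U : X.Opens) : Set X) from ⟨hxW, hx⟩) (W ⊓ U).2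
  let V : X.Opens := V
  have hV : IsAffineOpen V := hV'
  have hVU : V ≤ U := fun y hy => (hVW hy).2
  refine ⟨V, hVU, hxV, ?_⟩
  rw [map_zero]
  have hι : ∀ y, V.ι y ∈ V := fun y => y.2
  have h0 := hW _ (hV.isoSpec.inv ≫ V.ι)
    (fun y _ => (hVW (hι _)).2) (fun y _ => (hVW (hι _)).1)
  have h1 : V.ι.appLE U ⊤ (fun y _ => hVU (hι y)) t = 0 := by
    have := Scheme.Hom.appLE_comp_appLE (hV.isoSpec.hom)
      (hV.isoSpec.inv ≫ V.ι) U ⊤ ⊤ (fun y _ => (hVW (hι _)).2) le_top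
    have h2 := congrArg (fun f => f t) this
    simp only [Iso.hom_inv_id_assoc] at h2
    refine h2.symm.trans ?_
    rw [CommRingCat.comp_apply, h0, map_zero]
  have h3 := Scheme.Hom.map_appLE V.ι V.ι_preimage_self.ge (homOfLE hVU).op
  have h4 : V.ι.appLE V ⊤ V.ι_preimage_self.ge (X.presheaf.map (homOfLE hVU).op t) = 0 := by
    rw [← CommRingCat.comp_apply, h3]
    exact h1
  have hinj : Function.Injective (V.ι.appLE V ⊤ V.ι_preimage_self.ge) :=
    ((asIso (V.ι.appLE V ⊤ V.ι_preimage_self.ge)).commRingCatIsoToRingEquiv).injective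
  exact hinj (h4.trans (map_zero _).symm)

/-- An element of the coordinate ring of an affine open subscheme as a section. -/
def sectionOfOpen {X : Scheme.{u}} {P : CommRingCat.{u}} (v : Spec P ⟶ X) [IsOpenImmersion v]
    (s : P) : Γ(X, v ''ᵁ ⊤) :=
  (v.appIso ⊤).inv ((Scheme.ΓSpecIso P).inv s)

lemma appLE_sectionOfOpen {X : Scheme.{u}} {P A : CommRingCat.{u}} (v : Spec P ⟶ X)
    [IsOpenImmersion v] (ψ : P ⟶ A) (c : Spec A ⟶ X) (hc : c = Spec.map ψ ≫ v) (s : P)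
    (h : ⊤ ≤ c ⁻¹ᵁ (v ''ᵁ ⊤)) :
    c.appLE (v ''ᵁ ⊤) ⊤ h (sectionOfOpen v s) = (Scheme.ΓSpecIso A).inv (ψ s) := by
  subst hc
  have h1 := Scheme.Hom.appLE_comp_appLE (Spec.map ψ) v (v ''ᵁ ⊤) ⊤ ⊤
    (v.preimage_image_eq ⊤).ge le_top
  have h4 : v.appLE (v ''ᵁ ⊤) ⊤ (v.preimage_image_eq ⊤).ge (sectionOfOpen v s) =
      (Scheme.ΓSpecIso P).inv s := by
    rw [← Scheme.Hom.appIso_hom', sectionOfOpen, ← CommRingCat.comp_apply, Iso.inv_hom_id]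
    rfl
  rw [← h1, CommRingCat.comp_apply, h4]
  have h2 := Scheme.ΓSpecIso_inv_naturality ψ
  have h3 := congrArg (fun f => f s) h2
  simp only [CommRingCat.comp_apply] at h3
  rw [h3]
  rfl

lemma appLE_sectionOfOpen_eq_zero {X : Scheme.{u}} {P A : CommRingCat.{u}} (v : Spec P ⟶ X)
    [IsOpenImmersion v] (ψ : P ⟶ A) (c : Spec A ⟶ X) (hc : c = Spec.map ψ ≫ v) (s : P)
    (h : ⊤ ≤ c ⁻¹ᵁ (v ''ᵁ ⊤)) :
    c.appLE (v ''ᵁ ⊤) ⊤ h (sectionOfOpen v s) = 0 ↔ ψ s = 0 := by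
  rw [appLE_sectionOfOpen v ψ c hc]
  exact map_eq_zero_iff _ (Scheme.ΓSpecIso A).symm.commRingCatIsoToRingEquiv.injective

lemma exists_sigmaι_eq {𝒥 : Type u} {X : 𝒥 → Scheme.{u}} (x : (∐ X : Scheme.{u})) :
    ∃ J, x ∈ Set.range (Sigma.ι X J) :=
  ⟨_, (sigmaOpenCover X).covers x⟩

variable {R : Type u} [CommRing R]

variable {T : Over (Spec (.of R))} [T.left.IsSeparated] {𝒥 : Type u} [Finite 𝒥]
  {P B : 𝒥 → CommAlgCat.{u} R} (v : ∀ J, specOver (P J) ⟶ T) [hv : ∀ J, IsOpenImmersion (v J).left]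
  (π : ∀ J, P J ⟶ B J)

/-- The morphism from the disjoint union of affine closed subschemes of an open cover. -/
def sigmaDescLeft : ∐ (fun J => (specOver (B J)).left) ⟶ T.left :=
  Sigma.desc fun J => (specOverMap (π J) ≫ v J).left

instance : QuasiCompact (sigmaDescLeft v π) := by
  have : CompactSpace (∐ (fun J => (specOver (B J)).left) : Scheme.{u}) := by
    refine ⟨?_⟩
    have h : (Set.univ : Set (∐ (fun J => (specOver (B J)).left) : Scheme.{u})) =
        ⋃ J, Set.range (Sigma.ι (fun J => (specOver (B J)).left) J) :=
      (Set.eq_univ_of_forall fun x => Set.mem_iUnion.2 (exists_sigmaι_eq x)).symm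
    rw [h]
    refine isCompact_iUnion fun J => ?_
    have : CompactSpace (specOver (B J)).left := inferInstanceAs (CompactSpace (Spec _))
    exact isCompact_range (Scheme.Hom.continuous _)
  exact quasiCompact_of_compactSpace _

-- The claim is that over chart `J` the scheme-theoretic image of the disjoint union is no larger
-- than the closed subscheme of `B J`. A function `s` on the chart in the kernel of `π J` pulls back
-- to zero on the disjoint union: the part of the component of `K` that lies over chart `J` factors
-- through the spectrum of `B J`, by `hover`. So `s` vanishes on the image, and every point of the
-- chart that lies in the image kills it.
variable {v π} in
lemma exists_lift_of_comp_imageι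
    (hover : ∀ (J K) (A : CommAlgCat.{u} R) (b : specOver A ⟶ specOver (B K)),
      Set.range (b ≫ specOverMap (π K) ≫ v K).left ⊆ Set.range (v J).left →
      ∃ b' : specOver A ⟶ specOver (B J),
        b' ≫ specOverMap (π J) ≫ v J = b ≫ specOverMap (π K) ≫ v K)
    (hπ : ∀ J, Function.Surjective (π J).hom) {A : CommAlgCat.{u} R} (J : 𝒥)
    (a : specOver A ⟶ specOver (P J)) (y : (specOver A).left ⟶ (sigmaDescLeft v π).image)
    (hy : y ≫ (sigmaDescLeft v π).imageι = (a ≫ v J).left) :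
    ∃ b : specOver A ⟶ specOver (B J), b ≫ specOverMap (π J) = a := by
  obtain ⟨ψ, rfl⟩ := exists_specOverMap a
  suffices h : ∀ s, (π J).hom s = 0 → ψ.hom s = 0 by
    let β : B J →ₐ[R] A := AlgHom.liftOfSurjective (π J).hom (hπ J) ψ.hom h
    have hβ : β.comp (π J).hom = ψ.hom :=
      AlgHom.ext fun s => AlgHom.liftOfSurjective_apply (π J).hom (hπ J) ψ.hom h s
    refine ⟨specOverMap (CommAlgCat.ofHom β), ?_⟩
    rw [← specOverMap_comp]
    congr 1
    ext s
    exact AlgHom.congr_fun hβ s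
  intro s hs
  let w := sigmaDescLeft v π
  let vJ : Spec (CommRingCat.of (P J)) ⟶ T.left := (v J).left
  have hvJ : IsOpenImmersion vJ := hv J
  let U : T.left.Opens := vJ ''ᵁ ⊤
  have hUr : (U : Set T.left) = Set.range vJ := by
    simp [U]
  have hU : IsAffineOpen U := (isAffineOpen_top (Spec _)).image_of_isOpenImmersion vJ
  let σ : Γ(T.left, U) := sectionOfOpen vJ s
  -- Vanishing is tested near a point of one component, of index `K`, on affine schemes that map
  -- into this component.
  have hσ : w.app U σ = 0 := by
    refine section_eq_zero_of_affine _ fun x hx => ?_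
    obtain ⟨K, x, rfl⟩ := exists_sigmaι_eq x
    refine ⟨(Sigma.ι (fun J => (specOver (B J)).left) K).opensRange, ⟨x, rfl⟩, fun D c hc hc' => ?_⟩
    have hcr : Set.range c ⊆ Set.range (Sigma.ι (fun J => (specOver (B J)).left) K) := by
      rintro _ ⟨y, rfl⟩
      exact hc' (x := y) trivial
    let c₁ := IsOpenImmersion.lift (Sigma.ι (fun J => (specOver (B J)).left) K) c hcr
    have hc₁ : c₁ ≫ Sigma.ι (fun J => (specOver (B J)).left) K = c :=
      IsOpenImmersion.lift_fac _ _ _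
    let b := pointOfHom (specOver (B K)) c₁
    have hb : (b ≫ specOverMap (π K) ≫ v K).left = c ≫ w := by
      rw [← hc₁, Category.assoc]
      change c₁ ≫ _ = _
      congr 1
      exact (Sigma.ι_desc (fun J => (specOverMap (π J) ≫ v J).left) K).symm
    obtain ⟨b', hb'⟩ := hover J K _ b (by
      rintro _ ⟨y, rfl⟩
      refine (Set.ext_iff.1 hUr _).1 ?_
      have h0 : (c ≫ w) y ∈ U := hc (x := y) trivial
      exact (congrArg (fun g : Spec D ⟶ T.left => g y) hb).symm ▸ h0)
    obtain ⟨β, rfl⟩ := exists_specOverMap b'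
    rw [← CommRingCat.comp_apply]
    have h1 := Scheme.Hom.comp_appLE c w U ⊤ hc
    rw [← h1]
    refine (appLE_sectionOfOpen_eq_zero vJ
      (CommRingCat.ofHom (π J ≫ β).hom.toRingHom) (c ≫ w) ?_ s hc).2 ?_
    · refine hb.symm.trans ((congrArg CommaMorphism.left hb').symm.trans ?_)
      rw [← Category.assoc, ← specOverMap_comp]
      rfl
    · change β.hom ((π J).hom s) = 0
      rw [hs, map_zero]
  -- As `w` is quasicompact, the ideal of the image on the affine open set `U` is the kernel of the
  -- pullback to the disjoint union.
  have hker : σ ∈ w.imageι.ker.ideal ⟨U, hU⟩ := by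
    rw [Scheme.IdealSheafData.ker_subschemeι, Scheme.Hom.ker_apply]
    exact hσ
  rw [Scheme.Hom.ker_apply] at hker
  have hker' : w.imageι.app U σ = 0 := hker
  have hyU : ⊤ ≤ (y ≫ w.imageι) ⁻¹ᵁ U := by
    intro p _
    change (y ≫ w.imageι) p ∈ (U : Set T.left)
    rw [hUr, hy]
    exact ⟨_, rfl⟩
  have h2 := Scheme.Hom.comp_appLE y w.imageι U ⊤ hyU
  have h3 : (y ≫ w.imageι).appLE U ⊤ hyU σ = 0 := by
    rw [h2, CommRingCat.comp_apply, hker', map_zero]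
  exact (appLE_sectionOfOpen_eq_zero vJ (CommRingCat.ofHom ψ.hom.toRingHom) _ hy s hyU).1 h3

variable {v π} in
/-- Compatible affine closed subschemes of the members of an open cover of an open subscheme glue
to an immersed subscheme. -/
theorem exists_immersed
    (hover : ∀ (J K) (A : CommAlgCat.{u} R) (b : specOver A ⟶ specOver (B K)),
      Set.range (b ≫ specOverMap (π K) ≫ v K).left ⊆ Set.range (v J).left →
      ∃ b' : specOver A ⟶ specOver (B J),
        b' ≫ specOverMap (π J) ≫ v J = b ≫ specOverMap (π K) ≫ v K)
    (hπ : ∀ J, Function.Surjective (π J).hom) :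
    ∃ (Z : Over (Spec (.of R))) (i : Z ⟶ T) (z : ∀ J, specOver (B J) ⟶ Z),
      IsImmersion i.left ∧ QuasiCompact i.left ∧ (∀ J, z J ≫ i = specOverMap (π J) ≫ v J) ∧
      ∀ (A : CommAlgCat.{u} R) (y : specOver A ⟶ Z) (p : PrimeSpectrum A), ∃ J, ∃ f ∉ p.asIdeal,
        ∃ b : specOver (away A f) ⟶ specOver (B J), specOverMap (toAway A f) ≫ y = b ≫ z J := by
  let w := sigmaDescLeft v π
  -- The image is closed in `T` and may acquire points outside the charts. Intersecting with the
  -- union of the charts removes them.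
  let V : T.left.Opens := ⨆ J, (v J).left.opensRange
  let Z : Over (Spec (.of R)) := Over.mk ((w.imageι ⁻¹ᵁ V).ι ≫ w.imageι ≫ T.hom)
  let i : Z ⟶ T := Over.homMk ((w.imageι ⁻¹ᵁ V).ι ≫ w.imageι) (by simp [Z])
  have hi : IsImmersion i.left :=
    inferInstanceAs (IsImmersion ((w.imageι ⁻¹ᵁ V).ι ≫ w.imageι))
  have hmono : Mono i.left := inferInstance
  have hz (J) : ∃ z : specOver (B J) ⟶ Z, z ≫ i = specOverMap (π J) ≫ v J := by
    let z₀ := Sigma.ι (fun J => (specOver (B J)).left) J ≫ w.toImage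
    have hz₀ : z₀ ≫ w.imageι = (specOverMap (π J) ≫ v J).left := by
      simp only [z₀, Category.assoc, Scheme.Hom.toImage_imageι]
      exact Sigma.ι_desc _ _
    have hr : Set.range z₀ ⊆ Set.range (w.imageι ⁻¹ᵁ V).ι := by
      rw [Scheme.Opens.range_ι]
      rintro _ ⟨p, rfl⟩
      change (z₀ ≫ w.imageι) p ∈ V
      rw [hz₀]
      exact TopologicalSpace.Opens.mem_iSup.2 ⟨J, _, rfl⟩
    have hl : IsOpenImmersion.lift (w.imageι ⁻¹ᵁ V).ι z₀ hr ≫ (w.imageι ⁻¹ᵁ V).ι ≫ w.imageι =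
        (specOverMap (π J) ≫ v J).left := by
      rw [IsOpenImmersion.lift_fac_assoc, hz₀]
    refine ⟨Over.homMk (IsOpenImmersion.lift (w.imageι ⁻¹ᵁ V).ι z₀ hr) ?_, ?_⟩
    · have := Over.w (specOverMap (π J) ≫ v J)
      rw [← this, ← hl]
      simp [Z]
    · exact Over.OverMorphism.ext hl
  choose z hz using hz
  have hloc : ∀ (A : CommAlgCat.{u} R) (y : specOver A ⟶ Z) (p : PrimeSpectrum A),
      ∃ J, ∃ f ∉ p.asIdeal, ∃ b : specOver (away A f) ⟶ specOver (B J),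
        specOverMap (toAway A f) ≫ y = b ≫ z J := by
    intro A y p
    have hp : (y ≫ i).left p ∈ V := (y.left p).2
    obtain ⟨J, hJ⟩ := TopologicalSpace.Opens.mem_iSup.1 hp
    obtain ⟨f, hf, a, ha⟩ := exists_lift_of_mem_range (v J) (y ≫ i) p hJ
    obtain ⟨b, hb⟩ := exists_lift_of_comp_imageι hover hπ J a
      ((specOverMap (toAway A f) ≫ y).left ≫ (w.imageι ⁻¹ᵁ V).ι) (by
        rw [← ha, ← Category.assoc _ y i, Over.comp_left _ _ _ _ i, Category.assoc]
        rfl)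
    refine ⟨J, f, hf, b, over_cancel_mono i ?_⟩
    rw [Category.assoc, Category.assoc, hz, ha, reassoc_of% hb]
  -- A finite union of images of affine schemes is compact. Since `T` is separated, this makes `i`
  -- quasicompact.
  have hcompact : CompactSpace Z.left := by
    refine ⟨?_⟩
    have : (Set.univ : Set Z.left) = ⋃ J, Set.range (z J).left := by
      refine (Set.eq_univ_of_forall fun ζ => ?_).symm
      obtain ⟨k, x, p, rfl⟩ : ∃ (k : CommRingCat.{u}) (x : Spec k ⟶ Z.left) (p : Spec k),
          x p = ζ :=
        ⟨_, Z.left.affineOpenCover.f _, Z.left.affineOpenCover.covers ζ⟩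
      obtain ⟨J, f, hf, b, hb⟩ := hloc _ (pointOfHom Z x) p
      obtain ⟨p', hp'⟩ : p ∈ Set.range (specOverMap (toAway _ f)).left := by
        rw [range_specOverMap_toAway]; exact hf
      refine Set.mem_iUnion.2 ⟨J, b.left p', ?_⟩
      have := congrArg (fun y => y.left p') hb
      refine this.symm.trans ?_
      change x ((specOverMap (toAway _ f)).left p') = _
      rw [hp']
    rw [this]
    refine isCompact_iUnion fun J => ?_
    have : CompactSpace (specOver (B J)).left := inferInstanceAs (CompactSpace (Spec _))
    exact isCompact_range (z J).left.continuous
  exact ⟨Z, i, z, hi, inferInstance, hz, hloc⟩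

end Immersed

/-! ### A criterion for representability by a quasiprojective scheme -/

section Criterion

variable {R : Type u} [CommRing R] {N : ℕ}

lemma isUnit_of_forall_notMem {A : Type*} [CommRing A] {a : A}
    (h : ∀ p : PrimeSpectrum A, a ∉ p.asIdeal) : IsUnit a := by
  by_contra ha
  obtain ⟨m, hm, ham⟩ := exists_max_ideal_of_mem_nonunits ha
  exact h ⟨m, hm.isPrime⟩ ham

lemma projPoint_eq_iff {A : CommAlgCat.{u} R} {c c' : Fin (N + 1) → A} {k k' : Fin (N + 1)}
    (hk : IsUnit (c k)) (hk' : IsUnit (c' k')) :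
    projPoint c k hk = projPoint c' k' hk' ↔ ∃ a : Aˣ, c' = a.1 • c := by
  constructor
  · intro h
    -- Equal points lie in the same charts. So both coordinate vectors can be normalized at `k`,
    -- where they are determined by the point.
    have h1 : IsUnit (c' k) := isUnit_of_forall_notMem fun p => by
      rw [← mem_range_chartι_projPoint c' k' k hk' p, ← h, mem_range_chartι_projPoint]
      exact fun hp => p.2.ne_top (Ideal.eq_top_of_isUnit_mem _ hp hk)
    rw [projPoint_eq c' k' k hk' h1] at h
    obtain ⟨v, hv⟩ := hk
    obtain ⟨v', hv'⟩ := h1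
    have e1 : (v⁻¹.1 • c) k = 1 := by simp [← hv]
    have e2 : (v'⁻¹.1 • c') k = 1 := by simp [← hv']
    have h2 : v⁻¹.1 • c = v'⁻¹.1 • c' := by
      refine projPoint_injective e1 e2 ?_
      rw [projPoint_smul v⁻¹.isUnit c k (hv ▸ v.isUnit) _,
        projPoint_smul v'⁻¹.isUnit c' k (hv' ▸ v'.isUnit) _, h]
    refine ⟨v' * v⁻¹, ?_⟩
    rw [Units.val_mul, mul_smul, h2, smul_smul]
    simp
  · rintro ⟨a, rfl⟩
    rw [projPoint_eq (a.1 • c) k' k hk' (a.isUnit.mul hk), projPoint_smul a.isUnit c k hk]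

/-- A Zariski sheaf covered by finitely many affine schemes, with compatible homogeneous
coordinates that separate points and generate the coordinate rings, is representable by a
quasiprojective scheme. -/
theorem exists_isQuasiProjective {F : CommAlgCat.{u} R ⥤ Type u} (hF : IsZariskiSeparated F)
    (hF' : IsZariskiGluing F) {𝒥 : Type u} [Finite 𝒥] (B : 𝒥 → CommAlgCat.{u} R)
    (t : ∀ J, F.obj (B J)) (c : ∀ J, Fin (N + 1) → B J) (k : 𝒥 → Fin (N + 1))
    (hk : ∀ J, c J (k J) = 1) (hc : ∀ J, Algebra.adjoin R (Set.range (c J)) = ⊤)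
    (hsurj : ∀ (A : CommAlgCat.{u} R) (x : F.obj A) (p : PrimeSpectrum A), ∃ f ∉ p.asIdeal,
      ∃ (J : 𝒥) (φ : B J ⟶ away A f), F.map φ (t J) = F.map (toAway A f) x)
    (hinj : ∀ (A : CommAlgCat.{u} R) (J K : 𝒥) (φ : B J ⟶ A) (ψ : B K ⟶ A),
      F.map φ (t J) = F.map ψ (t K) ↔ ∃ a : Aˣ, ψ.hom ∘ c K = a.1 • (φ.hom ∘ c J))
    (hover : ∀ (A : CommAlgCat.{u} R) (J K : 𝒥) (ψ : B K ⟶ A), IsUnit (ψ.hom (c K (k J))) →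
      ∃ (φ : B J ⟶ A) (a : Aˣ), ψ.hom ∘ c K = a.1 • (φ.hom ∘ c J)) :
    ∃ Z : Over (Spec (.of R)), Nonempty (points Z ≅ F) ∧ IsQuasiProjective Z := by
  have hk' (J : 𝒥) {A : CommAlgCat.{u} R} (φ : B J ⟶ A) : IsUnit ((φ.hom ∘ c J) (k J)) := by
    simp [hk]
  have hpt (J : 𝒥) {A : CommAlgCat.{u} R} (φ : B J ⟶ A) :
      specOverMap φ ≫ specOverMap (chartEval (c J) (k J) (by simp [hk])) ≫ chartι R N (k J) =
        projPoint (φ.hom ∘ c J) (k J) (hk' J φ) :=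
    specOverMap_projPoint φ (c J) (k J) (by simp [hk])
  have hsep : (projectiveSpace R N).left.IsSeparated := isSeparated_projectiveSpace
  obtain ⟨Z, i, z, hi, hi', hz, hloc⟩ := exists_immersed
    (v := fun J => chartι R N (k J)) (π := fun J => chartEval (c J) (k J) (by simp [hk]))
    (fun J K A b hb => by
      obtain ⟨ψ, rfl⟩ := exists_specOverMap b
      rw [hpt K ψ] at hb ⊢
      -- A point lies in the chart `k J` exactly if its coordinate there is a unit, so the
      -- hypothesis on overlaps applies.
      obtain ⟨φ, a, ha⟩ := hover A J K ψ (isUnit_of_forall_notMem fun p =>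
        (mem_range_chartι_projPoint _ _ _ (hk' K ψ) p).1 (hb ⟨p, rfl⟩))
      refine ⟨specOverMap φ, ?_⟩
      rw [hpt J φ, projPoint_eq_iff]
      exact ⟨a, ha⟩)
    (fun J => chartEval_surjective (c J) (k J) (hk J) (hc J))
  -- The disjoint union of the functors of the charts covers both `F` and the immersed scheme. In
  -- both, two of its elements have the same image exactly if their homogeneous coordinates are
  -- proportional.
  let C : CommAlgCat.{u} R ⥤ Type u :=
    { obj := fun A => Σ J : 𝒥, (B J ⟶ A)
      map := fun φ => ↾fun x => ⟨x.1, x.2 ≫ φ⟩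
      map_id := fun A => by
        refine ConcreteCategory.hom_ext _ _ fun x => ?_
        change (⟨x.1, x.2 ≫ 𝟙 A⟩ : Σ J, (B J ⟶ A)) = x
        rw [Category.comp_id]
      map_comp := fun φ ψ => by
        refine ConcreteCategory.hom_ext _ _ fun x => ?_
        change (⟨x.1, x.2 ≫ φ ≫ ψ⟩ : Σ J, (B J ⟶ _)) = ⟨x.1, (x.2 ≫ φ) ≫ ψ⟩
        rw [Category.assoc] }
  let h : C ⟶ F :=
    { app := fun A => ↾fun x => F.map x.2 (t x.1)
      naturality := fun A A' φ => by ext x; exact Functor.map_comp_apply F x.2 φ _ }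
  let ζ : C ⟶ points Z :=
    { app := fun A => ↾fun x => specOverMap x.2 ≫ z x.1
      naturality := fun A A' φ => by
        refine ConcreteCategory.hom_ext _ _ fun x => ?_
        change specOverMap (x.2 ≫ φ) ≫ z x.1 = specOverMap φ ≫ specOverMap x.2 ≫ z x.1
        rw [specOverMap_comp, Category.assoc] }
  obtain ⟨e, -⟩ := exists_iso_of_isLocallySurjective (h := h) (z := ζ)
    (fun A x p => by
      obtain ⟨f, hf, J, φ, hφ⟩ := hsurj A x p
      exact ⟨f, hf, ⟨J, φ⟩, hφ⟩)
    (fun A y p => by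
      obtain ⟨J, f, hf, b, hb⟩ := hloc A y p
      obtain ⟨φ, rfl⟩ := exists_specOverMap b
      exact ⟨f, hf, ⟨J, φ⟩, hb.symm⟩)
    hF hF' (isZariskiSeparated_points Z) (isZariskiGluing_points Z)
    (fun A x x' => by
      obtain ⟨J, φ⟩ := x
      obtain ⟨K, ψ⟩ := x'
      refine (hinj A J K φ ψ).trans (Iff.trans ?_ (show specOverMap φ ≫ z J = specOverMap ψ ≫ z K ↔
        _ from Iff.rfl))
      rw [← projPoint_eq_iff (hk' J φ) (hk' K ψ), ← hpt J φ, ← hpt K ψ, ← hz, ← hz,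
        ← Category.assoc, ← Category.assoc]
      exact ⟨fun h => over_cancel_mono i h, fun h => by rw [h]⟩)
  exact ⟨Z, ⟨e.symm⟩, N, i, hi, hi'⟩

end Criterion

/-! ### Quotients of polynomial rings -/

section QuotRing

open MvPolynomial

variable {R : Type u} [CommRing R] {σ : Type u} (S : Set (MvPolynomial σ R))

/-- The universal algebra for solutions of a set of polynomial equations. -/
def quotRing : CommAlgCat.{u} R := CommAlgCat.of R (MvPolynomial σ R ⧸ Ideal.span S)

/-- The universal solution. -/
def quotVar (x : σ) : quotRing S := Ideal.Quotient.mkₐ R (Ideal.span S) (X x)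

variable {S}

lemma aeval_quotVar {A : CommAlgCat.{u} R} (φ : quotRing S ⟶ A) (s : MvPolynomial σ R) :
    aeval (fun x => φ.hom (quotVar S x)) s = φ.hom (Ideal.Quotient.mkₐ R (Ideal.span S) s) := by
  have : aeval (fun x => φ.hom (quotVar S x)) =
      φ.hom.comp (Ideal.Quotient.mkₐ R (Ideal.span S) : MvPolynomial σ R →ₐ[R] quotRing S) := by
    ext x
    exact aeval_X _ _
  exact AlgHom.congr_fun this s

lemma aeval_quotVar_eq_zero {A : CommAlgCat.{u} R} (φ : quotRing S ⟶ A) {s : MvPolynomial σ R}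
    (hs : s ∈ S) : aeval (fun x => φ.hom (quotVar S x)) s = 0 := by
  rw [aeval_quotVar]
  exact (congrArg φ.hom (Ideal.Quotient.eq_zero_iff_mem.2 (Ideal.subset_span hs))).trans
    (map_zero φ.hom)

lemma exists_quotRing_hom {A : CommAlgCat.{u} R} (a : σ → A) (h : ∀ s ∈ S, aeval a s = 0) :
    ∃ φ : quotRing S ⟶ A, ∀ x, φ.hom (quotVar S x) = a x := by
  have h' : ∀ s ∈ Ideal.span S, aeval a s = 0 := fun s hs => by
    have : Ideal.span S ≤ RingHom.ker (aeval a) := Ideal.span_le.2 h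
    exact this hs
  refine ⟨CommAlgCat.ofHom (Ideal.Quotient.liftₐ (Ideal.span S) (aeval a) h'), fun x => ?_⟩
  exact (Ideal.Quotient.liftₐ_apply _ _ _ _).trans (aeval_X _ _)

lemma quotRing_hom_ext {A : CommAlgCat.{u} R} {φ ψ : quotRing S ⟶ A}
    (h : ∀ x, φ.hom (quotVar S x) = ψ.hom (quotVar S x)) : φ = ψ := by
  ext z
  obtain ⟨s, rfl⟩ := Ideal.Quotient.mkₐ_surjective R (Ideal.span S) z
  have h1 := aeval_quotVar φ s
  have h2 := aeval_quotVar ψ s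
  rw [funext h] at h1
  exact h1.symm.trans h2

lemma adjoin_range_quotVar : Algebra.adjoin R (Set.range (quotVar S)) = ⊤ := by
  have h : Set.range (quotVar S) = (Ideal.Quotient.mkₐ R (Ideal.span S)) '' Set.range X := by
    rw [← Set.range_comp]; rfl
  rw [h]
  refine (AlgHom.map_adjoin (Ideal.Quotient.mkₐ R (Ideal.span S)) _).symm.trans ?_
  rw [adjoin_range_X, Algebra.map_top]
  exact (AlgHom.range_eq_top _).2 (Ideal.Quotient.mkₐ_surjective R _)

end QuotRing

/-! ### Local direct summands and vectors -/

section SubVec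

variable {R : Type u} [CommRing R] {L : Type u} [Ring L] [Algebra R L]

/-! ### Localization of submodules and elements -/

section Away

variable (L) in
/-- The localization homomorphism of `A ⊗ L`. -/
def awayBc (A : CommAlgCat.{u} R) (f : A) : A ⊗[R] L →ₗ[A] Localization.Away f ⊗[R] L :=
  AlgebraTensorModule.rTensor R L (Algebra.linearMap A (Localization.Away f))

instance (A : CommAlgCat.{u} R) (f : A) : IsLocalizedModule (Submonoid.powers f) (awayBc L A f) :=
  inferInstanceAs (IsLocalizedModule (Submonoid.powers f)
    (AlgebraTensorModule.rTensor R L (Algebra.linearMap A (Localization.Away f))))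

variable {A : CommAlgCat.{u} R} {f : A}

lemma awayBc_apply (z : A ⊗[R] L) : awayBc L A f z = bc L (toAway A f).hom z := rfl

lemma subMap_toAway (N : Submodule A (A ⊗[R] L)) :
    subMap (toAway A f).hom N =
      N.localized' (Localization.Away f) (Submonoid.powers f) (awayBc L A f) := by
  have := Submodule.localized'_eq_span (Localization.Away f) (Submonoid.powers f) (awayBc L A f) N
  rw [this]
  rfl

lemma bc_toAway_mem_iff {N : Submodule A (A ⊗[R] L)} {z : A ⊗[R] L} :
    bc L (toAway A f).hom z ∈ subMap (toAway A f).hom N ↔ ∃ k : ℕ, f ^ k • z ∈ N := by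
  rw [subMap_toAway]
  refine (Submodule.mem_localized' _ _ (awayBc L A f) N _).trans ?_
  constructor
  · rintro ⟨m, hm, s, hs⟩
    rw [IsLocalizedModule.mk'_eq_iff] at hs
    have hs' : awayBc L A f m = awayBc L A f (s.1 • z) := by
      rw [map_smul]; exact hs
    obtain ⟨⟨_, j, rfl⟩, hc⟩ := (IsLocalizedModule.eq_iff_exists (Submonoid.powers f) (awayBc L A f)).1 hs'
    obtain ⟨_, i, rfl⟩ := s
    refine ⟨j + i, ?_⟩
    rw [pow_add, mul_smul]
    exact (show f ^ j • m = f ^ j • f ^ i • z from hc) ▸ N.smul_mem _ hm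
  · rintro ⟨k, hk⟩
    refine ⟨_, hk, ⟨f ^ k, k, rfl⟩, ?_⟩
    rw [IsLocalizedModule.mk'_eq_iff, map_smul]
    rfl

lemma exists_smul_eq_bc_toAway (x : Localization.Away f ⊗[R] L) :
    ∃ (k : ℕ) (z : A ⊗[R] L), (toAway A f).hom (f ^ k) • x = bc L (toAway A f).hom z := by
  obtain ⟨⟨z, ⟨_, k, rfl⟩⟩, h⟩ := IsLocalizedModule.surj (Submonoid.powers f) (awayBc L A f) x
  refine ⟨k, z, ?_⟩
  rw [← awayBc_apply, ← h]
  exact algebraMap_smul (Localization.Away f) (f ^ k) x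

/-- The scalars that carry `z` into `N` form an ideal. It contains a power of an element outside
each prime, so no maximal ideal contains it. -/
lemma mem_of_local {N : Submodule A (A ⊗[R] L)} {z : A ⊗[R] L}
    (h : ∀ p : PrimeSpectrum A, ∃ f ∉ p.asIdeal,
      bc L (toAway A f).hom z ∈ subMap (toAway A f).hom N) : z ∈ N := by
  let 𝔞 : Ideal A := N.comap (LinearMap.toSpanSingleton A _ z)
  have h1 : 𝔞 = ⊤ := by
    by_contra hne
    obtain ⟨m, hm, hle⟩ := Ideal.exists_le_maximal 𝔞 hne
    obtain ⟨f, hf, hz⟩ := h ⟨m, hm.isPrime⟩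
    obtain ⟨k, hk⟩ := bc_toAway_mem_iff.1 hz
    exact hf (hm.isPrime.mem_of_pow_mem k (hle hk))
  have : (1 : A) ∈ 𝔞 := h1 ▸ Submodule.mem_top
  simpa [𝔞] using this

lemma subMap_mono {A B : Type u} [CommRing A] [Algebra R A] [CommRing B] [Algebra R B]
    (φ : A →ₐ[R] B) {N N' : Submodule A (A ⊗[R] L)} (h : N ≤ N') : subMap φ N ≤ subMap φ N' :=
  Submodule.span_mono (Set.image_mono h)

lemma bc_mem_subMap {A B : Type u} [CommRing A] [Algebra R A] [CommRing B] [Algebra R B]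
    (φ : A →ₐ[R] B) {N : Submodule A (A ⊗[R] L)} {z : A ⊗[R] L} (h : z ∈ N) :
    bc L φ z ∈ subMap φ N :=
  Submodule.subset_span ⟨z, h, rfl⟩

lemma le_of_local {N N' : Submodule A (A ⊗[R] L)} (h : ∀ p : PrimeSpectrum A, ∃ f ∉ p.asIdeal,
      subMap (toAway A f).hom N ≤ subMap (toAway A f).hom N') : N ≤ N' := fun z hz =>
  mem_of_local fun p => by
    obtain ⟨f, hf, hN⟩ := h p
    exact ⟨f, hf, hN (bc_mem_subMap _ hz)⟩

lemma eq_of_local {z z' : A ⊗[R] L} (h : ∀ p : PrimeSpectrum A, ∃ f ∉ p.asIdeal,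
      bc L (toAway A f).hom z = bc L (toAway A f).hom z') : z = z' := by
  rw [← sub_eq_zero, ← Submodule.mem_bot A]
  refine mem_of_local fun p => ?_
  obtain ⟨f, hf, hz⟩ := h p
  refine ⟨f, hf, ?_⟩
  rw [map_sub, hz, sub_self]
  exact zero_mem _

/-- Compatible submodules on a cover by basic open sets glue. -/
lemma exists_subMap_eq (f : PrimeSpectrum A → A) (hf : ∀ p, f p ∉ p.asIdeal)
    (N : ∀ p, Submodule (away A (f p)) (away A (f p) ⊗[R] L))
    (hN : ∀ (p q) (B : CommAlgCat.{u} R) (φ : away A (f p) ⟶ B) (ψ : away A (f q) ⟶ B),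
      toAway A (f p) ≫ φ = toAway A (f q) ≫ ψ → subMap φ.hom (N p) = subMap ψ.hom (N q)) :
    ∃ N' : Submodule A (A ⊗[R] L), ∀ p, subMap (toAway A (f p)).hom N' = N p := by
  have hcov : Ideal.span (Set.range f) = ⊤ := by
    by_contra hne
    obtain ⟨m, hm, hle⟩ := Ideal.exists_le_maximal _ hne
    exact hf ⟨m, hm.isPrime⟩ (hle (Ideal.subset_span ⟨_, rfl⟩))
  -- Only finitely many members of the cover enter the definition of the glued submodule, so that
  -- one exponent `K` can clear all denominators below.
  obtain ⟨t, ht, htop⟩ := (Ideal.span_eq_top_iff_finite _).1 hcov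
  have hts (q : t) : ∃ p, f p = q := ht q.2
  choose π hπ using hts
  have ht' (p : PrimeSpectrum A) : ∃ q : t, f (π q) ∉ p.asIdeal := by
    by_contra hne
    push Not at hne
    refine p.2.ne_top (top_le_iff.1 (htop ▸ Ideal.span_le.2 fun a ha => ?_))
    have := hne ⟨a, ha⟩
    rwa [hπ] at this
  -- comparison on overlaps
  have hcomp (p q : PrimeSpectrum A) (z : A ⊗[R] L)
      (hz : bc L (toAway A (f p)).hom z ∈ N p) :
      bc L (toAway (away A (f q)) ((toAway A (f q)).hom (f p))).hom (bc L (toAway A (f q)).hom z) ∈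
        subMap (toAway (away A (f q)) ((toAway A (f q)).hom (f p))).hom (N q) := by
    obtain ⟨φ, hφ⟩ := exists_away_lift (toAway A (f q) ≫ toAway (away A (f q)) _) (f p)
      (isUnit_toAway (away A (f q)) ((toAway A (f q)).hom (f p)))
    rw [← hN p q _ φ _ hφ, ← bc_comp]
    have : (toAway (away A (f q)) ((toAway A (f q)).hom (f p))).hom.comp (toAway A (f q)).hom =
        φ.hom.comp (toAway A (f p)).hom := congrArg CommAlgCat.Hom.hom hφ.symm
    rw [this, bc_comp]
    exact bc_mem_subMap _ hz
  let N' : Submodule A (A ⊗[R] L) :=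
    { carrier := {z | ∀ q : t, bc L (toAway A (f (π q))).hom z ∈ N (π q)}
      add_mem' := fun {x y} hx hy q => by rw [map_add]; exact add_mem (hx q) (hy q)
      zero_mem' := fun q => by rw [map_zero]; exact zero_mem _
      smul_mem' := fun a x hx q => by rw [bc_smul]; exact Submodule.smul_mem _ _ (hx q) }
  refine ⟨N', fun p => le_antisymm ?_ fun x hx => ?_⟩
  · refine Submodule.span_le.2 ?_
    rintro _ ⟨z, hz, rfl⟩
    refine mem_of_local (A := away A (f p)) fun P => ?_
    obtain ⟨q, hq⟩ := ht' (P.comap (toAway A (f p)).hom.toRingHom)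
    exact ⟨(toAway A (f p)).hom (f (π q)), hq, hcomp _ _ z (hz q)⟩
  · obtain ⟨k, z, hz⟩ := exists_smul_eq_bc_toAway x
    have hzN : bc L (toAway A (f p)).hom z ∈ N p := hz ▸ Submodule.smul_mem _ _ hx
    have hex (q : t) : ∃ k, bc L (toAway A (f (π q))).hom (f p ^ k • z) ∈ N (π q) := by
      obtain ⟨k, hk⟩ := bc_toAway_mem_iff.1 (hcomp p (π q) z hzN)
      refine ⟨k, ?_⟩
      rw [bc_smul, map_pow]
      exact hk
    choose k' hk' using hex
    let K := Finset.univ.sup k'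
    have hK : f p ^ K • z ∈ N' := fun q => by
      have : k' q ≤ K := Finset.le_sup (Finset.mem_univ q)
      rw [← Nat.sub_add_cancel this, pow_add, mul_smul, bc_smul]
      exact Submodule.smul_mem _ _ (hk' q)
    have h1 := bc_mem_subMap (toAway A (f p)).hom hK
    rw [bc_smul, ← hz, smul_smul, ← map_mul, ← pow_add, map_pow] at h1
    have hu : IsUnit ((toAway A (f p)).hom (f p) ^ (K + k)) := (isUnit_toAway A (f p)).pow _
    exact (Submodule.smul_mem_iff_of_isUnit _ hu).1 h1

end Away

/-! ### Base change and descent of the quotients -/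

section Quotient

variable {A B : Type u} [CommRing A] [Algebra R A] [CommRing B] [Algebra R B]

lemma exists_quotient_subMap_equiv (φ : A →ₐ[R] B) (N : Submodule A (A ⊗[R] L)) :
    letI : Algebra A B := φ.toAlgebra
    Nonempty (((B ⊗[R] L) ⧸ subMap φ N) ≃ₗ[B] B ⊗[A] ((A ⊗[R] L) ⧸ N)) :=
  letI : Algebra A B := φ.toAlgebra
  letI : IsScalarTower R A B := .of_algebraMap_eq' φ.comp_algebraMap.symm
  ⟨(Submodule.quotEquivOfEq _ _ (subMap_eq_ker φ N)).trans
      (Module.Grassmannian.baseChangeMkQEquiv N)⟩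

lemma finite_quotient_subMap (φ : A →ₐ[R] B) (N : Submodule A (A ⊗[R] L))
    [Module.Finite A ((A ⊗[R] L) ⧸ N)] : Module.Finite B ((B ⊗[R] L) ⧸ subMap φ N) := by
  let : Algebra A B := φ.toAlgebra
  obtain ⟨e⟩ := exists_quotient_subMap_equiv φ N
  exact Module.Finite.equiv e.symm

lemma projective_quotient_subMap (φ : A →ₐ[R] B) (N : Submodule A (A ⊗[R] L))
    [Module.Projective A ((A ⊗[R] L) ⧸ N)] :
    Module.Projective B ((B ⊗[R] L) ⧸ subMap φ N) := by
  let : Algebra A B := φ.toAlgebra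
  obtain ⟨e⟩ := exists_quotient_subMap_equiv φ N
  exact Module.Projective.of_equiv e.symm

lemma rankAtStalk_quotient_subMap (φ : A →ₐ[R] B) (N : Submodule A (A ⊗[R] L))
    [Module.Finite A ((A ⊗[R] L) ⧸ N)] [Module.Projective A ((A ⊗[R] L) ⧸ N)]
    (p : PrimeSpectrum B) :
    Module.rankAtStalk (R := B) ((B ⊗[R] L) ⧸ subMap φ N) p =
      Module.rankAtStalk (R := A) ((A ⊗[R] L) ⧸ N) (p.comap φ.toRingHom) := by
  let : Algebra A B := φ.toAlgebra
  obtain ⟨e⟩ := exists_quotient_subMap_equiv φ N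
  rw [Module.rankAtStalk_eq_of_equiv e, Module.rankAtStalk_baseChange]
  rfl

/-- Finite presentation and flatness are both local on the base, and together they give
projectivity. -/
lemma projective_quotient_of_local {A : CommAlgCat.{u} R} (f : PrimeSpectrum A → A)
    (hf : ∀ p, f p ∉ p.asIdeal) (N : Submodule A (A ⊗[R] L)) [Module.Finite R L]
    (h : ∀ p, Module.Projective (away A (f p))
      ((away A (f p) ⊗[R] L) ⧸ subMap (toAway A (f p)).hom N)) :
    Module.Projective A ((A ⊗[R] L) ⧸ N) := by
  have hcov : Ideal.span (Set.range f) = ⊤ := by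
    by_contra hne
    obtain ⟨m, hm, hle⟩ := Ideal.exists_le_maximal _ hne
    exact hf ⟨m, hm.isPrime⟩ (hle (Ideal.subset_span ⟨_, rfl⟩))
  have h' (g : Set.range f) : Module.Projective (Localization.Away g.1)
      ((Localization.Away g.1 ⊗[R] L) ⧸
        N.localized' (Localization.Away g.1) (Submonoid.powers g.1) (awayBc L A g.1)) := by
    obtain ⟨_, p, rfl⟩ := g
    have := h p
    rwa [subMap_toAway] at this
  have hfp : Module.FinitePresentation A ((A ⊗[R] L) ⧸ N) :=
    Module.FinitePresentation.of_localizationSpan' (Set.range f) hcov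
      (Rₚ := fun g => Localization.Away g.1)
      (fun g => N.toLocalizedQuotient' (Localization.Away g.1) (Submonoid.powers g.1) (awayBc L A g.1))
      (fun g => Module.finitePresentation_of_projective _ _)
  have hfl : Module.Flat A ((A ⊗[R] L) ⧸ N) :=
    Module.flat_of_isLocalized_span A ((A ⊗[R] L) ⧸ N) (Set.range f) hcov _
      (fun g => N.toLocalizedQuotient' (Localization.Away g.1) (Submonoid.powers g.1) (awayBc L A g.1))
      (fun g => (Module.flat_iff_of_isLocalization (Localization.Away g.1) (Submonoid.powers g.1) _).1
        inferInstance)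
  exact Module.Flat.projective_of_finitePresentation

end Quotient

end SubVec

/-! ### Coordinates -/

section Coord

variable {R : Type u} [CommRing R] {L : Type u} [Ring L] [Algebra R L]

variable (R L) in
/-- Finitely many elements and linear forms that exhibit a module as a direct summand of a finite
free module. -/
structure DualFamily (r : ℕ) where
  vec : Fin r → L
  form : Fin r → Module.Dual R L
  sum_eq : ∀ x, ∑ j, form j x • vec j = x

lemma exists_dualFamily [Module.Finite R L] [Module.Projective R L] :
    ∃ r, Nonempty (DualFamily R L r) := by
  obtain ⟨r, π, s, hπ, -, h⟩ := Module.Finite.exists_comp_eq_id_of_projective R L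
  refine ⟨r, ⟨⟨fun j => π (Pi.single j 1), fun j => LinearMap.proj j ∘ₗ s, fun x => ?_⟩⟩⟩
  have h1 : π (s x) = x := LinearMap.congr_fun h x
  conv_rhs => rw [← h1, ← Finset.univ_sum_single (s x), map_sum]
  refine Finset.sum_congr rfl fun j _ => ?_
  rw [← map_smul, ← Pi.single_smul]
  simp

section

variable {A B : Type u} [CommRing A] [Algebra R A] [CommRing B] [Algebra R B]

variable (A) in
/-- The base change of a linear form. -/
def coord (l : Module.Dual R L) : A ⊗[R] L →ₗ[A] A :=
  (AlgebraTensorModule.rid R A A).toLinearMap ∘ₗ LinearMap.baseChange A l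

@[simp] lemma coord_tmul (l : Module.Dual R L) (a : A) (x : L) :
    coord A l (a ⊗ₜ x) = l x • a := by
  simp [coord]

lemma coord_bc (l : Module.Dual R L) (φ : A →ₐ[R] B) (z : A ⊗[R] L) :
    coord B l (bc L φ z) = φ (coord A l z) := by
  induction z with
  | zero => simp
  | tmul a x => simp
  | add x y hx hy => simp only [map_add, hx, hy]

variable {r : ℕ} (β : DualFamily R L r)

variable (A) in
/-- The base change of a member of the dual family. -/
def DualFamily.elt (j : Fin r) : A ⊗[R] L := 1 ⊗ₜ β.vec j

variable (A) in
/-- The base change of a linear form of the dual family. -/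
def DualFamily.co (j : Fin r) : A ⊗[R] L →ₗ[A] A := coord A (β.form j)

lemma DualFamily.sum_co (z : A ⊗[R] L) : ∑ j, β.co A j z • β.elt A j = z := by
  induction z with
  | zero => simp
  | tmul a x =>
    simp only [co, elt, coord_tmul, smul_tmul', smul_eq_mul, mul_one]
    simp only [smul_tmul, ← tmul_sum, β.sum_eq]
  | add x y hx hy =>
    simp only [map_add, add_smul, Finset.sum_add_distrib, hx, hy]

lemma DualFamily.co_bc (φ : A →ₐ[R] B) (j : Fin r) (z : A ⊗[R] L) :
    β.co B j (bc L φ z) = φ (β.co A j z) :=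
  coord_bc _ _ _

lemma DualFamily.bc_elt (φ : A →ₐ[R] B) (j : Fin r) : bc L φ (β.elt A j) = β.elt B j := by
  simp [elt]

lemma DualFamily.co_elt (j k : Fin r) :
    β.co A j (β.elt A k) = algebraMap R A (β.form j (β.vec k)) := by
  simp [co, elt, Algebra.algebraMap_eq_smul_one]

lemma DualFamily.ext {z z' : A ⊗[R] L} (h : ∀ j, β.co A j z = β.co A j z') : z = z' := by
  rw [← β.sum_co z, ← β.sum_co z']
  simp only [h]

end

/-- Elements of an algebra are its points in the affine line, and points of a scheme glue. -/
lemma exists_glue_element {A : CommAlgCat.{u} R} (f : PrimeSpectrum A → A)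
    (hf : ∀ p, f p ∉ p.asIdeal) (x : ∀ p, away A (f p))
    (hx : ∀ (p q) (B : CommAlgCat.{u} R) (φ : away A (f p) ⟶ B) (ψ : away A (f q) ⟶ B),
      toAway A (f p) ≫ φ = toAway A (f q) ≫ ψ → φ.hom (x p) = ψ.hom (x q)) :
    ∃ y : A, ∀ p, (toAway A (f p)).hom y = x p := by
  let P : CommAlgCat.{u} R := quotRing (∅ : Set (MvPolynomial PUnit.{u + 1} R))
  have hev {B : CommAlgCat.{u} R} (b : B) : ∃ φ : P ⟶ B, φ.hom (quotVar _ PUnit.unit) = b := by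
    obtain ⟨φ, hφ⟩ := exists_quotRing_hom (S := (∅ : Set (MvPolynomial PUnit.{u + 1} R)))
      (fun _ => b) (by simp)
    exact ⟨φ, hφ _⟩
  choose ξ hξ using fun p => hev (x p)
  obtain ⟨y, hy⟩ := isZariskiGluing_points (specOver P) A f hf (fun p => specOverMap (ξ p))
    (fun p q B φ ψ h => by
      change specOverMap φ ≫ specOverMap (ξ p) = specOverMap ψ ≫ specOverMap (ξ q)
      rw [← specOverMap_comp, ← specOverMap_comp]
      congr 1
      refine quotRing_hom_ext fun _ => ?_
      have := hx p q B φ ψ h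
      rw [← hξ, ← hξ] at this
      exact this)
  obtain ⟨η, rfl⟩ := exists_specOverMap (R := R) y
  refine ⟨η.hom (quotVar _ PUnit.unit), fun p => ?_⟩
  have h1 : η ≫ toAway A (f p) = ξ p := by
    refine specOverMap_injective ?_
    rw [specOverMap_comp]
    exact hy p
  rw [← hξ, ← h1]
  rfl

lemma exists_glue_vector [Module.Finite R L] [Module.Projective R L] {A : CommAlgCat.{u} R}
    (f : PrimeSpectrum A → A) (hf : ∀ p, f p ∉ p.asIdeal) (x : ∀ p, away A (f p) ⊗[R] L)
    (hx : ∀ (p q) (B : CommAlgCat.{u} R) (φ : away A (f p) ⟶ B) (ψ : away A (f q) ⟶ B),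
      toAway A (f p) ≫ φ = toAway A (f q) ≫ ψ → bc L φ.hom (x p) = bc L ψ.hom (x q)) :
    ∃ y : A ⊗[R] L, ∀ p, bc L (toAway A (f p)).hom y = x p := by
  obtain ⟨r, ⟨β⟩⟩ := exists_dualFamily (R := R) (L := L)
  choose y hy using fun j => exists_glue_element f hf (fun p => β.co _ j (x p))
    fun p q B φ ψ h => by rw [← β.co_bc, ← β.co_bc, hx p q B φ ψ h]
  refine ⟨∑ j, y j • β.elt A j, fun p => ?_⟩
  rw [map_sum]
  simp only [bc_smul, hy, β.bc_elt]
  exact β.sum_co (x p)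

end Coord

/-! ### The functor of tuples of local direct summands and vectors -/

section SubVec

variable (R : Type u) [CommRing R] (L : Type u) [Ring L] [Algebra R L]
  (I E : Type u) [Fintype I] (D : ℕ)

/-- A family of local direct summands of `A ⊗ L` for which the ranks of the quotients add up
to `D`, together with a family of elements of `A ⊗ L`. -/
@[ext]
structure SubVec (A : Type u) [CommRing A] [Algebra R A] where
  sub : I → Submodule A (A ⊗[R] L)
  vec : E → A ⊗[R] L
  finite_quotient : ∀ i, Module.Finite A ((A ⊗[R] L) ⧸ sub i)
  projective_quotient : ∀ i, Module.Projective A ((A ⊗[R] L) ⧸ sub i)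
  rank_eq : ∀ p : PrimeSpectrum A,
    ∑ i, Module.rankAtStalk (R := A) ((A ⊗[R] L) ⧸ sub i) p = D

variable {R L I E D}

/-- The base change of families of local direct summands and elements. -/
def SubVec.map {A B : Type u} [CommRing A] [Algebra R A] [CommRing B] [Algebra R B]
    (φ : A →ₐ[R] B) (t : SubVec R L I E D A) : SubVec R L I E D B :=
  have := t.finite_quotient
  have := t.projective_quotient
  { sub := fun i => subMap φ (t.sub i)
    vec := fun α => bc L φ (t.vec α)
    finite_quotient := fun i => finite_quotient_subMap φ (t.sub i)
    projective_quotient := fun i => projective_quotient_subMap φ (t.sub i)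
    rank_eq := fun p => by
      simp only [rankAtStalk_quotient_subMap]
      exact t.rank_eq _ }

variable (R L I E D) in
/-- The functor of families of local direct summands and elements. -/
def subVecFunctor : CommAlgCat.{u} R ⥤ Type u where
  obj A := SubVec R L I E D A
  map φ := ↾SubVec.map φ.hom
  map_id A := by
    refine ConcreteCategory.hom_ext _ _ fun t => ?_
    exact SubVec.ext (funext fun i => subMap_id _) (funext fun α => bc_id _)
  map_comp φ ψ := by
    refine ConcreteCategory.hom_ext _ _ fun t => ?_
    exact SubVec.ext (funext fun i => subMap_comp _ _ _) (funext fun α => bc_comp _ _ _)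

lemma isZariskiSeparated_subVecFunctor : IsZariskiSeparated (subVecFunctor R L I E D) := by
  intro A x y h
  have h' (p : PrimeSpectrum A) : ∃ f ∉ p.asIdeal,
      SubVec.map (toAway A f).hom x = SubVec.map (toAway A f).hom y := h p
  refine SubVec.ext (funext fun i => ?_) (funext fun α => ?_)
  · refine le_antisymm (le_of_local fun p => ?_) (le_of_local fun p => ?_)
    · obtain ⟨f, hf, e⟩ := h' p
      exact ⟨f, hf, (congrArg (fun t => t.sub i) e).le⟩
    · obtain ⟨f, hf, e⟩ := h' p
      exact ⟨f, hf, (congrArg (fun t => t.sub i) e).ge⟩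
  · refine eq_of_local fun p => ?_
    obtain ⟨f, hf, e⟩ := h' p
    exact ⟨f, hf, congrArg (fun t => t.vec α) e⟩

lemma isZariskiGluing_subVecFunctor [Module.Finite R L] [Module.Projective R L] :
    IsZariskiGluing (subVecFunctor R L I E D) := by
  intro A f hf x hx
  let x' (p : PrimeSpectrum A) : SubVec R L I E D (away A (f p)) := x p
  have hx' (p q) (B : CommAlgCat.{u} R) (φ : away A (f p) ⟶ B) (ψ : away A (f q) ⟶ B)
      (h : toAway A (f p) ≫ φ = toAway A (f q) ≫ ψ) :
      SubVec.map φ.hom (x' p) = SubVec.map ψ.hom (x' q) := hx p q B φ ψ h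
  choose N hN using fun i => exists_subMap_eq f hf (fun p => (x' p).sub i)
    fun p q B φ ψ h => congrArg (fun t => t.sub i) (hx' p q B φ ψ h)
  choose v hv using fun α => exists_glue_vector f hf (fun p => (x' p).vec α)
    fun p q B φ ψ h => congrArg (fun t => t.vec α) (hx' p q B φ ψ h)
  have hproj (i) : Module.Projective A ((A ⊗[R] L) ⧸ N i) :=
    projective_quotient_of_local f hf (N i) fun p => by
      rw [hN]
      exact (x' p).projective_quotient i
  let t : SubVec R L I E D A :=
    { sub := N
      vec := v
      finite_quotient := fun i => inferInstance
      projective_quotient := hproj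
      rank_eq := fun p => by
        -- The rank at `p` is read off at a prime of the localization above `p`.
        obtain ⟨p', hp'⟩ : p ∈ Set.range (specOverMap (toAway A (f p))).left := by
          rw [range_specOverMap_toAway]; exact hf p
        let p'' : PrimeSpectrum (away A (f p)) := p'
        have h1 : p''.comap (toAway A (f p)).hom.toRingHom = p := hp'
        rw [← (x' p).rank_eq p'']
        refine Finset.sum_congr rfl fun i _ => ?_
        have h2 := rankAtStalk_quotient_subMap (toAway A (f p)).hom (N i) p''
        rw [h1] at h2
        rw [← h2, hN] }
  refine ⟨t, fun p => ?_⟩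
  exact SubVec.ext (funext fun i => hN i p) (funext fun α => hv α p)

end SubVec

/-! ### Charts -/

section Charts

open MvPolynomial Classical

variable {R : Type u} [CommRing R] {L : Type u} [Ring L] [Algebra R L] {r : ℕ}
  (β : DualFamily R L r) {I E : Type u} {D : ℕ}

/-- The equations of a chart: the entries of a matrix `q` with unit submatrix at the columns `J`,
and of coordinate vectors `w`. -/
structure IsChart {A : Type*} [CommRing A] [Algebra R A] (J : Fin D → I × Fin r)
    (q : Matrix (Fin D) (I × Fin r) A) (w : E → Fin r → A) : Prop where
  one : q.submatrix id J = 1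
  proj : ∀ d i k, ∑ k', q d (i, k') * algebraMap R A (β.form k' (β.vec k)) = q d (i, k)
  block : ∀ d x, (J d).1 ≠ x.1 → q d x = 0
  vec : ∀ e j, ∑ k, algebraMap R A (β.form j (β.vec k)) * w e k = w e j

variable (I E D r) in
/-- The variables in the equations of a chart. -/
abbrev ChartVar : Type u := (Fin D × (I × Fin r)) ⊕ (E × Fin r)

/-- The matrix of a family of variables. -/
def varMat {A : Type*} (a : ChartVar r I E D → A) : Matrix (Fin D) (I × Fin r) A :=
  fun d x => a (Sum.inl (d, x))

/-- The coordinate vectors of a family of variables. -/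
def varVec {A : Type*} (a : ChartVar r I E D → A) : E → Fin r → A :=
  fun e j => a (Sum.inr (e, j))

/-- The equations of a chart as a set of polynomials. -/
def chartRel (J : Fin D → I × Fin r) : Set (MvPolynomial (ChartVar r I E D) R) :=
  (Set.range fun x : Fin D × Fin D =>
      X (Sum.inl (x.1, J x.2)) - C ((1 : Matrix (Fin D) (Fin D) R) x.1 x.2)) ∪
    (Set.range fun x : Fin D × I × Fin r =>
      ∑ k', X (Sum.inl (x.1, (x.2.1, k'))) * C (β.form k' (β.vec x.2.2)) - X (Sum.inl x)) ∪
    (Set.range fun x : {x : Fin D × I × Fin r // (J x.1).1 ≠ x.2.1} => X (Sum.inl x.1)) ∪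
    (Set.range fun x : E × Fin r =>
      ∑ k, C (β.form x.2 (β.vec k)) * X (Sum.inr (x.1, k)) - X (Sum.inr x))

variable {β} {A : Type*} [CommRing A] [Algebra R A]

lemma isChart_iff (J : Fin D → I × Fin r) (a : ChartVar r I E D → A) :
    (∀ s ∈ chartRel β J, aeval a s = 0) ↔ IsChart β J (varMat a) (varVec a) := by
  constructor
  · intro h
    refine ⟨?_, fun d i k => ?_, fun d x hx => ?_, fun e j => ?_⟩
    · ext d d'
      have := h _ (Or.inl (Or.inl (Or.inl ⟨(d, d'), rfl⟩)))
      simp only [map_sub, aeval_X, aeval_C, sub_eq_zero] at this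
      rw [Matrix.submatrix_apply, varMat, id, this, Matrix.one_apply, Matrix.one_apply]
      split_ifs <;> simp
    · have := h _ (Or.inl (Or.inl (Or.inr ⟨(d, i, k), rfl⟩)))
      simpa only [map_sub, map_sum, map_mul, aeval_X, aeval_C, sub_eq_zero] using! this
    · have := h _ (Or.inl (Or.inr ⟨⟨(d, x), hx⟩, rfl⟩))
      simpa only [aeval_X] using! this
    · have := h _ (Or.inr ⟨(e, j), rfl⟩)
      simpa only [map_sub, map_sum, map_mul, aeval_X, aeval_C, sub_eq_zero] using! this
  · rintro h s (((⟨x, rfl⟩ | ⟨x, rfl⟩) | ⟨x, rfl⟩) | ⟨x, rfl⟩)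
    · have := congrFun (congrFun h.one x.1) x.2
      simp only [map_sub, aeval_X, aeval_C, sub_eq_zero]
      refine Eq.trans this ?_
      rw [Matrix.one_apply, Matrix.one_apply]
      split_ifs <;> simp
    · simp only [map_sub, map_sum, map_mul, aeval_X, aeval_C, sub_eq_zero]
      exact h.proj x.1 x.2.1 x.2.2
    · simp only [aeval_X]
      exact h.block x.1.1 x.1.2 x.2
    · simp only [map_sub, map_sum, map_mul, aeval_X, aeval_C, sub_eq_zero]
      exact h.vec x.1 x.2

/-! ### Homogeneous coordinates -/

variable (I E D r) in
/-- The index set of the homogeneous coordinates. -/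
abbrev CoordIndex : Type u := Option ((Fin D → I × Fin r) × Option (E × Fin r))

/-- The homogeneous coordinates of a matrix and a family of vectors. -/
def plucker (q : Matrix (Fin D) (I × Fin r) A) (w : E → Fin r → A) : CoordIndex r I E D → A
  | none => 0
  | some (J, none) => (q.submatrix id J).det
  | some (J, some x) => (q.submatrix id J).det * w x.1 x.2

lemma plucker_map {B : Type*} [CommRing B] (φ : A →+* B) (q : Matrix (Fin D) (I × Fin r) A)
    (w : E → Fin r → A) (x : CoordIndex r I E D) :
    plucker (q.map φ) (fun e j => φ (w e j)) x = φ (plucker q w x) := by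
  match x with
  | none => exact (map_zero φ).symm
  | some (J, none) => exact (φ.map_det _).symm
  | some (J, some x) =>
    simp only [plucker, map_mul, φ.map_det]
    rfl

/-- Exchanging column `d` of the unit matrix for a column with index `x` leaves a determinant equal
to the entry `d` of that column. So all entries of a normalized matrix are maximal minors of it. -/
lemma det_submatrix_update {q : Matrix (Fin D) (I × Fin r) A} {J : Fin D → I × Fin r}
    (h : q.submatrix id J = 1) (d : Fin D) (x : I × Fin r) :
    (q.submatrix id (Function.update J d x)).det = q d x := by
  have : q.submatrix id (Function.update J d x) =
      (1 : Matrix (Fin D) (Fin D) A).updateCol d (fun d' => q d' x) := by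
    rw [← h]
    ext d' e
    by_cases he : e = d
    · subst he; simp
    · simp [he]
  rw [this, ← Matrix.cramer_apply, Matrix.cramer_one]
  rfl

lemma mul_submatrix_id (g : Matrix (Fin D) (Fin D) A) (q : Matrix (Fin D) (I × Fin r) A)
    (J : Fin D → I × Fin r) : (g * q).submatrix id J = g * q.submatrix id J := rfl

/-- The matrices and vectors of two charts define the same point. -/
def ChartEquiv (q q' : Matrix (Fin D) (I × Fin r) A) (w w' : E → Fin r → A) : Prop :=
  w' = w ∧ ∃ g : Matrix (Fin D) (Fin D) A, IsUnit g.det ∧ q' = g * q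

/-- Left multiplication by an invertible matrix multiplies every coordinate by its determinant.
Conversely, proportional coordinates have proportional minors, and a matrix normalized at `J` is
determined by its minors. -/
lemma chartEquiv_iff {J K : Fin D → I × Fin r} {q q' : Matrix (Fin D) (I × Fin r) A}
    {w w' : E → Fin r → A} (h : q.submatrix id J = 1) (h' : q'.submatrix id K = 1) :
    ChartEquiv q q' w w' ↔ ∃ a : Aˣ, plucker q' w' = a.1 • plucker q w := by
  constructor
  · rintro ⟨rfl, g, hg, rfl⟩
    refine ⟨hg.unit, funext fun x => ?_⟩
    match x with
    | none => simp [plucker]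
    | some (J, none) => simp [plucker, mul_submatrix_id]
    | some (J, some x) => simp [plucker, mul_submatrix_id, mul_assoc]
  · rintro ⟨a, ha⟩
    have hdet (J' : Fin D → I × Fin r) :
        (q'.submatrix id J').det = a * (q.submatrix id J').det := congrFun ha (some (J', none))
    have ha' : (q'.submatrix id J).det = a := by
      rw [hdet, h, Matrix.det_one, mul_one]
    -- The minor at `J` is `1` for `q` and `a` for `q'`, so comparing the coordinates that contain
    -- this minor cancels the factor.
    have hw : w' = w := by
      ext e j
      have := congrFun ha (some (J, some (e, j)))
      simp only [plucker, Pi.smul_apply, smul_eq_mul, h, Matrix.det_one, one_mul, ha'] at this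
      exact a.isUnit.mul_left_cancel this
    have hu : IsUnit (q'.submatrix id J).det := ha' ▸ a.isUnit
    refine ⟨hw, q'.submatrix id J, hu, ?_⟩
    have h1 : ((q'.submatrix id J)⁻¹ * q').submatrix id J = 1 := by
      rw [mul_submatrix_id, Matrix.nonsing_inv_mul _ hu]
    -- Both sides are normalized at `J` and have the same maximal minors, hence the same entries.
    have h2 : (q'.submatrix id J)⁻¹ * q' = q := by
      ext d x
      rw [← det_submatrix_update h1, ← det_submatrix_update h, mul_submatrix_id, Matrix.det_mul,
        hdet, ← mul_assoc, ← ha', ← Matrix.det_mul, Matrix.nonsing_inv_mul _ hu, Matrix.det_one,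
        one_mul]
    conv_rhs => rw [← h2, ← Matrix.mul_assoc, Matrix.mul_nonsing_inv _ hu, Matrix.one_mul]

/-- Change of chart. -/
lemma IsChart.change {J K : Fin D → I × Fin r} {q : Matrix (Fin D) (I × Fin r) A}
    {w : E → Fin r → A} (h : IsChart β K q w) (hu : IsUnit (q.submatrix id J).det) :
    IsChart β J ((q.submatrix id J)⁻¹ * q) w := by
  set g := q.submatrix id J with hg
  -- By the block condition, `g` intertwines the diagonal idempotents that select the indices
  -- belonging to a fixed vertex, those of `J` on the right and those of `K` on the left. Its
  -- inverse does so in the other direction, so the block condition survives the change of chart.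
  have hinv (d d') (hne : (J d).1 ≠ (K d').1) : g⁻¹ d d' = 0 := by
    let E₁ : Matrix (Fin D) (Fin D) A :=
      Matrix.diagonal fun e => if (J e).1 = (J d).1 then 1 else 0
    let F₁ : Matrix (Fin D) (Fin D) A :=
      Matrix.diagonal fun e => if (K e).1 = (J d).1 then 1 else 0
    have hc : g * E₁ = F₁ * g := by
      ext e e'
      simp only [E₁, F₁, Matrix.mul_diagonal, Matrix.diagonal_mul]
      by_cases h0 : (K e).1 = (J e').1
      · simp [h0]
      · simp [hg, h.block e (J e') h0]
    have hc' : E₁ * g⁻¹ = g⁻¹ * F₁ := by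
      calc E₁ * g⁻¹ = g⁻¹ * (g * E₁) * g⁻¹ := by
            rw [← Matrix.mul_assoc, Matrix.nonsing_inv_mul _ hu, Matrix.one_mul]
        _ = g⁻¹ * F₁ := by
            rw [hc, Matrix.mul_assoc, Matrix.mul_assoc, Matrix.mul_nonsing_inv _ hu,
              Matrix.mul_one]
    have := congrFun (congrFun hc' d) d'
    simpa [E₁, F₁, Matrix.mul_diagonal, Matrix.diagonal_mul, Ne.symm hne] using this
  refine ⟨?_, fun d i k => ?_, fun d x hx => ?_, h.vec⟩
  · rw [mul_submatrix_id, Matrix.nonsing_inv_mul _ hu]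
  · simp only [Matrix.mul_apply, Finset.sum_mul]
    rw [Finset.sum_comm]
    refine Finset.sum_congr rfl fun e _ => ?_
    simp only [mul_assoc, ← Finset.mul_sum, h.proj]
  · rw [Matrix.mul_apply]
    refine Finset.sum_eq_zero fun d' _ => ?_
    by_cases h0 : (J d).1 = (K d').1
    · rw [h.block d' x (h0 ▸ hx), mul_zero]
    · rw [hinv d d' h0, zero_mul]

end Charts

/-! ### The point defined by a chart -/

section ChartPoint

open Classical

variable {R : Type u} [CommRing R] {L : Type u} [Ring L] [Algebra R L] {r : ℕ}
  (β : DualFamily R L r) {I E : Type u} {D : ℕ}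
variable {A B : Type u} [CommRing A] [Algebra R A] [CommRing B] [Algebra R B]

/-- The linear map `A ⊗ L → A ^ D` given by the columns of a matrix that belong to `i`. -/
def chartMap (q : Matrix (Fin D) (I × Fin r) A) (i : I) : A ⊗[R] L →ₗ[A] Fin D → A :=
  LinearMap.pi fun d => ∑ k, q d (i, k) • β.co A k

lemma chartMap_apply (q : Matrix (Fin D) (I × Fin r) A) (i : I) (z : A ⊗[R] L) (d : Fin D) :
    chartMap β q i z d = ∑ k, q d (i, k) * β.co A k z := by
  simp [chartMap]

lemma chartMap_mul (g : Matrix (Fin D) (Fin D) A) (q : Matrix (Fin D) (I × Fin r) A) (i : I)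
    (z : A ⊗[R] L) : chartMap β (g * q) i z = g.mulVec (chartMap β q i z) := by
  ext d
  simp only [chartMap_apply, Matrix.mul_apply, Matrix.mulVec, dotProduct, Finset.sum_mul,
    Finset.mul_sum, mul_assoc]
  exact Finset.sum_comm

lemma chartMap_bc (φ : A →ₐ[R] B) (q : Matrix (Fin D) (I × Fin r) A) (i : I) (z : A ⊗[R] L)
    (d : Fin D) : chartMap β (q.map φ) i (bc L φ z) d = φ (chartMap β q i z d) := by
  simp [chartMap_apply, β.co_bc]

variable {β} {J : Fin D → I × Fin r} {q : Matrix (Fin D) (I × Fin r) A} {w : E → Fin r → A}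

lemma IsChart.map (h : IsChart β J q w) (φ : A →ₐ[R] B) :
    IsChart β J (q.map φ) (fun e j => φ (w e j)) where
  one := by
    rw [Matrix.submatrix_map, h.one]
    exact Matrix.map_one φ (map_zero φ) (map_one φ)
  proj d i k := by
    have := congrArg φ (h.proj d i k)
    simpa using this
  block d x hx := by simp [h.block d x hx]
  vec e j := by
    have := congrArg φ (h.vec e j)
    simpa using this

/-- The family `β` need not be a basis. The equation `proj` says that each block of a row is fixed
by the idempotent matrix of the family, so it is the list of values of a linear form on `A ⊗ L`. -/
lemma IsChart.chartMap_elt (h : IsChart β J q w) (i : I) (k : Fin r) (d : Fin D) :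
    chartMap β q i (β.elt A k) d = q d (i, k) := by
  simp only [chartMap_apply, β.co_elt, h.proj]

lemma IsChart.chartMap_eq_zero (h : IsChart β J q w) {i : I} (z : A ⊗[R] L) {d : Fin D}
    (hd : (J d).1 ≠ i) : chartMap β q i z d = 0 := by
  rw [chartMap_apply]
  exact Finset.sum_eq_zero fun k _ => by rw [h.block d (i, k) hd, zero_mul]

lemma IsChart.chartMap_elt_column (h : IsChart β J q w) {i : I} {d' : Fin D} (hd : (J d').1 = i) :
    chartMap β q i (β.elt A (J d').2) = Pi.single d' 1 := by
  ext d
  rw [h.chartMap_elt]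
  subst hd
  have := congrFun (congrFun h.one d) d'
  rw [Matrix.submatrix_apply, id] at this
  rw [this, Matrix.one_apply, Pi.single_apply]

/-- Lifts of vectors along `chartMap`. -/
def chartLift (β : DualFamily R L r) (J : Fin D → I × Fin r) : (Fin D → A) →ₗ[A] A ⊗[R] L :=
  Fintype.linearCombination A fun d => β.elt A (J d).2

lemma IsChart.chartMap_chartLift (h : IsChart β J q w) {i : I} {v : Fin D → A}
    (hv : ∀ d, (J d).1 ≠ i → v d = 0) : chartMap β q i (chartLift β J v) = v := by
  rw [chartLift, Fintype.linearCombination_apply, map_sum]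
  conv_rhs => rw [← Finset.univ_sum_single v]
  refine Finset.sum_congr rfl fun d _ => ?_
  rw [map_smul]
  by_cases hd : (J d).1 = i
  · rw [h.chartMap_elt_column hd, ← Pi.single_smul, smul_eq_mul, mul_one]
  · simp [hv d hd]

variable (β) in
/-- The submodule defined by a chart. -/
def chartSub (q : Matrix (Fin D) (I × Fin r) A) (i : I) : Submodule A (A ⊗[R] L) :=
  (chartMap β q i).ker

variable (β J) in
/-- A projection onto the submodule defined by a chart. -/
def chartProj (q : Matrix (Fin D) (I × Fin r) A) (i : I) : A ⊗[R] L →ₗ[A] A ⊗[R] L :=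
  LinearMap.id - chartLift β J ∘ₗ chartMap β q i

lemma chartProj_bc (φ : A →ₐ[R] B) (i : I) (z : A ⊗[R] L) :
    chartProj β J (q.map φ) i (bc L φ z) = bc L φ (chartProj β J q i z) := by
  simp only [chartProj, LinearMap.sub_apply, LinearMap.id_apply, LinearMap.comp_apply, map_sub,
    chartLift, Fintype.linearCombination_apply, map_sum, bc_smul, chartMap_bc, β.bc_elt]

lemma chartProj_of_mem {i : I} {z : A ⊗[R] L} (hz : z ∈ chartSub β q i) :
    chartProj β J q i z = z := by
  have : chartMap β q i z = 0 := hz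
  simp [chartProj, this]

lemma IsChart.chartProj_mem (h : IsChart β J q w) (i : I) (z : A ⊗[R] L) :
    chartProj β J q i z ∈ chartSub β q i := by
  change chartMap β q i (z - chartLift β J (chartMap β q i z)) = 0
  rw [map_sub, h.chartMap_chartLift fun d hd => h.chartMap_eq_zero z hd, sub_self]

/-- The kernel is the image of a projection that is given by the same formula over every algebra,
and images of projections commute with base change. -/
lemma IsChart.subMap_chartSub (h : IsChart β J q w) (φ : A →ₐ[R] B) (i : I) :
    subMap φ (chartSub β q i) = chartSub β (q.map φ) i := by
  apply le_antisymm
  · refine Submodule.span_le.2 ?_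
    rintro _ ⟨z, hz, rfl⟩
    have hz' : chartMap β q i z = 0 := hz
    change chartMap β (q.map φ) i (bc L φ z) = 0
    ext d
    rw [chartMap_bc, hz']
    simp
  · intro y hy
    have hmem : ∀ y : B ⊗[R] L, chartProj β J (q.map φ) i y ∈ subMap φ (chartSub β q i) := by
      intro y
      rw [← β.sum_co y, map_sum]
      refine Submodule.sum_mem _ fun j _ => ?_
      rw [map_smul, ← β.bc_elt φ, chartProj_bc]
      exact Submodule.smul_mem _ _ (bc_mem_subMap φ (h.chartProj_mem i _))
    rw [← chartProj_of_mem (J := J) hy]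
    exact hmem y

/-- The quotient by the submodule defined by a chart is free. -/
lemma IsChart.exists_quotient_equiv (h : IsChart β J q w) (i : I) :
    Nonempty (((A ⊗[R] L) ⧸ chartSub β q i) ≃ₗ[A] ({d : Fin D // (J d).1 = i} → A)) := by
  let π : A ⊗[R] L →ₗ[A] ({d : Fin D // (J d).1 = i} → A) :=
    LinearMap.funLeft A A Subtype.val ∘ₗ chartMap β q i
  have hker : chartSub β q i = π.ker := by
    ext z
    constructor
    · intro hz
      have hz' : chartMap β q i z = 0 := hz
      simp [π, hz']
    · intro hz
      change chartMap β q i z = 0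
      ext d
      by_cases hd : (J d).1 = i
      · exact congrFun (show π z = 0 from hz) ⟨d, hd⟩
      · exact h.chartMap_eq_zero z hd
  have hsurj : Function.Surjective π := by
    intro v
    let v' : Fin D → A := fun d => if hd : (J d).1 = i then v ⟨d, hd⟩ else 0
    refine ⟨chartLift β J v', ?_⟩
    ext d
    change chartMap β q i (chartLift β J v') d.1 = v d
    rw [h.chartMap_chartLift (fun d hd => by simp [v', hd])]
    simp [v', d.2]
  exact ⟨(Submodule.quotEquivOfEq _ _ hker).trans (π.quotKerEquivOfSurjective hsurj)⟩

/-- A generator minus its expression in the generators of `J` lies in the submodule of `q`, hence in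
that of `q'`. Evaluating the map of `q'` on it gives the columns of the matrix identity. -/
lemma eq_mul_of_chartSub_le {K : Fin D → I × Fin r} {q' : Matrix (Fin D) (I × Fin r) A}
    {w' : E → Fin r → A} (h : IsChart β J q w) (h' : IsChart β K q' w')
    (hle : ∀ i, chartSub β q i ≤ chartSub β q' i) : q' = q'.submatrix id J * q := by
  ext d x
  obtain ⟨i, k⟩ := x
  have h1 : chartMap β q' i (chartProj β J q i (β.elt A k)) = 0 := hle i (h.chartProj_mem i _)
  have h2 := congrFun h1 d
  simp only [chartProj, LinearMap.sub_apply, LinearMap.id_apply, LinearMap.comp_apply, map_sub,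
    chartLift, Fintype.linearCombination_apply, map_sum, map_smul, Pi.sub_apply, Finset.sum_apply,
    Pi.smul_apply, h'.chartMap_elt, h.chartMap_elt, Pi.zero_apply, sub_eq_zero] at h2
  rw [h2, Matrix.mul_apply]
  refine Finset.sum_congr rfl fun d' _ => ?_
  rw [Matrix.submatrix_apply, id, smul_eq_mul, mul_comm]
  by_cases hd : (J d').1 = i
  · subst hd; rfl
  · rw [h.block d' (i, k) hd, mul_zero, mul_zero]

variable [Fintype I]

/-- The point defined by a chart. -/
def chartPoint (h : IsChart β J q w) : SubVec R L I E D A where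
  sub := chartSub β q
  vec e := ∑ j, w e j • β.elt A j
  finite_quotient i := by
    obtain ⟨e⟩ := h.exists_quotient_equiv i
    exact Module.Finite.equiv e.symm
  projective_quotient i := by
    obtain ⟨e⟩ := h.exists_quotient_equiv i
    exact Module.Projective.of_equiv e.symm
  rank_eq p := by
    have := p.nontrivial
    have hr (i : I) : Module.rankAtStalk (R := A) ((A ⊗[R] L) ⧸ chartSub β q i) p =
        Fintype.card {d : Fin D // (J d).1 = i} := by
      obtain ⟨e⟩ := h.exists_quotient_equiv i
      rw [Module.rankAtStalk_eq_of_equiv e, Module.rankAtStalk_eq_finrank_of_free]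
      simp
    simp only [hr]
    -- The quotient for `i` has as basis the indices `d` with vertex `i`, and these fibres partition
    -- the `D` indices.
    rw [← Fintype.card_sigma, Fintype.card_congr (Equiv.sigmaFiberEquiv fun d => (J d).1),
      Fintype.card_fin]

lemma map_chartPoint (h : IsChart β J q w) (φ : A →ₐ[R] B) :
    SubVec.map φ (chartPoint h) = chartPoint (h.map φ) := by
  refine SubVec.ext (funext fun i => h.subMap_chartSub φ i) (funext fun e => ?_)
  change bc L φ (∑ j, w e j • β.elt A j) = ∑ j, φ (w e j) • β.elt B j
  simp only [map_sum, bc_smul, β.bc_elt]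

lemma co_vec_chartPoint (h : IsChart β J q w) (e : E) (j : Fin r) :
    β.co A j ((chartPoint h).vec e) = w e j := by
  change β.co A j (∑ k, w e k • β.elt A k) = _
  simp only [map_sum, map_smul, β.co_elt, smul_eq_mul]
  rw [← h.vec e j]
  exact Finset.sum_congr rfl fun k _ => mul_comm _ _

lemma chartPoint_eq_iff {K : Fin D → I × Fin r} {q' : Matrix (Fin D) (I × Fin r) A}
    {w' : E → Fin r → A} (h : IsChart β J q w) (h' : IsChart β K q' w') :
    chartPoint h = chartPoint h' ↔ ChartEquiv q q' w w' := by
  constructor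
  · intro e
    have hs (i : I) : chartSub β q i = chartSub β q' i := congrArg (fun t => t.sub i) e
    refine ⟨?_, q'.submatrix id J, ?_, eq_mul_of_chartSub_le h h' fun i => (hs i).le⟩
    · ext e' j
      rw [← co_vec_chartPoint h, ← co_vec_chartPoint h', e]
    · have h1 := eq_mul_of_chartSub_le h h' fun i => (hs i).le
      -- On the columns `K` the identity reads `1 = q'_J * q_K`, so the transition matrix is
      -- invertible.
      have h2 := congrArg (fun m => m.submatrix id K) h1
      simp only [mul_submatrix_id, h'.one] at h2
      exact Matrix.isUnit_det_of_right_inverse h2.symm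
  · rintro ⟨rfl, g, hg, rfl⟩
    refine SubVec.ext (funext fun i => ?_) rfl
    change chartSub β q i = chartSub β (g * q) i
    ext z
    change chartMap β q i z = 0 ↔ chartMap β (g * q) i z = 0
    rw [chartMap_mul]
    constructor
    · intro hz; rw [hz, Matrix.mulVec_zero]
    · intro hz
      have := congrArg (g⁻¹.mulVec) hz
      rwa [Matrix.mulVec_mulVec, Matrix.nonsing_inv_mul _ hg, Matrix.one_mulVec,
        Matrix.mulVec_zero] at this

end ChartPoint

/-! ### Charts cover -/

section Cover

/-- Near a prime, finitely many generators of a finite projective module contain a generating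
family whose length is the rank. -/
lemma exists_generators_of_rankAtStalk {A : Type u} [CommRing A] {Q : Type u} [AddCommGroup Q]
    [Module A Q] [Module.Finite A Q] [Module.Projective A Q] {ι : Type u} [Finite ι] (g : ι → Q)
    (hg : Submodule.span A (Set.range g) = ⊤) (p : PrimeSpectrum A) {D : ℕ}
    (hD : Module.rankAtStalk (R := A) Q p = D) :
    ∃ J : Fin D → ι, ∃ f ∉ p.asIdeal, ∀ x, f • g x ∈ Submodule.span A (Set.range (g ∘ J)) := by
  let S := p.asIdeal.primeCompl
  let Ap := Localization.AtPrime p.asIdeal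
  let Qp := LocalizedModule S Q
  let ℓ : Q →ₗ[A] Qp := LocalizedModule.mkLinearMap S Q
  have hproj : Module.Projective Ap Qp := Module.projective_of_isLocalizedModule S ℓ
  have hfin : Module.Finite Ap Qp := Module.Finite.of_isLocalizedModule S ℓ
  have hfp : Module.FinitePresentation Ap Qp := Module.finitePresentation_of_projective _ _
  have hspan : Submodule.span Ap (Set.range (ℓ ∘ g)) = ⊤ := by
    rw [Set.range_comp, ← Submodule.localized'_span Ap S ℓ, hg, Submodule.localized'_top]
  -- Over the local ring at `p`, the module is free and a basis can be selected among the
  -- generators.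
  obtain ⟨κ, a, b, hb⟩ := Module.exists_basis_of_span_of_flat (ℓ ∘ g) hspan
  have hcard : Nat.card κ = D := by
    rw [← hD]
    exact (Module.finrank_eq_nat_card_basis b).symm
  have hκ : Finite κ := Module.Finite.finite_basis b
  let e : Fin D ≃ κ := (finCongr hcard.symm).trans (Finite.equivFin κ).symm
  have hJ : Submodule.span Ap (ℓ '' Set.range (g ∘ a ∘ e)) = ⊤ := by
    rw [← b.span_eq, ← Set.range_comp]
    congr 1
    have h1 : ℓ ∘ g ∘ a ∘ e = b ∘ e := by ext x; exact (hb _).symm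
    rw [h1, e.surjective.range_comp]
  rw [← Submodule.localized'_span Ap S ℓ] at hJ
  have hx (x : ι) : ∃ s : S, s.1 • g x ∈ Submodule.span A (Set.range (g ∘ a ∘ e)) := by
    have h1 : ℓ (g x) ∈ (Submodule.span A (Set.range (g ∘ a ∘ e))).localized' Ap S ℓ :=
      hJ ▸ Submodule.mem_top
    obtain ⟨m, hm, s, hs⟩ := (Submodule.mem_localized' _ _ _ _ _).1 h1
    rw [IsLocalizedModule.mk'_eq_iff] at hs
    have hs' : ℓ m = ℓ (s.1 • g x) := by rw [map_smul]; exact hs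
    obtain ⟨c, hc⟩ := (IsLocalizedModule.eq_iff_exists S ℓ).1 hs'
    refine ⟨c * s, ?_⟩
    rw [Submonoid.coe_mul, mul_smul]
    exact (show c.1 • m = c.1 • s.1 • g x from hc) ▸ Submodule.smul_mem _ _ hm
  choose s hs using hx
  have := Fintype.ofFinite ι
  -- One denominator for all generators at once: the product of the individual ones.
  refine ⟨a ∘ e, ((∏ x, s x : S) : A), (∏ x, s x : S).2, fun x => ?_⟩
  classical
  rw [← Finset.prod_erase_mul _ _ (Finset.mem_univ x), Submonoid.coe_mul, mul_smul]
  exact Submodule.smul_mem _ _ (hs x)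

open Classical

variable {R : Type u} [CommRing R] {L : Type u} [Ring L] [Algebra R L] {r : ℕ}
  (β : DualFamily R L r) {I E : Type u} {D : ℕ}

variable (A : Type u) [CommRing A] [Algebra R A] in
/-- The components of the generators of a sum of quotients of `A ⊗ L`. -/
def genVec (x : I × Fin r) (i : I) : A ⊗[R] L := if x.1 = i then β.elt A x.2 else 0

lemma bc_genVec {A B : Type u} [CommRing A] [Algebra R A] [CommRing B] [Algebra R B]
    (φ : A →ₐ[R] B) (x : I × Fin r) (i : I) : bc L φ (genVec β A x i) = genVec β B x i := by
  unfold genVec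
  split_ifs
  · exact β.bc_elt φ _
  · exact map_zero _

variable {A : Type u} [CommRing A] [Algebra R A]

/-- The generators of a sum of quotients of `A ⊗ L`. -/
def genQuot (N : I → Submodule A (A ⊗[R] L)) (x : I × Fin r) : ∀ i, (A ⊗[R] L) ⧸ N i :=
  fun i => (N i).mkQ (genVec β A x i)

lemma genQuot_eq_single (N : I → Submodule A (A ⊗[R] L)) (x : I × Fin r) :
    genQuot β N x = Pi.single x.1 ((N x.1).mkQ (β.elt A x.2)) := by
  ext i
  by_cases h : x.1 = i
  · subst h; simp [genQuot, genVec]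
  · simp [genQuot, genVec, h]

lemma single_mkQ (N : I → Submodule A (A ⊗[R] L)) (i : I) (z : A ⊗[R] L) :
    (Pi.single i ((N i).mkQ z) : ∀ i, (A ⊗[R] L) ⧸ N i) =
      ∑ k, β.co A k z • genQuot β N (i, k) := by
  conv_lhs => rw [← β.sum_co z]
  simp only [genQuot_eq_single, map_sum, map_smul]
  ext j
  by_cases h : j = i
  · subst h; simp
  · simp [h]

lemma span_genQuot [Finite I] (N : I → Submodule A (A ⊗[R] L)) :
    Submodule.span A (Set.range (genQuot β N)) = ⊤ := by
  have := Fintype.ofFinite I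
  rw [eq_top_iff]
  intro y _
  rw [← Finset.univ_sum_single y]
  refine Submodule.sum_mem _ fun i _ => ?_
  obtain ⟨z, hz⟩ := (N i).mkQ_surjective (y i)
  rw [← hz, single_mkQ β]
  exact Submodule.sum_mem _ fun k _ => Submodule.smul_mem _ _ (Submodule.subset_span ⟨_, rfl⟩)

variable [Fintype I]

lemma SubVec.projective_pi (t : SubVec R L I E D A) :
    Module.Projective A (∀ i, (A ⊗[R] L) ⧸ t.sub i) :=
  have := t.projective_quotient
  Module.Projective.of_equiv (DFinsupp.linearEquivFunOnFintype (R := A))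

lemma SubVec.rankAtStalk_pi (t : SubVec R L I E D A) (p : PrimeSpectrum A) :
    Module.rankAtStalk (R := A) (∀ i, (A ⊗[R] L) ⧸ t.sub i) p = D := by
  have := t.finite_quotient
  have := t.projective_quotient
  rw [Module.rankAtStalk_pi, finsum_eq_sum_of_fintype, t.rank_eq]

/-- A point for which the generators of a chart span comes from the chart. -/
lemma exists_chartPoint_eq (t : SubVec R L I E D A) (J : Fin D → I × Fin r)
    (hJ : ∀ x, genQuot β t.sub x ∈ Submodule.span A (Set.range (genQuot β t.sub ∘ J))) :
    ∃ (q : Matrix (Fin D) (I × Fin r) A) (w : E → Fin r → A) (h : IsChart β J q w),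
      chartPoint h = t := by
  have := t.finite_quotient
  have := t.projective_pi
  let π : (Fin D → A) →ₗ[A] (∀ i, (A ⊗[R] L) ⧸ t.sub i) :=
    Fintype.linearCombination A (genQuot β t.sub ∘ J)
  have hsurj : Function.Surjective π := by
    rw [← LinearMap.range_eq_top, Fintype.range_linearCombination, ← top_le_iff,
      ← span_genQuot β t.sub, Submodule.span_le]
    rintro _ ⟨x, rfl⟩
    exact hJ x
  -- A surjection between finite projective modules of the same rank is bijective, so the generators
  -- with indices in `J` form a basis.
  have hbij : Function.Bijective π :=
    Module.bijective_of_surjective_of_rankAtStalk_eq hsurj fun m _ => by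
      have : Nontrivial A := (⟨m, inferInstance⟩ : PrimeSpectrum A).nontrivial
      rw [t.rankAtStalk_pi, Module.rankAtStalk_eq_finrank_of_free]
      simp
  let e := LinearEquiv.ofBijective π hbij
  have he (c : Fin D → A) : e c = ∑ d, c d • genQuot β t.sub (J d) :=
    Fintype.linearCombination_apply _ _ _
  let q : Matrix (Fin D) (I × Fin r) A := fun d x => e.symm (genQuot β t.sub x) d
  have key (i : I) (z : A ⊗[R] L) :
      e.symm (Pi.single i ((t.sub i).mkQ z)) = chartMap β q i z := by
    ext d
    rw [single_mkQ β, chartMap_apply, map_sum, Finset.sum_apply]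
    refine Finset.sum_congr rfl fun k _ => ?_
    rw [map_smul, Pi.smul_apply, smul_eq_mul, mul_comm]
  have h : IsChart β J q (fun a j => β.co A j (t.vec a)) := by
    refine ⟨?_, fun d i k => ?_, fun d x hx => ?_, fun a j => ?_⟩
    · ext d d'
      have h1 : e (Pi.single d' 1) = genQuot β t.sub (J d') := by
        rw [he, Finset.sum_eq_single d' (fun d _ hd => by rw [Pi.single_eq_of_ne hd]; exact zero_smul A (genQuot β t.sub (J d))) (by simp),
          Pi.single_eq_same]
        exact one_smul A _
      rw [Matrix.submatrix_apply, id, Matrix.one_apply]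
      change e.symm (genQuot β t.sub (J d')) d = _
      rw [← h1, e.symm_apply_apply, Pi.single_apply]
    · have h1 := congrFun (key i (β.elt A k)) d
      rw [chartMap_apply] at h1
      simp only [β.co_elt] at h1
      rw [← h1]
      change _ = e.symm (genQuot β t.sub (i, k)) d
      rw [genQuot_eq_single]
    · let c := e.symm (genQuot β t.sub x)
      -- The part of the relation that belongs to the vertex of `J d` maps to the component of the
      -- generator `x` at this vertex, which is zero. By injectivity this part of the coefficients
      -- vanishes.
      let c' : Fin D → A := fun d' => if (J d').1 = (J d).1 then c d' else 0
      have hc : e c = genQuot β t.sub x := e.apply_symm_apply _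
      have hc' : e c' = 0 := by
        ext i
        rw [he, Finset.sum_apply, Pi.zero_apply]
        by_cases hi : i = (J d).1
        · have h1 : (genQuot β t.sub x) i = 0 := by
            rw [genQuot_eq_single, Pi.single_eq_of_ne (by rw [hi]; exact hx)]
          rw [← h1, ← hc, he, Finset.sum_apply]
          refine Finset.sum_congr rfl fun d' _ => ?_
          simp only [Pi.smul_apply, c']
          split_ifs with h2
          · rfl
          · rw [genQuot_eq_single, Pi.single_eq_of_ne (by rw [hi]; exact Ne.symm h2), smul_zero,
              smul_zero]
        · refine Finset.sum_eq_zero fun d' _ => ?_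
          simp only [Pi.smul_apply, c']
          split_ifs with h2
          · rw [genQuot_eq_single, Pi.single_eq_of_ne (by rw [h2]; exact hi), smul_zero]
          · rw [zero_smul]
      have h3 : c' d = 0 := by
        have : c' = 0 := by simpa using hc'
        rw [this]; rfl
      simpa [c'] using h3
    · have h1 := congrArg (β.co A j) (β.sum_co (t.vec a))
      simp only [map_sum, map_smul, β.co_elt, smul_eq_mul] at h1
      rw [← h1]
      exact Finset.sum_congr rfl fun k _ => mul_comm _ _
  refine ⟨q, _, h, SubVec.ext (funext fun i => ?_) (funext fun a => β.sum_co (t.vec a))⟩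
  ext z
  change chartMap β q i z = 0 ↔ _
  rw [← key, LinearEquiv.map_eq_zero_iff]
  have h0 : (0 : ∀ i, (A ⊗[R] L) ⧸ t.sub i) = Pi.single i 0 := by simp
  rw [h0, Pi.single_inj]
  simp

/-- Near each prime, a point comes from a chart. -/
lemma exists_chartPoint_eq_map {A : CommAlgCat.{u} R} (t : SubVec R L I E D A)
    (p : PrimeSpectrum A) : ∃ f ∉ p.asIdeal, ∃ (J : Fin D → I × Fin r)
      (q : Matrix (Fin D) (I × Fin r) (away A f)) (w : E → Fin r → away A f)
      (h : IsChart β J q w), chartPoint h = SubVec.map (toAway A f).hom t := by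
  have := t.finite_quotient
  have := t.projective_pi
  obtain ⟨J, f, hf, hJ⟩ := exists_generators_of_rankAtStalk (genQuot β t.sub)
    (span_genQuot β t.sub) p (t.rankAtStalk_pi p)
  refine ⟨f, hf, J, exists_chartPoint_eq β _ J fun x => ?_⟩
  obtain ⟨c, hc⟩ := (Submodule.mem_span_range_iff_exists_fun A).1 (hJ x)
  have hu := isUnit_toAway A f
  refine (Submodule.smul_mem_iff_of_isUnit _ hu).1
    ((Submodule.mem_span_range_iff_exists_fun _).2 ⟨fun d => (toAway A f).hom (c d), ?_⟩)
  ext i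
  have h1 := congrFun hc i
  -- The relation between classes is lifted to `A ⊗ L`, where base change is explicit, before
  -- passing to the localization.
  have h2 : ∑ d, c d • genVec β A (J d) i - f • genVec β A x i ∈ t.sub i := by
    rw [← Submodule.Quotient.mk_eq_zero, ← Submodule.mkQ_apply, map_sub, map_sum, sub_eq_zero,
      map_smul]
    simpa [genQuot] using h1
  have h3 := bc_mem_subMap (toAway A f).hom h2
  rw [← Submodule.Quotient.mk_eq_zero, ← Submodule.mkQ_apply, map_sub, map_sub, map_sum, map_sum,
    sub_eq_zero, bc_smul, bc_genVec, map_smul] at h3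
  simp only [bc_smul, bc_genVec, map_smul] at h3
  rw [Finset.sum_apply]
  exact h3

end Cover

/-! ### Representability -/

section Representability

variable {R : Type u} [CommRing R] {L : Type u} [Ring L] [Algebra R L] {r : ℕ}
  (β : DualFamily R L r) {I E : Type u} {D : ℕ}

/-- The universal algebra of a chart. -/
abbrev chartAlg (E : Type u) (J : Fin D → I × Fin r) : CommAlgCat.{u} R :=
  quotRing (chartRel (E := E) β J)

/-- The universal matrix of a chart. -/
abbrev univMat (E : Type u) (J : Fin D → I × Fin r) :
    Matrix (Fin D) (I × Fin r) (chartAlg β E J) :=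
  varMat (quotVar (chartRel (E := E) β J))

/-- The universal vectors of a chart. -/
abbrev univVec (E : Type u) (J : Fin D → I × Fin r) : E → Fin r → chartAlg β E J :=
  varVec (quotVar (chartRel (E := E) β J))

lemma isChart_hom {A : CommAlgCat.{u} R} (J : Fin D → I × Fin r) (φ : chartAlg β E J ⟶ A) :
    IsChart β J ((univMat β E J).map φ.hom) (fun e j => φ.hom (univVec β E J e j)) :=
  (isChart_iff J fun x => φ.hom (quotVar _ x)).1 fun _ hs => aeval_quotVar_eq_zero φ hs

lemma isChart_univ (J : Fin D → I × Fin r) : IsChart β J (univMat β E J) (univVec β E J) :=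
  isChart_hom β J (𝟙 _)

lemma exists_chartAlg_hom {A : CommAlgCat.{u} R} {J : Fin D → I × Fin r}
    {q : Matrix (Fin D) (I × Fin r) A} {w : E → Fin r → A} (h : IsChart β J q w) :
    ∃ φ : chartAlg β E J ⟶ A,
      (univMat β E J).map φ.hom = q ∧ (fun e j => φ.hom (univVec β E J e j)) = w := by
  let a : ChartVar r I E D → A := Sum.elim (fun x => q x.1 x.2) (fun x => w x.1 x.2)
  obtain ⟨φ, hφ⟩ := exists_quotRing_hom (S := chartRel β J) a ((isChart_iff J a).2 h)
  exact ⟨φ, by ext d x; exact hφ _, by ext e j; exact hφ _⟩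

lemma plucker_hom {A : CommAlgCat.{u} R} (J : Fin D → I × Fin r) (φ : chartAlg β E J ⟶ A)
    (x : CoordIndex r I E D) :
    plucker ((univMat β E J).map φ.hom) (fun e j => φ.hom (univVec β E J e j)) x =
      φ.hom (plucker (univMat β E J) (univVec β E J) x) :=
  plucker_map φ.hom.toRingHom _ _ x

/-- On its own chart the minor at `J` is `1`, so every matrix entry is a minor with one column
exchanged, and every vector coordinate is itself one of the homogeneous coordinates. -/
lemma adjoin_range_plucker (J : Fin D → I × Fin r) :
    Algebra.adjoin R (Set.range (plucker (univMat β E J) (univVec β E J))) = ⊤ := by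
  classical
  have h := isChart_univ β (E := E) J
  rw [← top_le_iff, ← adjoin_range_quotVar, Algebra.adjoin_le_iff]
  rintro _ ⟨x | x, rfl⟩
  · refine Algebra.subset_adjoin ⟨some (Function.update J x.1 x.2, none), ?_⟩
    exact det_submatrix_update h.one x.1 x.2
  · refine Algebra.subset_adjoin ⟨some (J, some x), ?_⟩
    change (Matrix.submatrix _ id J).det * _ = _
    rw [h.one, Matrix.det_one, one_mul]
    rfl

/-- Families of local direct summands and vectors are parametrized by a quasiprojective scheme. -/
theorem exists_represents_subVecFunctor [Module.Finite R L] [Module.Projective R L]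
    (I E : Type u) [Fintype I] [Finite E] (D : ℕ) :
    ∃ Z : Over (Spec (.of R)),
      Nonempty (points Z ≅ subVecFunctor R L I E D) ∧ IsQuasiProjective Z := by
  obtain ⟨r, ⟨β⟩⟩ := exists_dualFamily (R := R) (L := L)
  obtain ⟨N, ⟨e⟩⟩ : ∃ N, Nonempty (CoordIndex r I E D ≃ Fin (N + 1)) := by
    -- The superfluous coordinate `none`, which is always zero, keeps the index set nonempty even if
    -- there are no minors.
    have h : 0 < Nat.card (CoordIndex r I E D) := Nat.card_pos
    exact ⟨_, ⟨(Finite.equivFin _).trans (finCongr (Nat.succ_pred_eq_of_pos h).symm)⟩⟩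
  have hcomp {A : CommAlgCat.{u} R} (J K : Fin D → I × Fin r) (φ : chartAlg β E J ⟶ A)
      (ψ : chartAlg β E K ⟶ A) :
      (∃ a : Aˣ, plucker ((univMat β E K).map ψ.hom) (fun e j => ψ.hom (univVec β E K e j)) =
        a.1 • plucker ((univMat β E J).map φ.hom) (fun e j => φ.hom (univVec β E J e j))) ↔
      ∃ a : Aˣ, ψ.hom ∘ plucker (univMat β E K) (univVec β E K) ∘ e.symm =
        a.1 • (φ.hom ∘ plucker (univMat β E J) (univVec β E J) ∘ e.symm) := by
    refine exists_congr fun a => ?_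
    rw [funext (plucker_hom β J φ), funext (plucker_hom β K ψ)]
    constructor
    · intro h
      ext x
      exact congrFun h (e.symm x)
    · intro h
      ext x
      simpa using congrFun h (e x)
  have hk (J : Fin D → I × Fin r) {A : CommAlgCat.{u} R} (K : Fin D → I × Fin r)
      (ψ : chartAlg β E K ⟶ A) :
      ψ.hom ((plucker (univMat β E K) (univVec β E K) ∘ e.symm) (e (some (J, none)))) =
        (((univMat β E K).map ψ.hom).submatrix id J).det := by
    rw [Function.comp_apply, e.symm_apply_apply, ← plucker_hom]
    rfl
  refine exists_isQuasiProjective isZariskiSeparated_subVecFunctor isZariskiGluing_subVecFunctor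
    (𝒥 := Fin D → I × Fin r) (fun J => chartAlg β E J)
    (fun J => chartPoint (isChart_univ β J))
    (fun J => plucker (univMat β E J) (univVec β E J) ∘ e.symm)
    (fun J => e (some (J, none))) (fun J => ?_) (fun J => ?_) (fun A x p => ?_)
    (fun A J K φ ψ => ?_) (fun A J K ψ hu => ?_)
  · have := hk J J (𝟙 (chartAlg β E J))
    refine this.trans ?_
    have h1 := (isChart_hom β (E := E) J (𝟙 _)).one
    rw [h1, Matrix.det_one]
  · rw [e.symm.surjective.range_comp]
    exact adjoin_range_plucker β J
  · obtain ⟨f, hf, J, q, w, h, hq⟩ := exists_chartPoint_eq_map β x p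
    obtain ⟨φ, rfl, rfl⟩ := exists_chartAlg_hom β h
    exact ⟨f, hf, J, φ, (map_chartPoint (isChart_univ β J) φ.hom).trans hq⟩
  · rw [← hcomp J K φ ψ, ← chartEquiv_iff (isChart_hom β J φ).one (isChart_hom β K ψ).one,
      ← chartPoint_eq_iff (isChart_hom β J φ) (isChart_hom β K ψ)]
    have h1 := map_chartPoint (isChart_univ β J (E := E)) φ.hom
    have h2 := map_chartPoint (isChart_univ β K (E := E)) ψ.hom
    change SubVec.map φ.hom _ = SubVec.map ψ.hom _ ↔ _
    rw [h1, h2]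
  · rw [hk J K ψ] at hu
    -- If the minor at `J` is invertible, normalizing the matrix at `J` gives a point of the chart
    -- of `J`.
    obtain ⟨φ, hq, hw⟩ := exists_chartAlg_hom β ((isChart_hom β K ψ).change hu)
    refine ⟨φ, (hcomp J K φ ψ).1 ?_⟩
    rw [← chartEquiv_iff (isChart_hom β J φ).one (isChart_hom β K ψ).one, hq, hw]
    refine ⟨rfl, _, hu, ?_⟩
    rw [← Matrix.mul_assoc, Matrix.mul_nonsing_inv _ hu, Matrix.one_mul]

end Representability

/-! ### Grassmannians and the target functor -/

section Target

variable {R : Type u} [CommRing R] {L : Type u} [Ring L] [Algebra R L]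

variable (R L) in
/-- The Grassmannian functor as a functor of single local direct summands. -/
def grassmannianIso (d : ℕ) : subVecFunctor R L PUnit.{u + 1} PEmpty.{u + 1} d ≅
    Module.Grassmannian.functor.{u, u, u} (R := R) (M := L) d :=
  NatIso.ofComponents (fun A => Equiv.toIso
    { toFun := fun t : SubVec R L PUnit.{u + 1} PEmpty.{u + 1} d A =>
        ({ toSubmodule := t.sub PUnit.unit
           finite_quotient := t.finite_quotient _
           projective_quotient := t.projective_quotient _
           rankAtStalk_eq := fun p => by simpa using t.rank_eq p } :
          Module.Grassmannian A (A ⊗[R] L) d)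
      invFun := fun N : Module.Grassmannian A (A ⊗[R] L) d =>
        ({ sub := fun _ => N.toSubmodule
           vec := PEmpty.elim
           finite_quotient := fun _ => N.finite_quotient
           projective_quotient := fun _ => N.projective_quotient
           rank_eq := fun p => by simpa using N.rankAtStalk_eq p } :
          SubVec R L PUnit.{u + 1} PEmpty.{u + 1} d A)
      left_inv := fun t => SubVec.ext (funext fun _ => rfl) (funext fun e => e.elim)
      right_inv := fun N => rfl })
    fun φ => by
      refine ConcreteCategory.hom_ext _ _ fun t => ?_
      refine Module.Grassmannian.ext ?_
      exact subMap_eq_ker _ _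

/-! ### Splitting of local direct summands and additivity of ranks -/

section Summand

variable {A M : Type*} [CommRing A] [AddCommGroup M] [Module A M] (N : Submodule A M)
  [Module.Projective A (M ⧸ N)]

lemma exists_equiv_quotient_prod : Nonempty (M ≃ₗ[A] (M ⧸ N) × N) := by
  obtain ⟨s, hs⟩ := Module.projective_lifting_property N.mkQ LinearMap.id N.mkQ_surjective
  have hs' (x) : N.mkQ (s x) = x := LinearMap.congr_fun hs x
  refine ⟨LinearEquiv.ofBijective (N.mkQ.prod
      ((LinearMap.id - s ∘ₗ N.mkQ).codRestrict N fun x => ?_)) ⟨?_, ?_⟩⟩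
  · rw [← LinearMap.ker_eq_bot, LinearMap.ker_eq_bot']
    intro z hz
    obtain ⟨h1, h2⟩ := Prod.ext_iff.1 hz
    have h3 : z - s (N.mkQ z) = 0 := congrArg Subtype.val h2
    have h1' : N.mkQ z = 0 := h1
    rwa [h1', map_zero, sub_zero] at h3
  · rintro ⟨a, b, hb⟩
    have hb' : N.mkQ b = 0 := (Submodule.Quotient.mk_eq_zero N).2 hb
    have h : N.mkQ (s a + b) = a := by rw [map_add, hs', hb', add_zero]
    refine ⟨s a + b, Prod.ext h (Subtype.ext ?_)⟩
    change s a + b - s (N.mkQ (s a + b)) = b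
    rw [h, add_sub_cancel_left]
  · rw [← (Submodule.Quotient.mk_eq_zero N)]
    change N.mkQ (x - s (N.mkQ x)) = 0
    rw [map_sub, hs', sub_self]

lemma finite_of_projective_quotient [Module.Finite A M] : Module.Finite A N := by
  obtain ⟨e⟩ := exists_equiv_quotient_prod N
  exact Module.Finite.of_surjective (LinearMap.snd A _ _ ∘ₗ e.toLinearMap)
    (Prod.snd_surjective.comp e.surjective)

lemma projective_of_projective_quotient [Module.Projective A M] : Module.Projective A N := by
  obtain ⟨e⟩ := exists_equiv_quotient_prod N
  exact Module.Projective.of_split (e.symm.toLinearMap ∘ₗ LinearMap.inr A (M ⧸ N) _)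
    (LinearMap.snd A _ _ ∘ₗ e.toLinearMap) (by ext x; simp)

lemma rankAtStalk_quotient_add [Module.Finite A M] [Module.Projective A M] (p : PrimeSpectrum A) :
    Module.rankAtStalk (R := A) (M ⧸ N) p + Module.rankAtStalk (R := A) N p =
      Module.rankAtStalk (R := A) M p := by
  obtain ⟨e⟩ := exists_equiv_quotient_prod N
  have := finite_of_projective_quotient N
  have := projective_of_projective_quotient N
  rw [Module.rankAtStalk_eq_of_equiv e, Module.rankAtStalk_prod]
  rfl

end Summand

/-- With `m i = n ^ 2 - r i`, the condition on `m` becomes that the `r i` have sum `(card I - 1) * n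
^ 2`. -/
lemma exists_sum_eq_iff (I : Type*) [Fintype I] {n : ℕ} (hn : 1 ≤ n) : ∃ D : ℕ,
    ∀ r : I → ℕ, (∀ i, r i ≤ n ^ 2) →
      ((∃ m : I → ℕ, ∑ i, m i = n ^ 2 ∧ ∀ i, r i = n ^ 2 - m i) ↔ ∑ i, r i = D) := by
  have hn' : 1 ≤ n ^ 2 := Nat.one_le_pow _ _ hn
  rcases isEmpty_or_nonempty I with hI | hI
  · refine ⟨1, fun r _ => ?_⟩
    simp only [Finset.univ_eq_empty, Finset.sum_empty]
    constructor
    · rintro ⟨m, h, -⟩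
      omega
    · intro h
      omega
  have hsum (r m : I → ℕ) (h : ∀ i, r i + m i = n ^ 2) :
      ∑ i, r i + ∑ i, m i = Fintype.card I * n ^ 2 := by
    rw [← Finset.sum_add_distrib, Finset.sum_congr rfl fun i _ => h i]
    simp
  have hc : n ^ 2 ≤ Fintype.card I * n ^ 2 := Nat.le_mul_of_pos_left _ Fintype.card_pos
  refine ⟨Fintype.card I * n ^ 2 - n ^ 2, fun r hr => ⟨?_, fun h => ?_⟩⟩
  · rintro ⟨m, hm, h⟩
    have := hsum r m fun i => by
      -- No entry exceeds the total, so the subtraction `n ^ 2 - m i` is not truncated.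
      have h1 : m i ≤ n ^ 2 := hm ▸ Finset.single_le_sum (fun _ _ => Nat.zero_le _) (Finset.mem_univ i)
      have h2 := h i
      omega
    omega
  · have := hsum r (fun i => n ^ 2 - r i) fun i => by
      have := hr i
      omega
    refine ⟨fun i => n ^ 2 - r i, by dsimp only; omega, fun i => ?_⟩
    have := hr i
    dsimp only
    omega

/-- The points of the target are the families of local direct summands of a given total rank,
together with families of vectors. -/
lemma exists_targetFunctor_iso (n : ℕ) [IsAzumayaOfDegree R L n] (Δ : Type u) [Quiver.{u} Δ]
    [Fintype Δ] : ∃ D : ℕ, Nonempty (targetFunctor R L n Δ ≅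
      subVecFunctor R L Δ (Quiver.Total Δ) D) := by
  have : IsAzumaya R L := IsAzumayaOfDegree.toIsAzumaya n
  obtain ⟨D, hD⟩ := exists_sum_eq_iff Δ (IsAzumayaOfDegree.one_le R L (n := n))
  have hle (A : CommAlgCat.{u} R) (N : Submodule A (A ⊗[R] L))
      [Module.Projective A ((A ⊗[R] L) ⧸ N)] (p : PrimeSpectrum A) :
      Module.rankAtStalk (R := A) ((A ⊗[R] L) ⧸ N) p ≤ n ^ 2 := by
    have h := rankAtStalk_quotient_add N p
    rw [Module.rankAtStalk_baseChange, IsAzumayaOfDegree.rank_eq (n := n)] at h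
    omega
  refine ⟨D, ⟨NatIso.ofComponents (fun A => Equiv.toIso
    { toFun := fun t : TargetPoint R L n Δ A =>
        ({ sub := t.sub
           vec := t.vec
           finite_quotient := t.finite_quotient
           projective_quotient := t.projective_quotient
           rank_eq := fun p => (hD _ fun i =>
            have := t.projective_quotient
            hle A _ p).1 (t.rank_eq p) } : SubVec R L Δ (Quiver.Total Δ) D A)
      invFun := fun t : SubVec R L Δ (Quiver.Total Δ) D A =>
        ({ sub := t.sub
           vec := t.vec
           finite_quotient := t.finite_quotient
           projective_quotient := t.projective_quotient
           rank_eq := fun p => (hD _ fun i =>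
            have := t.projective_quotient
            hle A _ p).2 (t.rank_eq p) } : TargetPoint R L n Δ A)
      left_inv := fun t => rfl
      right_inv := fun t => rfl }) fun φ => ?_⟩⟩
  refine ConcreteCategory.hom_ext _ _ fun t => ?_
  rfl

/-- The target is parametrized by a quasiprojective scheme. -/
lemma exists_represents_targetFunctor (n : ℕ) [IsAzumayaOfDegree R L n] (Δ : Type u)
    [Quiver.{u} Δ] [Fintype Δ] [Finite (Quiver.Total Δ)] :
    ∃ Y : Over (Spec (.of R)), Nonempty (points Y ≅ targetFunctor R L n Δ) ∧
      IsQuasiProjective Y := by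
  have : IsAzumaya R L := IsAzumayaOfDegree.toIsAzumaya n
  obtain ⟨D, ⟨e⟩⟩ := exists_targetFunctor_iso (R := R) (L := L) n Δ
  obtain ⟨Y, ⟨h⟩, hY⟩ := exists_represents_subVecFunctor (R := R) (L := L) Δ (Quiver.Total Δ) D
  exact ⟨Y, ⟨h ≪≫ e.symm⟩, hY⟩

/-- The Grassmannian functors are parametrized by schemes. -/
lemma exists_represents_grassmannian [Module.Finite R L] [Module.Projective R L] (d : ℕ) :
    ∃ Z : Over (Spec (.of R)),
      Nonempty (points Z ≅ Module.Grassmannian.functor.{u, u, u} (R := R) (M := L) d) := by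
  obtain ⟨Z, ⟨h⟩, -⟩ := exists_represents_subVecFunctor (R := R) (L := L)
    PUnit.{u + 1} PEmpty.{u + 1} d
  exact ⟨Z, ⟨h ≪≫ grassmannianIso R L d⟩⟩

end Target

/-! ### Points of vector bundles and open subfunctors -/

section Bundle

variable {R : Type u} [CommRing R] {E : Type u} [AddCommGroup E] [Module R E]

lemma bundlePoint_eq (A : CommAlgCat.{u} R) (a : A ⊗[R] E) :
    bundlePoint A a = specOverMap (CommAlgCat.ofHom (SymmetricAlgebra.lift
      ((TensorProduct.rid R A).toLinearMap ∘ₗ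
        LinearMap.applyₗ a ∘ₗ LinearMap.lTensorHom A))) := rfl

end Bundle

section Bundle

variable {R : Type u} [CommRing R] {L : Type u} [Ring L] [Algebra R L]

lemma rid_lTensor_apply {A : Type u} [CommRing A] [Algebra R A] (a : A ⊗[R] L)
    (l : Module.Dual R L) :
    ((TensorProduct.rid R A).toLinearMap ∘ₗ
        LinearMap.applyₗ a ∘ₗ LinearMap.lTensorHom A) l = coord A l a := rfl

lemma bundlePoint_bc {A B : CommAlgCat.{u} R} (φ : A ⟶ B) (a : A ⊗[R] L) :
    bundlePoint B (bc L φ.hom a) = specOverMap φ ≫ bundlePoint A a := by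
  refine Eq.trans (congrArg specOverMap (CommAlgCat.hom_ext ?_)) (specOverMap_comp
    (CommAlgCat.ofHom (SymmetricAlgebra.lift ((TensorProduct.rid R A).toLinearMap ∘ₗ
      LinearMap.applyₗ a ∘ₗ LinearMap.lTensorHom A))) φ)
  refine SymmetricAlgebra.algHom_ext (LinearMap.ext fun l => ?_)
  refine (SymmetricAlgebra.lift_ι_apply _ _).trans ?_
  refine Eq.trans ?_ (congrArg φ.hom (SymmetricAlgebra.lift_ι_apply _ l).symm)
  rw [rid_lTensor_apply, rid_lTensor_apply, coord_bc]

/-- A point is a linear map from the dual of `L` to `A`. By the dual family it is determined by its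
values on the finitely many forms `β.form j`, which are the coordinates of the sought element. -/
lemma bundlePoint_bijective [Module.Finite R L] [Module.Projective R L] (A : CommAlgCat.{u} R) :
    Function.Bijective (bundlePoint A : A ⊗[R] L → (points (vectorBundle R L)).obj A) := by
  obtain ⟨r, ⟨β⟩⟩ := exists_dualFamily (R := R) (L := L)
  constructor
  · intro a b h
    rw [bundlePoint_eq, bundlePoint_eq] at h
    have h1 := SymmetricAlgebra.lift.injective
      (congrArg CommAlgCat.Hom.hom (specOverMap_injective h))
    exact β.ext fun j => LinearMap.congr_fun h1 (β.form j)
  · intro x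
    obtain ⟨φ, hφ⟩ := exists_specOverMap (show specOver A ⟶
      specOver (CommAlgCat.of R (SymmetricAlgebra R (Module.Dual R L))) from x)
    let g : Module.Dual R L → A := fun l => φ.hom (SymmetricAlgebra.ι R _ l)
    have hg (l : Module.Dual R L) : ∑ j, l (β.vec j) • g (β.form j) = g l := by
      have h : l = ∑ j, l (β.vec j) • β.form j := by
        ext x
        conv_lhs => rw [← β.sum_eq x]
        simp [mul_comm]
      conv_rhs => rw [h]
      simp [g]
    refine ⟨∑ j, g (β.form j) • β.elt A j, ?_⟩
    rw [bundlePoint_eq]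
    refine Eq.trans (congrArg specOverMap (CommAlgCat.hom_ext ?_)) hφ.symm
    refine SymmetricAlgebra.algHom_ext (LinearMap.ext fun l => ?_)
    refine (SymmetricAlgebra.lift_ι_apply _ _).trans ?_
    rw [rid_lTensor_apply, map_sum]
    refine Eq.trans (Finset.sum_congr rfl fun j _ => ?_) (hg l)
    rw [map_smul, DualFamily.elt, coord_tmul, smul_eq_mul, mul_smul_comm, mul_one]

end Bundle

section OpenSubfunctor

variable {R : Type u} [CommRing R]

/-- A morphism that on points is the inclusion of an open subfunctor is an open immersion. -/
lemma IsOpenCondition.isOpenImmersion {C T : Over (Spec (.of R))}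
    {P : ∀ A : CommAlgCat.{u} R, (specOver A ⟶ T) → Prop} (hP : IsOpenCondition P) (c : C ⟶ T)
    (hc : ∀ A (y y' : specOver A ⟶ C), y ≫ c = y' ≫ c → y = y')
    (hcP : ∀ A (x : specOver A ⟶ T), P A x ↔ ∃ y, y ≫ c = x) :
    IsOpenImmersion c.left ∧
      ∀ A (x : specOver A ⟶ T), P A x ↔ Set.range x.left ⊆ Set.range c.left := by
  obtain ⟨V, hV⟩ := hP.exists_opens
  let U : Over (Spec (.of R)) := Over.mk (V.ι ≫ T.hom)
  let u : U ⟶ T := Over.homMk V.ι rfl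
  have hu : IsOpenImmersion u.left := inferInstanceAs (IsOpenImmersion V.ι)
  have hur : Set.range u.left = V := V.range_ι
  have huinj (A : CommAlgCat.{u} R) (y y' : specOver A ⟶ U) (h : y ≫ u = y' ≫ u) : y = y' :=
    Over.OverMorphism.ext ((cancel_mono u.left).1 (congrArg CommaMorphism.left h))
  have hPu (A : CommAlgCat.{u} R) (x : specOver A ⟶ T) : P A x ↔ ∃ y, y ≫ u = x := by
    rw [hV, ← hur]
    constructor
    · exact exists_lift_of_range_subset u x
    · rintro ⟨y, rfl⟩ _ ⟨p, rfl⟩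
      exact ⟨y.left p, rfl⟩
  -- A morphism to `T` factors through one that is injective on points as soon as each of its points
  -- does. Applied in both directions it identifies `C` with the open subscheme of the condition.
  have key {S S' : Over (Spec (.of R))} (s : S ⟶ T) (s' : S' ⟶ T)
      (hs' : ∀ A (y y' : specOver A ⟶ S'), y ≫ s' = y' ≫ s' → y = y')
      (hs : ∀ A (y : specOver A ⟶ S), ∃ y' : specOver A ⟶ S', y' ≫ s' = y ≫ s) :
      ∃ g : S ⟶ S', g ≫ s' = s := by
    choose θ hθ using hs
    obtain ⟨g, hg⟩ := exists_hom_of_natural θ fun A B φ y => hs' _ _ _ (by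
      rw [hθ, Category.assoc, Category.assoc, hθ])
    exact ⟨g, hom_ext_of_points fun A y => by rw [← Category.assoc, hg, hθ]⟩
  obtain ⟨g, hg⟩ := key c u huinj fun A y => (hPu A _).1 ((hcP A _).2 ⟨y, rfl⟩)
  obtain ⟨g', hg'⟩ := key u c hc fun A y => (hcP A _).1 ((hPu A _).2 ⟨y, rfl⟩)
  let e : C ≅ U :=
    { hom := g
      inv := g'
      hom_inv_id := hom_ext_of_points fun A y => hc _ _ _ (by simp [hg, hg'])
      inv_hom_id := hom_ext_of_points fun A y => huinj _ _ _ (by simp [hg, hg']) }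
  let k : C.left ≅ U.left := (Over.forget _).mapIso e
  have hk : IsOpenImmersion (k.hom ≫ u.left) := inferInstance
  have hce : k.hom ≫ u.left = c.left := congrArg CommaMorphism.left hg
  refine ⟨hce ▸ hk, fun A x => ?_⟩
  rw [hV, ← hur]
  have hr : Set.range u.left = Set.range c.left := by
    apply subset_antisymm
    · rintro _ ⟨p, rfl⟩
      exact ⟨g'.left p, congrArg (fun k : U ⟶ T => k.left p) hg'⟩
    · rintro _ ⟨p, rfl⟩
      exact ⟨g.left p, congrArg (fun k : C ⟶ T => k.left p) hg⟩
  rw [hr]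

/-- Each point of an `R`-scheme is the image of the spectrum of a local algebra with a single
prime ideal. -/
lemma exists_point_range_eq (T : Over (Spec (.of R))) (s : T.left) :
    ∃ (K : CommAlgCat.{u} R) (x : specOver K ⟶ T), Nonempty (PrimeSpectrum K) ∧
      Subsingleton (PrimeSpectrum K) ∧ Set.range x.left = {s} :=
  ⟨_, pointOfHom T (T.left.fromSpecResidueField s),
    inferInstanceAs (Nonempty (PrimeSpectrum (T.left.residueField s))),
    inferInstanceAs (Subsingleton (PrimeSpectrum (T.left.residueField s))),
    T.left.range_fromSpecResidueField s⟩

end OpenSubfunctor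

/-! ### The disjoint union of the components -/

section TargetScheme

variable {R : Type u} [CommRing R] {L : Type u} [Ring L] [Algebra R L] {n : ℕ}
  {Δ : Type u} [Quiver.{u} Δ] [Fintype Δ]

/-- The quotients by the local direct summands have the ranks prescribed by a tuple. -/
def TargetPoint.HasRanks {A : Type u} [CommRing A] [Algebra R A] (t : TargetPoint R L n Δ A)
    (m : RankVector n Δ) : Prop :=
  ∀ (p : PrimeSpectrum A) (i : Δ),
    Module.rankAtStalk (R := A) ((A ⊗[R] L) ⧸ t.sub i) p = n ^ 2 - m.1 i

/-- The entries of a rank vector are at most `n ^ 2`, so they can be recovered from the coranks at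
any prime. -/
lemma TargetPoint.HasRanks.eq {A : Type u} [CommRing A] [Algebra R A] [Nonempty (PrimeSpectrum A)]
    {t : TargetPoint R L n Δ A} {m m' : RankVector n Δ} (h : t.HasRanks m) (h' : t.HasRanks m') :
    m = m' := by
  obtain ⟨p⟩ : Nonempty (PrimeSpectrum A) := inferInstance
  refine Subtype.ext (funext fun i => ?_)
  have hle (m : RankVector n Δ) : m.1 i ≤ n ^ 2 :=
    (Finset.single_le_sum (fun _ _ => Nat.zero_le _) (Finset.mem_univ i)).trans_eq m.2
  have h1 := h p i
  have h2 := h' p i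
  have h3 := hle m
  have h4 := hle m'
  omega

lemma TargetPoint.isOpen_setOf_rankAtStalk {A : Type u} [CommRing A] [Algebra R A]
    (t : TargetPoint R L n Δ A) (m : RankVector n Δ) :
    IsOpen {p : PrimeSpectrum A | ∀ i, Module.rankAtStalk (R := A) ((A ⊗[R] L) ⧸ t.sub i) p =
      n ^ 2 - m.1 i} := by
  rw [Set.ofPred_forall]
  refine isOpen_iInter_of_finite fun i => ?_
  have := t.finite_quotient i
  have := t.projective_quotient i
  have := Module.finitePresentation_of_projective A ((A ⊗[R] L) ⧸ t.sub i)
  exact Module.isLocallyConstant_rankAtStalk.isOpen_fiber _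

lemma TargetPoint.hasRanks_map_iff {A B : Type u} [CommRing A] [Algebra R A] [CommRing B]
    [Algebra R B] (φ : A →ₐ[R] B) (t : TargetPoint R L n Δ A) (m : RankVector n Δ) :
    (t.map φ).HasRanks m ↔ ∀ q : PrimeSpectrum B, ∀ i,
      Module.rankAtStalk (R := A) ((A ⊗[R] L) ⧸ t.sub i) (q.comap φ.toRingHom) =
        n ^ 2 - m.1 i := by
  refine forall_congr' fun q => forall_congr' fun i => ?_
  have := t.finite_quotient i
  have := t.projective_quotient i
  exact iff_of_eq (congrArg (· = _) (rankAtStalk_quotient_subMap φ (t.sub i) q))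

/-! ### Points of a Grassmannian scheme as submodules -/

section Grassmannian

variable {d : ℕ} {G : Over (Spec (.of R))}
  (g : points G ≅ Module.Grassmannian.functor.{u, u, u} (R := R) (M := L) d)

/-- The local direct summand that corresponds to a point of a Grassmannian. -/
def grassPoint {A : CommAlgCat.{u} R} (z : specOver A ⟶ G) :
    Module.Grassmannian A (A ⊗[R] L) d :=
  g.hom.app A z

lemma grassPoint_map {A B : CommAlgCat.{u} R} (φ : A ⟶ B) (z : specOver A ⟶ G) :
    (grassPoint g (specOverMap φ ≫ z)).toSubmodule = subMap φ.hom (grassPoint g z).toSubmodule := by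
  have h : grassPoint g (specOverMap φ ≫ z) = Module.Grassmannian.map φ.hom (grassPoint g z) :=
    NatTrans.naturality_apply g.hom φ z
  rw [h]
  exact (subMap_eq_ker _ _).symm

lemma grassPoint_injective (A : CommAlgCat.{u} R) :
    Function.Injective (grassPoint g : (specOver A ⟶ G) → _) :=
  (g.app A).toEquiv.injective

lemma grassPoint_surjective (A : CommAlgCat.{u} R) :
    Function.Surjective (grassPoint g : (specOver A ⟶ G) → _) :=
  (g.app A).toEquiv.surjective

end Grassmannian

variable [Finite (Quiver.Total Δ)] {𝒢 : ℕ → Over (Spec (.of R))}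
  (γ : ∀ d, points (𝒢 d) ≅ Module.Grassmannian.functor.{u, u, u} (R := R) (M := L) d)

variable {m : RankVector n Δ}

/-- The Grassmannian component of a point of a product. -/
def componentGrass {A : CommAlgCat.{u} R} (y : specOver A ⟶ targetComponent L 𝒢 m) (i : Δ) :
    Module.Grassmannian A (A ⊗[R] L) (n ^ 2 - m.1 i) :=
  grassPoint (γ (n ^ 2 - m.1 i)) (y ≫ prod.fst ≫ Pi.π (fun i : Δ => 𝒢 (n ^ 2 - m.1 i)) i)

lemma componentGrass_map {A B : CommAlgCat.{u} R} (φ : A ⟶ B)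
    (y : specOver A ⟶ targetComponent L 𝒢 m) (i : Δ) :
    (componentGrass γ (specOverMap φ ≫ y) i).toSubmodule =
      subMap φ.hom (componentGrass γ y i).toSubmodule := by
  rw [componentGrass, Category.assoc]
  exact grassPoint_map _ φ _

variable [Module.Finite R L] [Module.Projective R L]

/-- The vector components of a point of a product. -/
def componentVec {A : CommAlgCat.{u} R} (y : specOver A ⟶ targetComponent L 𝒢 m)
    (α : Quiver.Total Δ) : A ⊗[R] L :=
  (Equiv.ofBijective _ (bundlePoint_bijective A)).symm
    (y ≫ prod.snd ≫ Pi.π (fun _ : Quiver.Total Δ => vectorBundle R L) α)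

lemma bundlePoint_componentVec {A : CommAlgCat.{u} R} (y : specOver A ⟶ targetComponent L 𝒢 m)
    (α : Quiver.Total Δ) : bundlePoint A (componentVec y α) =
      y ≫ prod.snd ≫ Pi.π (fun _ : Quiver.Total Δ => vectorBundle R L) α :=
  (Equiv.ofBijective _ (bundlePoint_bijective A)).apply_symm_apply _

lemma componentVec_map {A B : CommAlgCat.{u} R} (φ : A ⟶ B)
    (y : specOver A ⟶ targetComponent L 𝒢 m) (α : Quiver.Total Δ) :
    componentVec (specOverMap φ ≫ y) α = bc L φ.hom (componentVec y α) := by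
  refine (bundlePoint_bijective B).injective ?_
  refine (bundlePoint_componentVec _ α).trans (Eq.trans ?_ (bundlePoint_bc φ _).symm)
  refine (Category.assoc _ _ _).trans ?_
  exact congrArg (specOverMap φ ≫ ·) (bundlePoint_componentVec y α).symm

/-- The point of the disjoint union given by a point of a summand. -/
def componentPoint {A : CommAlgCat.{u} R} (y : specOver A ⟶ targetComponent L 𝒢 m) :
    TargetPoint R L n Δ A where
  sub i := (componentGrass γ y i).toSubmodule
  vec := componentVec y
  finite_quotient i := (componentGrass γ y i).finite_quotient
  projective_quotient i := (componentGrass γ y i).projective_quotient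
  rank_eq p := ⟨m.1, m.2, fun i => (componentGrass γ y i).rankAtStalk_eq p⟩

lemma hasRanks_componentPoint {A : CommAlgCat.{u} R}
    (y : specOver A ⟶ targetComponent L 𝒢 m) : (componentPoint γ y).HasRanks m :=
  fun p i => (componentGrass γ y i).rankAtStalk_eq p

lemma componentPoint_map {A B : CommAlgCat.{u} R} (φ : A ⟶ B)
    (y : specOver A ⟶ targetComponent L 𝒢 m) :
    componentPoint γ (specOverMap φ ≫ y) = (componentPoint γ y).map φ.hom :=
  TargetPoint.ext (funext (componentGrass_map γ φ y)) (funext (componentVec_map φ y))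

lemma componentPoint_injective {A : CommAlgCat.{u} R}
    {y y' : specOver A ⟶ targetComponent L 𝒢 m} (h : componentPoint γ y = componentPoint γ y') :
    y = y' := by
  have h1 (i : Δ) : componentGrass γ y i = componentGrass γ y' i :=
    Module.Grassmannian.ext (congrFun (congrArg TargetPoint.sub h) i)
  have h2 (α : Quiver.Total Δ) : componentVec y α = componentVec y' α :=
    congrFun (congrArg TargetPoint.vec h) α
  refine prod.hom_ext (Pi.hom_ext _ _ fun i => ?_) (Pi.hom_ext _ _ fun α => ?_)
  · refine (Category.assoc _ _ _).trans (Eq.trans ?_ (Category.assoc _ _ _).symm)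
    exact grassPoint_injective _ A (h1 i)
  · refine (Category.assoc _ _ _).trans (Eq.trans ?_ (Category.assoc _ _ _).symm)
    exact (bundlePoint_componentVec y α).symm.trans
      ((congrArg (bundlePoint A) (h2 α)).trans (bundlePoint_componentVec y' α))

lemma exists_componentPoint_eq {A : CommAlgCat.{u} R} {t : TargetPoint R L n Δ A}
    (ht : t.HasRanks m) :
    ∃ y : specOver A ⟶ targetComponent L 𝒢 m, componentPoint γ y = t := by
  let N (i : Δ) : Module.Grassmannian A (A ⊗[R] L) (n ^ 2 - m.1 i) :=
    { toSubmodule := t.sub i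
      finite_quotient := t.finite_quotient i
      projective_quotient := t.projective_quotient i
      rankAtStalk_eq := fun p => ht p i }
  choose z hz using fun i => grassPoint_surjective (γ (n ^ 2 - m.1 i)) A (N i)
  let w (α : Quiver.Total Δ) : specOver A ⟶ vectorBundle R L := bundlePoint A (t.vec α)
  let y : specOver A ⟶ targetComponent L 𝒢 m := prod.lift (Pi.lift z) (Pi.lift w)
  have h1 (i : Δ) : y ≫ prod.fst ≫ Pi.π (fun i : Δ => 𝒢 (n ^ 2 - m.1 i)) i = z i :=
    (prod.lift_fst_assoc _ _ _).trans (Pi.lift_π _ _)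
  have h2 (α : Quiver.Total Δ) :
      y ≫ prod.snd ≫ Pi.π (fun _ : Quiver.Total Δ => vectorBundle R L) α = w α :=
    (prod.lift_snd_assoc _ _ _).trans (Pi.lift_π _ _)
  refine ⟨y, TargetPoint.ext (funext fun i => ?_) (funext fun α => ?_)⟩
  · refine congrArg Module.Grassmannian.toSubmodule (?_ : componentGrass γ y i = N i)
    rw [componentGrass, h1]
    exact hz i
  · exact (bundlePoint_bijective A).injective ((bundlePoint_componentVec y α).trans (h2 α))

/-- A scheme that represents the target functor is the disjoint union of the components. -/
lemma exists_targetScheme_iso (Y : Over (Spec (.of R))) (h : points Y ≅ targetFunctor R L n Δ) :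
    ∃ φ : targetScheme L n Δ 𝒢 ≅ Y, ∀ (A : CommAlgCat.{u} R) (m : RankVector n Δ)
      (y : specOver A ⟶ targetComponent L 𝒢 m),
      h.hom.app A (y ≫ Sigma.ι (targetComponent L 𝒢) m ≫ φ.hom) = componentPoint γ y := by
  let pt (A : CommAlgCat.{u} R) (x : specOver A ⟶ Y) : TargetPoint R L n Δ A := h.hom.app A x
  have hpt (A B : CommAlgCat.{u} R) (φ : A ⟶ B) (x : specOver A ⟶ Y) :
      pt B (specOverMap φ ≫ x) = (pt A x).map φ.hom := NatTrans.naturality_apply h.hom φ x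
  have hinj (A : CommAlgCat.{u} R) : Function.Injective (pt A) := (h.app A).toEquiv.injective
  have hsurj (A : CommAlgCat.{u} R) : Function.Surjective (pt A) := (h.app A).toEquiv.surjective
  choose inv hinv using hsurj
  have hc (m : RankVector n Δ) : ∃ c : targetComponent L 𝒢 m ⟶ Y,
      ∀ (A : CommAlgCat.{u} R) (y : specOver A ⟶ targetComponent L 𝒢 m),
        y ≫ c = inv A (componentPoint γ y) :=
    exists_hom_of_natural (fun A y => inv A (componentPoint γ y)) fun A B φ y => hinj B (by
      rw [hpt, hinv, hinv, componentPoint_map])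
  choose c hc using hc
  have hcpt (m : RankVector n Δ) (A : CommAlgCat.{u} R)
      (y : specOver A ⟶ targetComponent L 𝒢 m) : pt A (y ≫ c m) = componentPoint γ y := by
    rw [hc, hinv]
  have hP (m : RankVector n Δ) :
      IsOpenCondition fun (A : CommAlgCat.{u} R) (x : specOver A ⟶ Y) => (pt A x).HasRanks m := by
    intro A x
    refine ⟨_, (pt A x).isOpen_setOf_rankAtStalk m, fun B φ => ?_⟩
    exact (iff_of_eq (congrArg (fun t => TargetPoint.HasRanks t m) (hpt A B φ x))).trans
      (TargetPoint.hasRanks_map_iff φ.hom (pt A x) m)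
  -- On points, the component of `m` is the subfunctor where the quotients have the ranks prescribed
  -- by `m`. This subfunctor is open because ranks are locally constant.
  have hopen (m : RankVector n Δ) := (hP m).isOpenImmersion (c m)
    (fun A y y' e => componentPoint_injective γ (by rw [← hcpt, ← hcpt, e]))
    (fun A x => by
      constructor
      · intro hx
        obtain ⟨y, hy⟩ := exists_componentPoint_eq γ hx
        exact ⟨y, hinj A (by rw [hcpt, hy])⟩
      · rintro ⟨y, rfl⟩
        rw [hcpt]
        exact hasRanks_componentPoint γ y)
  have hopen' (m : RankVector n Δ) : IsOpenImmersion (c m).left := (hopen m).1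
  have hcov : ⨆ m, (c m).left.opensRange = ⊤ := by
    rw [eq_top_iff]
    intro s _
    -- At a single prime the existence of a tuple `m` in the definition of the target is the same as
    -- having ranks `m`.
    obtain ⟨K, x, ⟨p⟩, _, hx⟩ := exists_point_range_eq Y s
    obtain ⟨m, hm, hr⟩ := (pt K x).rank_eq p
    have h1 : (pt K x).HasRanks ⟨m, hm⟩ := fun q i => by
      rw [Subsingleton.elim q p]
      exact hr i
    have h2 := ((hopen ⟨m, hm⟩).2 K x).1 h1
    rw [hx, Set.singleton_subset_iff] at h2
    exact TopologicalSpace.Opens.mem_iSup.2 ⟨⟨m, hm⟩, h2⟩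
  have hdisj : Pairwise (Function.onFun Disjoint fun m => (c m).left.opensRange) := by
    intro m m' hne
    rw [Function.onFun, disjoint_iff, eq_bot_iff]
    rintro s ⟨h1, h2⟩
    obtain ⟨K, x, _, _, hx⟩ := exists_point_range_eq Y s
    refine hne (TargetPoint.HasRanks.eq (t := pt K x) (((hopen m).2 K x).2 ?_)
      (((hopen m').2 K x).2 ?_))
    · rw [hx, Set.singleton_subset_iff]
      exact h1
    · rw [hx, Set.singleton_subset_iff]
      exact h2
  obtain ⟨hcol⟩ := nonempty_isColimit_cofanMk_of (fun m => (c m).left) hcov hdisj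
  -- Disjoint open subschemes that cover form a coproduct of schemes, and this lifts to schemes over
  -- the base.
  have hcol' : IsColimit (Cofan.mk Y c) :=
    isColimitOfIsColimitCofanMkObj (Over.forget _) _ c hcol
  let φ : targetScheme L n Δ 𝒢 ≅ Y :=
    (coproductIsCoproduct (targetComponent L 𝒢)).coconePointUniqueUpToIso hcol'
  have hφ (m : RankVector n Δ) : Sigma.ι (targetComponent L 𝒢) m ≫ φ.hom = c m :=
    (coproductIsCoproduct (targetComponent L 𝒢)).comp_coconePointUniqueUpToIso_hom hcol' ⟨m⟩
  refine ⟨φ, fun A m y => ?_⟩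
  rw [hφ]
  exact hcpt m A y

end TargetScheme

/-! ### Transport along isomorphisms of schemes -/

section Isomorphism

variable {R : Type u} [CommRing R]

/-- The isomorphism of functors of points induced by an isomorphism of schemes. -/
def pointsIso {S T : Over (Spec (.of R))} (φ : S ≅ T) : points S ≅ points T :=
  Functor.isoWhiskerLeft (algSpec (.of R)).rightOp (yoneda.mapIso φ)

lemma IsQuasiProjective.of_iso {S T : Over (Spec (.of R))} (φ : S ≅ T)
    (h : IsQuasiProjective T) : IsQuasiProjective S := by
  obtain ⟨N, i, _, _⟩ := h
  let k : S.left ≅ T.left := (Over.forget _).mapIso φ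
  have h1 : IsImmersion (k.hom ≫ i.left) := inferInstance
  have h2 : QuasiCompact (k.hom ≫ i.left) := inferInstance
  exact ⟨N, φ.hom ≫ i, h1, h2⟩

end Isomorphism

/-! ### The universal representation -/

section UniversalRep

variable {R : Type u} [CommRing R] {L : Type u} [Ring L] [Algebra R L]
  {Δ : Type u} [Quiver.{u} Δ] [Fintype Δ]
variable {A B : Type u} [CommRing A] [Algebra R A] [CommRing B] [Algebra R B]

variable (R) in
/-- The generators of the path algebra. -/
def pathGen (g : Δ ⊕ Quiver.Total Δ) : PathAlgebra R Δ :=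
  RingQuot.mkAlgHom R (PathAlgebra.Rel R Δ) (FreeAlgebra.ι R g)

/-- The values of a representation on the generators of the path algebra. -/
def genValue (ρ : A ⊗[R] PathAlgebra R Δ →ₐ[A] A ⊗[R] L) (g : Δ ⊕ Quiver.Total Δ) : A ⊗[R] L :=
  ρ (1 ⊗ₜ pathGen R g)

lemma genValue_repMap (φ : A →ₐ[R] B) (ρ : A ⊗[R] PathAlgebra R Δ →ₐ[A] A ⊗[R] L)
    (g : Δ ⊕ Quiver.Total Δ) :
    genValue (repMap (PathAlgebra R Δ) L φ ρ) g = bc L φ (genValue ρ g) := by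
  rw [genValue, repMap_tmul, one_smul]
  rfl

lemma lift_genValue (ρ : A ⊗[R] PathAlgebra R Δ →ₐ[A] A ⊗[R] L)
    (a : FreeAlgebra R (Δ ⊕ Quiver.Total Δ)) :
    FreeAlgebra.lift R (genValue ρ) a = ρ (1 ⊗ₜ RingQuot.mkAlgHom R (PathAlgebra.Rel R Δ) a) := by
  have : FreeAlgebra.lift R (genValue ρ) = ((ρ.restrictScalars R).comp
      Algebra.TensorProduct.includeRight).comp (RingQuot.mkAlgHom R (PathAlgebra.Rel R Δ)) := by
    refine FreeAlgebra.hom_ext (funext fun g => ?_)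
    exact FreeAlgebra.lift_ι_apply _ _
  exact AlgHom.congr_fun this a

lemma rep_ext {ρ ρ' : A ⊗[R] PathAlgebra R Δ →ₐ[A] A ⊗[R] L}
    (h : ∀ g, genValue ρ g = genValue ρ' g) : ρ = ρ' := by
  refine Algebra.TensorProduct.ext (by ext) (AlgHom.ext fun x => ?_)
  obtain ⟨a, rfl⟩ := RingQuot.mkAlgHom_surjective R (PathAlgebra.Rel R Δ) x
  have h1 := lift_genValue ρ a
  rw [funext h, lift_genValue] at h1
  exact h1.symm

lemma lift_genValue_eq_of_rel (ρ : A ⊗[R] PathAlgebra R Δ →ₐ[A] A ⊗[R] L)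
    {a b : FreeAlgebra R (Δ ⊕ Quiver.Total Δ)} (h : PathAlgebra.Rel R Δ a b) :
    FreeAlgebra.lift R (genValue ρ) a = FreeAlgebra.lift R (genValue ρ) b := by
  rw [lift_genValue, lift_genValue, RingQuot.mkAlgHom_rel R h]

lemma exists_rep (v : Δ ⊕ Quiver.Total Δ → A ⊗[R] L) (hv : ∀ a b, PathAlgebra.Rel R Δ a b →
    FreeAlgebra.lift R v a = FreeAlgebra.lift R v b) :
    ∃ ρ : A ⊗[R] PathAlgebra R Δ →ₐ[A] A ⊗[R] L, genValue ρ = v := by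
  refine ⟨Algebra.TensorProduct.lift (Algebra.ofId A (A ⊗[R] L))
    (RingQuot.liftAlgHom R ⟨FreeAlgebra.lift R v, fun a b h => hv a b h⟩)
    (fun b x => by rw [Algebra.ofId_apply]; exact Algebra.commutes b _), funext fun g => ?_⟩
  rw [genValue, Algebra.TensorProduct.lift_tmul, map_one, one_mul, pathGen,
    RingQuot.liftAlgHom_mkAlgHom_apply, FreeAlgebra.lift_ι_apply]

lemma bc_lift (φ : A →ₐ[R] B) {Γ : Type*} (v : Γ → A ⊗[R] L) (a : FreeAlgebra R Γ) :
    bc L φ (FreeAlgebra.lift R v a) = FreeAlgebra.lift R (fun g => bc L φ (v g)) a := by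
  have : (bc L φ).comp (FreeAlgebra.lift R v) = FreeAlgebra.lift R (fun g => bc L φ (v g)) := by
    refine FreeAlgebra.hom_ext (funext fun g => ?_)
    simp
  exact AlgHom.congr_fun this a

open MvPolynomial

variable {r : ℕ} (β : DualFamily R L r)

/-- The vectors with given coordinates. -/
def coordVec {Γ : Type*} (c : Γ × Fin r → A) (g : Γ) : A ⊗[R] L := ∑ j, c (g, j) • β.elt A j

lemma bc_coordVec {Γ : Type*} (φ : A →ₐ[R] B) (c : Γ × Fin r → A) (g : Γ) :
    bc L φ (coordVec β c g) = coordVec β (fun x => φ (c x)) g := by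
  simp only [coordVec, map_sum, bc_smul, β.bc_elt]

variable (Δ) in
/-- The equations for the coordinates of the values of a representation on the generators. -/
def repEquations : Set (MvPolynomial ((Δ ⊕ Quiver.Total Δ) × Fin r) R) :=
  {s | ∃ x, s = X x - β.co _ x.2 (coordVec β X x.1)} ∪
  {s | ∃ a b j, PathAlgebra.Rel R Δ a b ∧
    s = β.co _ j (FreeAlgebra.lift R (coordVec β X) a - FreeAlgebra.lift R (coordVec β X) b)}

/-- Evaluation at `c` is a homomorphism of algebras, so it turns the generic vectors into those with
coordinates `c`. The first equations say that `c` really is the family of coordinates of these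
vectors, because the dual family need not be a basis. -/
lemma aeval_repEquations_iff (c : (Δ ⊕ Quiver.Total Δ) × Fin r → A) :
    (∀ s ∈ repEquations Δ β, aeval c s = 0) ↔
      (∀ x, c x = β.co A x.2 (coordVec β c x.1)) ∧ ∀ a b, PathAlgebra.Rel R Δ a b →
        FreeAlgebra.lift R (coordVec β c) a = FreeAlgebra.lift R (coordVec β c) b := by
  have h0 : (fun g => bc L (aeval (R := R) c) (coordVec β X g)) = coordVec β c := by
    funext g
    simp [bc_coordVec]
  have h1 (x : (Δ ⊕ Quiver.Total Δ) × Fin r) :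
      aeval c (X (R := R) x - β.co _ x.2 (coordVec β X x.1)) =
        c x - β.co A x.2 (coordVec β c x.1) := by
    rw [map_sub, aeval_X, ← β.co_bc, ← h0]
  have h2 (a b : FreeAlgebra R (Δ ⊕ Quiver.Total Δ)) (j : Fin r) :
      aeval c (β.co (MvPolynomial ((Δ ⊕ Quiver.Total Δ) × Fin r) R) j
        (FreeAlgebra.lift R (coordVec β X) a - FreeAlgebra.lift R (coordVec β X) b)) =
      β.co A j (FreeAlgebra.lift R (coordVec β c) a - FreeAlgebra.lift R (coordVec β c) b) := by
    rw [← β.co_bc, map_sub (bc L (aeval (R := R) c)), bc_lift, bc_lift, h0]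
  constructor
  · intro h
    refine ⟨fun x => ?_, fun a b hab => ?_⟩
    · rw [← sub_eq_zero, ← h1]
      exact h _ (Or.inl ⟨x, rfl⟩)
    · rw [← sub_eq_zero]
      refine β.ext fun j => ?_
      rw [← h2, map_zero]
      exact h _ (Or.inr ⟨a, b, j, hab, rfl⟩)
  · rintro ⟨h, h'⟩ s (⟨x, rfl⟩ | ⟨a, b, j, hab, rfl⟩)
    · rw [h1, ← h, sub_self]
    · rw [h2, h' a b hab, sub_self, map_zero]

variable (Δ) in
/-- There is a universal representation, and the coordinates of its values on the generators
generate the algebra over which it is defined. -/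
theorem exists_universal_rep : ∃ (B : CommAlgCat.{u} R)
    (ρ : B ⊗[R] PathAlgebra R Δ →ₐ[B] B ⊗[R] L),
    Algebra.adjoin R (Set.range fun x : (Δ ⊕ Quiver.Total Δ) × Fin r =>
      β.co B x.2 (genValue ρ x.1)) = ⊤ ∧
    ∀ (A : CommAlgCat.{u} R) (ρ' : A ⊗[R] PathAlgebra R Δ →ₐ[A] A ⊗[R] L),
      ∃ φ : B ⟶ A, repMap (PathAlgebra R Δ) L φ.hom ρ = ρ' := by
  let S := repEquations Δ β
  obtain ⟨h1, h2⟩ := (aeval_repEquations_iff β (quotVar S)).1 fun s hs =>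
    aeval_quotVar_eq_zero (𝟙 (quotRing S)) hs
  obtain ⟨ρ, hρ⟩ := exists_rep (coordVec β (quotVar S)) h2
  refine ⟨quotRing S, ρ, ?_, fun A ρ' => ?_⟩
  · have h3 : (fun x : (Δ ⊕ Quiver.Total Δ) × Fin r => β.co (quotRing S) x.2 (genValue ρ x.1)) =
        quotVar S := by
      funext x
      rw [hρ, ← h1]
    rw [h3]
    exact adjoin_range_quotVar
  · let c (x : (Δ ⊕ Quiver.Total Δ) × Fin r) : A := β.co A x.2 (genValue ρ' x.1)
    have h4 : coordVec β c = genValue ρ' := by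
      funext g
      exact β.sum_co (genValue ρ' g)
    have h7 (x) : c x = β.co A x.2 (coordVec β c x.1) :=
      congrArg (β.co A x.2) (congrFun h4 x.1).symm
    have h8 (a b) (hab : PathAlgebra.Rel R Δ a b) :
        FreeAlgebra.lift R (coordVec β c) a = FreeAlgebra.lift R (coordVec β c) b := by
      rw [h4]
      exact lift_genValue_eq_of_rel ρ' hab
    have h5 := (aeval_repEquations_iff β c).2 ⟨h7, h8⟩
    obtain ⟨φ, hφ⟩ := exists_quotRing_hom c h5
    have h6 (g : Δ ⊕ Quiver.Total Δ) : bc L φ.hom (coordVec β (quotVar S) g) = genValue ρ' g := by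
      rw [bc_coordVec, funext hφ, h4]
    refine ⟨φ, rep_ext fun g => ?_⟩
    rw [genValue_repMap, hρ]
    exact h6 g

/-- Homomorphisms out of an algebra that is generated by the coordinates of the values of a
representation are determined by the induced representation. -/
lemma eq_of_repMap_eq {A B : CommAlgCat.{u} R} {ρ : B ⊗[R] PathAlgebra R Δ →ₐ[B] B ⊗[R] L}
    (hρ : Algebra.adjoin R (Set.range fun x : (Δ ⊕ Quiver.Total Δ) × Fin r =>
      β.co B x.2 (genValue ρ x.1)) = ⊤) {φ ψ : B ⟶ A}
    (h : repMap (PathAlgebra R Δ) L φ.hom ρ = repMap (PathAlgebra R Δ) L ψ.hom ρ) : φ = ψ := by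
  refine CommAlgCat.hom_ext (AlgHom.ext_of_adjoin_eq_top hρ ?_)
  rintro _ ⟨x, rfl⟩
  dsimp only
  rw [← β.co_bc, ← β.co_bc, ← genValue_repMap, ← genValue_repMap, h]

end UniversalRep

/-! ### The scheme of Schur representations -/

section SchurScheme

variable {R : Type u} [CommRing R] {L : Type u} [Ring L] [Algebra R L]
  {Δ : Type u} [Quiver.{u} Δ] [Fintype Δ]
variable {A B : Type u} [CommRing A] [Algebra R A] [CommRing B] [Algebra R B]

/-- The centralizer of `z` is a subalgebra, and the generators together with the scalars generate
the source. -/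
lemma forall_commute_iff (ρ : A ⊗[R] PathAlgebra R Δ →ₐ[A] A ⊗[R] L) (z : A ⊗[R] L) :
    (∀ x, z * ρ x = ρ x * z) ↔ ∀ g, z * genValue ρ g = genValue ρ g * z := by
  refine ⟨fun h g => h _, fun h x => ?_⟩
  let C : Subalgebra R (A ⊗[R] L) := Subalgebra.centralizer R {z}
  have hC (y : A ⊗[R] L) : y ∈ C ↔ z * y = y * z := by
    simp [C, Subalgebra.mem_centralizer_iff]
  have h1 (a : FreeAlgebra R (Δ ⊕ Quiver.Total Δ)) : FreeAlgebra.lift R (genValue ρ) a ∈ C := by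
    induction a with
    | grade0 c => rw [AlgHom.commutes]; exact C.algebraMap_mem c
    | grade1 g => rw [FreeAlgebra.lift_ι_apply, hC, h]
    | mul a b ha hb => rw [map_mul]; exact mul_mem ha hb
    | add a b ha hb => rw [map_add]; exact add_mem ha hb
  induction x with
  | zero => simp
  | tmul a x =>
    obtain ⟨y, rfl⟩ := RingQuot.mkAlgHom_surjective R (PathAlgebra.Rel R Δ) x
    have h2 := (hC _).1 (h1 y)
    rw [lift_genValue] at h2
    have h3 : a ⊗ₜ[R] RingQuot.mkAlgHom R (PathAlgebra.Rel R Δ) y =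
        a • ((1 : A) ⊗ₜ[R] RingQuot.mkAlgHom R (PathAlgebra.Rel R Δ) y) := by simp [smul_tmul']
    rw [h3, map_smul, mul_smul_comm, smul_mul_assoc, h2]
  | add x y hx hy => rw [map_add, mul_add, add_mul, hx, hy]

variable {r : ℕ} (β : DualFamily R L r)

variable (Δ) in
/-- The rows of the commutator matrix. -/
abbrev CommIndex (r : ℕ) : Type u :=
  ULift.{u} (Fin r) ⊕ PUnit.{u + 1} ⊕ ((Δ ⊕ Quiver.Total Δ) × Fin r)

/-- The matrix of the linear map that sends the coordinates of `z` to the defect of their being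
coordinates, the value of a linear form on `z` and the coordinates of the commutators of `z`
with the values of a representation on the generators. -/
def commMatrix (l : Module.Dual R L) (ρ : A ⊗[R] PathAlgebra R Δ →ₐ[A] A ⊗[R] L) :
    Matrix (CommIndex Δ r) (Fin r) A :=
  Matrix.of fun i k => Sum.elim
    (fun i => (Pi.single k 1 : Fin r → A) i.down - β.co A i.down (β.elt A k))
    (Sum.elim (fun _ => coord A l (β.elt A k)) fun x =>
      β.co A x.2 (β.elt A k * genValue ρ x.1 - genValue ρ x.1 * β.elt A k)) i

lemma commMatrix_repMap (φ : A →ₐ[R] B) (l : Module.Dual R L)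
    (ρ : A ⊗[R] PathAlgebra R Δ →ₐ[A] A ⊗[R] L) :
    commMatrix β l (repMap (PathAlgebra R Δ) L φ ρ) = (commMatrix β l ρ).map φ := by
  ext i k
  rcases i with ⟨i⟩ | i | x
  · simp only [commMatrix, Matrix.of_apply, Matrix.map_apply, Sum.elim_inl, map_sub, ← β.co_bc,
      β.bc_elt, Pi.single_apply]
    split_ifs <;> simp
  · simp only [commMatrix, Matrix.of_apply, Matrix.map_apply, Sum.elim_inl, Sum.elim_inr,
      ← coord_bc, β.bc_elt]
  · simp only [commMatrix, Matrix.of_apply, Matrix.map_apply, Sum.elim_inr, ← β.co_bc,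
      map_sub (bc L φ), map_mul, β.bc_elt, genValue_repMap]

lemma commMatrix_mulVec (l : Module.Dual R L) (ρ : A ⊗[R] PathAlgebra R Δ →ₐ[A] A ⊗[R] L)
    (y : Fin r → A) {z : A ⊗[R] L} (hz : ∑ k, y k • β.elt A k = z) :
    (commMatrix β l ρ).mulVec y = Sum.elim (fun i => y i.down - β.co A i.down z)
      (Sum.elim (fun _ => coord A l z) fun x =>
        β.co A x.2 (z * genValue ρ x.1 - genValue ρ x.1 * z)) := by
  subst hz
  ext i
  rcases i with ⟨i⟩ | i | x
  · simp only [commMatrix, Matrix.mulVec, dotProduct, Matrix.of_apply, Sum.elim_inl, map_sum,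
      map_smul, sub_mul, Finset.sum_sub_distrib, smul_eq_mul, Pi.single_apply, ite_mul, one_mul,
      zero_mul, Finset.sum_ite_eq, Finset.mem_univ, if_true, mul_comm (y _)]
  · simp only [commMatrix, Matrix.mulVec, dotProduct, Matrix.of_apply, Sum.elim_inl, Sum.elim_inr,
      map_sum, map_smul, smul_eq_mul, mul_comm (y _)]
  · simp only [commMatrix, Matrix.mulVec, dotProduct, Matrix.of_apply, Sum.elim_inr,
      Finset.sum_mul, Finset.mul_sum, smul_mul_assoc, mul_smul_comm, map_sub, map_sum, map_smul,
      smul_eq_mul, sub_mul, Finset.sum_sub_distrib, mul_comm (y _)]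

/-- The rows of a matrix with trivial kernel span, so `r` of them form a basis. -/
lemma exists_det_submatrix_ne_zero {K ι : Type*} [Field K] (M : Matrix ι (Fin r) K)
    (h : ∀ y, M.mulVec y = 0 → y = 0) : ∃ J : Fin r → ι, (M.submatrix J id).det ≠ 0 := by
  have hspan : Submodule.span K (Set.range M) = ⊤ := by
    by_contra hne
    -- A nonzero functional that vanishes on all rows is a nonzero vector in the kernel.
    obtain ⟨f, hf, hle⟩ := Submodule.exists_le_ker_of_lt_top _ (lt_top_iff_ne_top.2 hne)
    have hf' (v : Fin r → K) : f v = v ⬝ᵥ fun k => f (Pi.single k 1) := by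
      conv_lhs => rw [pi_eq_sum_univ' v, map_sum]
      refine Finset.sum_congr rfl fun k _ => ?_
      rw [map_smul, smul_eq_mul]
    have h0 := h (fun k => f (Pi.single k 1)) (funext fun i => by
      refine (hf' (M i)).symm.trans ?_
      exact hle (Submodule.subset_span ⟨i, rfl⟩))
    refine hf (LinearMap.ext fun v => ?_)
    rw [hf', h0, dotProduct_zero, LinearMap.zero_apply]
  obtain ⟨f, hf, -, hli⟩ := Submodule.exists_fun_fin_finrank_span_eq K (Set.range M)
  have hr : Module.finrank K (Submodule.span K (Set.range M)) = r := by
    rw [hspan, finrank_top, Module.finrank_fin_fun]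
  choose J hJ using hf
  refine ⟨J ∘ finCongr hr.symm, ?_⟩
  have h1 : LinearIndependent K (M.submatrix (J ∘ finCongr hr.symm) id).row := by
    have : (M.submatrix (J ∘ finCongr hr.symm) id).row = f ∘ finCongr hr.symm :=
      funext fun i => hJ _
    rw [this]
    exact hli.comp _ (finCongr hr.symm).injective
  exact ((Matrix.isUnit_iff_isUnit_det _).1
    (Matrix.linearIndependent_rows_iff_isUnit.1 h1)).ne_zero

/-- The functions on the base of a representation whose nonvanishing loci cover the open locus
where the representation is a Schur representation. -/
def schurMinor (ρ : A ⊗[R] PathAlgebra R Δ →ₐ[A] A ⊗[R] L)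
    (x : Fin r × (Fin r → CommIndex Δ r)) : A :=
  algebraMap R A (β.form x.1 1) * ((commMatrix β (β.form x.1) ρ).submatrix x.2 id).det

lemma schurMinor_repMap (φ : A →ₐ[R] B) (ρ : A ⊗[R] PathAlgebra R Δ →ₐ[A] A ⊗[R] L)
    (x : Fin r × (Fin r → CommIndex Δ r)) :
    schurMinor β (repMap (PathAlgebra R Δ) L φ ρ) x = φ (schurMinor β ρ x) := by
  rw [schurMinor, schurMinor, map_mul, AlgHom.commutes, commMatrix_repMap, AlgHom.map_det]
  rfl

lemma DualFamily.co_one (j : Fin r) : β.co A j 1 = algebraMap R A (β.form j 1) := by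
  rw [Algebra.TensorProduct.one_def, co, coord_tmul, Algebra.algebraMap_eq_smul_one]

/-- If a form `l` does not vanish at `1`, the commutant is the sum of the scalars and its
intersection with the kernel of `l`. The kernel of the commutator matrix is exactly this
intersection: the first rows force a vector to be a vector of coordinates, the next row is `l`, and
the remaining ones are the commutators with the generators. -/
lemma hasScalarCommutant_iff {K : Type u} [Field K] [Algebra R K] [Nontrivial (K ⊗[R] L)]
    (ρ : K ⊗[R] PathAlgebra R Δ →ₐ[K] K ⊗[R] L) :
    HasScalarCommutant ρ ↔ ∃ x, schurMinor β ρ x ≠ 0 := by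
  constructor
  · intro h
    -- Some coordinate form is nonzero at `1`, as otherwise `1 = 0` in `K ⊗ L`.
    obtain ⟨j, hj⟩ : ∃ j, β.co K j 1 ≠ 0 := by
      by_contra hcon
      push Not at hcon
      exact one_ne_zero (α := K ⊗[R] L) (β.ext fun j => by rw [hcon, map_zero])
    obtain ⟨J, hJ⟩ := exists_det_submatrix_ne_zero (commMatrix β (β.form j) ρ) fun y hy => by
      rw [commMatrix_mulVec β _ ρ y rfl] at hy
      set z : K ⊗[R] L := ∑ k, y k • β.elt K k
      have h1 (i : Fin r) : y i = β.co K i z := sub_eq_zero.1 (congrFun hy (Sum.inl ⟨i⟩))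
      have h2 : β.co K j z = 0 := congrFun hy (Sum.inr (Sum.inl PUnit.unit))
      have h3 (g) : z * genValue ρ g = genValue ρ g * z := by
        rw [← sub_eq_zero]
        refine β.ext fun i => ?_
        rw [map_zero]
        exact congrFun hy (Sum.inr (Sum.inr (g, i)))
      obtain ⟨a, ha⟩ := h z ((forall_commute_iff ρ z).2 h3)
      rw [Algebra.algebraMap_eq_smul_one] at ha
      rw [ha, map_smul, smul_eq_mul, mul_eq_zero, or_iff_left hj] at h2
      rw [h2, zero_smul] at ha
      ext i
      rw [h1, ha, map_zero, Pi.zero_apply]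
    refine ⟨(j, J), mul_ne_zero ?_ hJ⟩
    rwa [← β.co_one]
  · rintro ⟨⟨j, J⟩, hx⟩ z hz
    obtain ⟨hj, hJ⟩ := mul_ne_zero_iff.1 hx
    dsimp only at hj hJ
    rw [← β.co_one] at hj
    have hz' := (forall_commute_iff ρ z).1 hz
    -- Subtracting this multiple of `1` moves `z` into the kernel of the form, where the nonzero
    -- minor forces it to vanish.
    let a : K := β.co K j z / β.co K j 1
    let z' : K ⊗[R] L := z - algebraMap K (K ⊗[R] L) a
    have h1 : β.co K j z' = 0 := by
      rw [map_sub, Algebra.algebraMap_eq_smul_one, map_smul, smul_eq_mul, div_mul_cancel₀ _ hj,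
        sub_self]
    have h2 (g) : z' * genValue ρ g - genValue ρ g * z' = 0 := by
      rw [sub_mul, mul_sub, hz', Algebra.commutes, sub_self]
    have h3 : (commMatrix β (β.form j) ρ).mulVec (fun k => β.co K k z') = 0 := by
      rw [commMatrix_mulVec β _ ρ _ (β.sum_co z')]
      ext i
      rcases i with ⟨i⟩ | i | x
      · exact sub_self _
      · exact h1
      · exact (congrArg _ (h2 x.1)).trans (map_zero _)
    have h4 : (fun k => β.co K k z') = 0 := by
      refine Matrix.eq_zero_of_mulVec_eq_zero hJ (funext fun i => ?_)
      exact congrFun h3 (J i)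
    refine ⟨a, sub_eq_zero.1 (β.ext fun k => ?_)⟩
    rw [map_zero]
    exact congrFun h4 k

lemma nontrivial_tensorProduct (n : ℕ) [IsAzumayaOfDegree R L n] (K : Type u) [Field K]
    [Algebra R K] : Nontrivial (K ⊗[R] L) := by
  have : IsAzumaya R L := IsAzumayaOfDegree.toIsAzumaya n
  have p : PrimeSpectrum K := default
  have h : Module.rankAtStalk (R := K) (K ⊗[R] L) p = n ^ 2 := by
    rw [Module.rankAtStalk_baseChange, IsAzumayaOfDegree.rank_eq (n := n)]
  by_contra hcon
  rw [not_nontrivial_iff_subsingleton] at hcon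
  rw [Module.rankAtStalk_eq_zero_of_subsingleton] at h
  have h1 : 1 ≤ n ^ 2 := Nat.one_le_pow _ _ (IsAzumayaOfDegree.one_le R L (n := n))
  have h2 : 0 = n ^ 2 := h
  omega

lemma isSchur_iff (n : ℕ) [IsAzumayaOfDegree R L n]
    (ρ : A ⊗[R] PathAlgebra R Δ →ₐ[A] A ⊗[R] L) :
    IsSchur ρ ↔ ∀ p : PrimeSpectrum A, ∃ x, schurMinor β ρ x ∉ p.asIdeal := by
  refine forall_congr' fun p => ?_
  have := nontrivial_tensorProduct (R := R) (L := L) n p.asIdeal.ResidueField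
  rw [hasScalarCommutant_iff β]
  refine exists_congr fun x => not_congr ?_
  rw [schurMinor_repMap]
  exact Ideal.algebraMap_residueField_eq_zero

end SchurScheme

section SchurScheme

variable {R : Type u} [CommRing R] {L : Type u} [Ring L] [Algebra R L]
  {Δ : Type u} [Quiver.{u} Δ] [Fintype Δ] [Finite (Quiver.Total Δ)]

/-- The functor of Schur representations is represented by a quasicompact open subscheme of the
spectrum of the algebra of definition of the universal representation. -/
theorem exists_schurScheme (n : ℕ) [IsAzumayaOfDegree R L n] {r : ℕ} (β : DualFamily R L r)
    {B : CommAlgCat.{u} R} (ρ : B ⊗[R] PathAlgebra R Δ →ₐ[B] B ⊗[R] L)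
    (hinj : ∀ {A : CommAlgCat.{u} R} {φ ψ : B ⟶ A},
      repMap (PathAlgebra R Δ) L φ.hom ρ = repMap (PathAlgebra R Δ) L ψ.hom ρ → φ = ψ)
    (hsurj : ∀ (A : CommAlgCat.{u} R) (ρ' : A ⊗[R] PathAlgebra R Δ →ₐ[A] A ⊗[R] L),
      ∃ φ : B ⟶ A, repMap (PathAlgebra R Δ) L φ.hom ρ = ρ') :
    ∃ (X : Over (Spec (.of R))) (u : X ⟶ specOver B)
      (e : points X ≅ schurFunctor R (PathAlgebra R Δ) L), IsOpenImmersion u.left ∧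
      CompactSpace X.left ∧ ∀ (A : CommAlgCat.{u} R) (y : specOver A ⟶ X) (φ : B ⟶ A),
        y ≫ u = specOverMap φ →
          (e.hom.app A y : SchurRep R (PathAlgebra R Δ) L A).1 =
            repMap (PathAlgebra R Δ) L φ.hom ρ := by
  let V' : (PrimeSpectrum B) → Prop := fun p => ∃ x, schurMinor β ρ x ∉ p.asIdeal
  have hVo : IsOpen {p | V' p} := by
    have : {p | V' p} = ⋃ x, (PrimeSpectrum.basicOpen (schurMinor β ρ x) :
        Set (PrimeSpectrum B)) := by
      ext p
      simp [V']
    rw [this]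
    exact isOpen_iUnion fun x => (PrimeSpectrum.basicOpen _).isOpen
  -- There are finitely many generators, hence finitely many minors, so this is a finite union of
  -- basic open sets.
  have hVc : IsCompact {p | V' p} := by
    have : {p | V' p} = ⋃ x, (PrimeSpectrum.basicOpen (schurMinor β ρ x) :
        Set (PrimeSpectrum B)) := by
      ext p
      simp [V']
    rw [this]
    exact isCompact_iUnion fun x => PrimeSpectrum.isCompact_basicOpen _
  let V : (specOver B).left.Opens := ⟨{p | V' p}, hVo⟩
  let X : Over (Spec (.of R)) := Over.mk (V.ι ≫ (specOver B).hom)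
  let u : X ⟶ specOver B := Over.homMk V.ι rfl
  have hu : IsOpenImmersion u.left := inferInstanceAs (IsOpenImmersion V.ι)
  have hur : Set.range u.left = V := V.range_ι
  have hX : CompactSpace X.left := isCompact_iff_compactSpace.1 hVc
  have hV (A : CommAlgCat.{u} R) (φ : B ⟶ A) : IsSchur (repMap (PathAlgebra R Δ) L φ.hom ρ) ↔
      Set.range (specOverMap φ).left ⊆ Set.range u.left := by
    rw [isSchur_iff β n, hur]
    constructor
    · rintro h _ ⟨p, rfl⟩
      obtain ⟨x, hx⟩ := h p
      rw [schurMinor_repMap] at hx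
      exact ⟨x, hx⟩
    · intro h p
      obtain ⟨x, hx⟩ := h ⟨p, rfl⟩
      refine ⟨x, ?_⟩
      rw [schurMinor_repMap]
      exact hx
  -- The representation attached to a point is the pullback of the universal one, and a point
  -- factors through the open locus exactly if this pullback is Schur.
  have hex (A : CommAlgCat.{u} R) (y : specOver A ⟶ X) :
      ∃ s : SchurRep R (PathAlgebra R Δ) L A, ∀ φ : B ⟶ A, y ≫ u = specOverMap φ →
        s.1 = repMap (PathAlgebra R Δ) L φ.hom ρ := by
    obtain ⟨φ, hφ⟩ := exists_specOverMap (y ≫ u)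
    refine ⟨⟨repMap (PathAlgebra R Δ) L φ.hom ρ, (hV A φ).2 ?_⟩, fun ψ hψ => ?_⟩
    · rw [← hφ]
      rintro _ ⟨p, rfl⟩
      exact ⟨y.left p, rfl⟩
    · rw [hφ] at hψ
      exact congrArg (fun χ : B ⟶ A => repMap (PathAlgebra R Δ) L χ.hom ρ)
        (specOverMap_injective hψ)
  choose θ hθ using hex
  have hbij (A : CommAlgCat.{u} R) : Function.Bijective (θ A) := by
    constructor
    · intro y y' h
      obtain ⟨φ, hφ⟩ := exists_specOverMap (y ≫ u)
      obtain ⟨ψ, hψ⟩ := exists_specOverMap (y' ≫ u)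
      have h1 : φ = ψ := hinj (by rw [← hθ A y φ hφ, ← hθ A y' ψ hψ, h])
      have h2 : y ≫ u = y' ≫ u := by rw [hφ, hψ, h1]
      exact Over.OverMorphism.ext ((cancel_mono u.left).1 (congrArg CommaMorphism.left h2))
    · intro s
      obtain ⟨φ, hφ⟩ := hsurj A s.1
      obtain ⟨y, hy⟩ := exists_lift_of_range_subset u (specOverMap φ) ((hV A φ).1 (by
        rw [hφ]
        exact s.2))
      exact ⟨y, Subtype.ext ((hθ A y φ hy).trans hφ)⟩
  refine ⟨X, u, NatIso.ofComponents (fun A => (Equiv.ofBijective _ (hbij A)).toIso)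
    fun {A A'} ψ => ?_, hu, hX, hθ⟩
  refine ConcreteCategory.hom_ext _ _ fun y => ?_
  let y' : specOver A ⟶ X := y
  obtain ⟨φ, hφ⟩ := exists_specOverMap (y' ≫ u)
  refine Subtype.ext ((hθ A' (specOverMap ψ ≫ y') (φ ≫ ψ) ?_).trans ?_)
  · rw [Category.assoc, hφ, specOverMap_comp]
  · refine (repMap_comp ψ.hom φ.hom ρ).trans ?_
    exact congrArg (repMap (PathAlgebra R Δ) L ψ.hom) (hθ A y' φ hφ).symm

/-- A natural transformation between functors of points comes from a morphism. -/
lemma exists_pointsMap_eq {S T : Over (Spec (.of R))} (η : points S ⟶ points T) :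
    ∃ f : S ⟶ T, pointsMap f = η := by
  obtain ⟨f, hf⟩ := exists_hom_of_natural (S := S) (T := T) (fun A y => η.app A y)
    fun A B φ y => NatTrans.naturality_apply η φ y
  refine ⟨f, ?_⟩
  ext A y
  exact hf A y

/-- A quasicompact open subscheme of an affine scheme of finite type is quasiprojective. -/
lemma isQuasiProjective_of_isOpenImmersion {X : Over (Spec (.of R))} {B : CommAlgCat.{u} R}
    (u : X ⟶ specOver B) [IsOpenImmersion u.left] [CompactSpace X.left] {σ : Type*} [Finite σ]
    (c : σ → B) (hc : Algebra.adjoin R (Set.range c) = ⊤) : IsQuasiProjective X := by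
  obtain ⟨N, ⟨e⟩⟩ := Finite.exists_equiv_fin σ
  -- With first coordinate `1`, the generators exhibit the spectrum of `B` as a closed subscheme of
  -- the standard affine chart of projective space.
  let c' : Fin (N + 1) → B := Fin.cons 1 (c ∘ e.symm)
  have hc' : Algebra.adjoin R (Set.range c') = ⊤ := by
    rw [← top_le_iff, ← hc, Algebra.adjoin_le_iff]
    rintro _ ⟨x, rfl⟩
    exact Algebra.subset_adjoin ⟨(e x).succ, by simp [c']⟩
  have h1 := chartEval_surjective c' 0 rfl hc'
  let v : specOver B ⟶ specOver (chartRing R N 0) := specOverMap (chartEval c' 0 (by simp [c']))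
  have hv : IsClosedImmersion v.left := IsClosedImmersion.spec_of_surjective _ h1
  have hsep : (projectiveSpace R N).left.IsSeparated := isSeparated_projectiveSpace
  have h2 : IsImmersion (u ≫ v ≫ chartι R N 0).left :=
    inferInstanceAs (IsImmersion (u.left ≫ v.left ≫ (chartι R N 0).left))
  exact ⟨N, u ≫ v ≫ chartι R N 0, h2, inferInstance⟩

end SchurScheme

/-! ### The locus where the submodules span -/

/-- The support of a finite module is detected on fibres over residue fields, and extending a
residue field does not affect whether a fibre is zero. -/
lemma mem_support_baseChange_iff {A B : Type u} [CommRing A] [CommRing B] [Algebra A B]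
    (M : Type u) [AddCommGroup M] [Module A M] [Module.Finite A M] (q : PrimeSpectrum B) :
    q ∈ Module.support B (B ⊗[A] M) ↔ q.comap (algebraMap A B) ∈ Module.support A M := by
  let p : PrimeSpectrum A := q.comap (algebraMap A B)
  change _ ↔ p ∈ _
  rw [Module.mem_support_iff_nontrivial_residueField_tensorProduct,
    Module.mem_support_iff_nontrivial_residueField_tensorProduct]
  let k := p.asIdeal.ResidueField
  let K := q.asIdeal.ResidueField
  let : Algebra k K := (Ideal.ResidueField.map p.asIdeal q.asIdeal (algebraMap A B) rfl).toAlgebra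
  have : IsScalarTower A k K := .of_algebraMap_eq fun a => by
    rw [IsScalarTower.algebraMap_apply A B K]
    exact (Ideal.ResidueField.map_algebraMap (I := p.asIdeal) (J := q.asIdeal) (algebraMap A B) rfl a).symm
  rw [(AlgebraTensorModule.cancelBaseChange A B K K M).nontrivial_congr,
    ← (AlgebraTensorModule.cancelBaseChange A k K K M).nontrivial_congr]
  constructor
  · intro h
    by_contra hcon
    rw [not_nontrivial_iff_subsingleton] at hcon
    exact not_subsingleton (K ⊗[k] (k ⊗[A] M)) inferInstance
  · intro h
    infer_instance

section Decomposition

variable {R : Type u} [CommRing R] {L : Type u} [Ring L] [Algebra R L]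
variable {A B : Type u} [CommRing A] [Algebra R A] [CommRing B] [Algebra R B]

lemma iSup_subMap (φ : A →ₐ[R] B) {I : Type*} (N : I → Submodule A (A ⊗[R] L)) :
    ⨆ i, subMap φ (N i) = subMap φ (⨆ i, N i) := by
  refine le_antisymm (iSup_le fun i => subMap_mono φ (le_iSup N i)) (Submodule.span_le.2 ?_)
  rintro _ ⟨z, hz, rfl⟩
  induction hz using Submodule.iSup_induction' with
  | mem i z hz => exact Submodule.mem_iSup_of_mem i (bc_mem_subMap φ hz)
  | zero => rw [map_zero]; exact zero_mem _
  | add y z _ _ hy hz => rw [map_add]; exact add_mem hy hz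

lemma subMap_eq_top_iff [Module.Finite R L] (φ : A →ₐ[R] B) (N : Submodule A (A ⊗[R] L)) :
    subMap φ N = ⊤ ↔ ∀ q : PrimeSpectrum B,
      q.comap φ.toRingHom ∈ (Module.support A ((A ⊗[R] L) ⧸ N))ᶜ := by
  let : Algebra A B := φ.toAlgebra
  obtain ⟨e⟩ := exists_quotient_subMap_equiv φ N
  rw [← Submodule.Quotient.subsingleton_iff, e.subsingleton_congr,
    ← Module.support_eq_empty_iff (R := B), Set.eq_empty_iff_forall_notMem]
  exact forall_congr' fun q => not_congr (mem_support_baseChange_iff _ q)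

variable {n : ℕ} {Δ : Type u} [Quiver.{u} Δ] [Fintype Δ]

lemma TargetPoint.iSup_sub_map_eq_top_iff [Module.Finite R L] (φ : A →ₐ[R] B)
    (t : TargetPoint R L n Δ A) : ⨆ i, (t.map φ).sub i = ⊤ ↔ ∀ q : PrimeSpectrum B,
      q.comap φ.toRingHom ∈ (Module.support A ((A ⊗[R] L) ⧸ ⨆ i, t.sub i))ᶜ := by
  rw [← subMap_eq_top_iff, ← iSup_subMap]
  rfl

lemma TargetPoint.sum_rankAtStalk_sub [IsAzumayaOfDegree R L n] (t : TargetPoint R L n Δ A)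
    (p : PrimeSpectrum A) : ∑ i, Module.rankAtStalk (R := A) (t.sub i) p = n ^ 2 := by
  have : IsAzumaya R L := IsAzumayaOfDegree.toIsAzumaya n
  obtain ⟨m, hm, h⟩ := t.rank_eq p
  rw [← hm]
  refine Finset.sum_congr rfl fun i _ => ?_
  have := t.projective_quotient i
  have h1 := rankAtStalk_quotient_add (t.sub i) p
  rw [Module.rankAtStalk_baseChange, IsAzumayaOfDegree.rank_eq (n := n), h] at h1
  have h2 : m i ≤ n ^ 2 :=
    (Finset.single_le_sum (fun _ _ => Nat.zero_le _) (Finset.mem_univ i)).trans_eq hm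
  omega

/-- The direct sum of the submodules surjects onto `A ⊗ L`, and both are finite projective of rank
`n ^ 2`. Hence the sum map is bijective. -/
lemma TargetPoint.existsUnique_decomposition [IsAzumayaOfDegree R L n]
    (t : TargetPoint R L n Δ A) (ht : ⨆ i, t.sub i = ⊤) :
    ∃! e : Δ → A ⊗[R] L, (∀ i, e i ∈ t.sub i) ∧ ∑ i, e i = 1 := by
  classical
  have : IsAzumaya R L := IsAzumayaOfDegree.toIsAzumaya n
  have := t.projective_quotient
  have hfin (i : Δ) : Module.Finite A (t.sub i) := finite_of_projective_quotient _
  have hproj (i : Δ) : Module.Projective A (t.sub i) := projective_of_projective_quotient _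
  have hpi : Module.Projective A (∀ i, t.sub i) :=
    Module.Projective.of_equiv (DFinsupp.linearEquivFunOnFintype (R := A))
  let s : (∀ i, t.sub i) →ₗ[A] A ⊗[R] L :=
    ∑ i, (t.sub i).subtype ∘ₗ LinearMap.proj i
  have hs (z : ∀ i, t.sub i) : s z = ∑ i, (z i : A ⊗[R] L) := by
    simp [s]
  have hsurj : Function.Surjective s := by
    rw [← LinearMap.range_eq_top, ← top_le_iff, ← ht]
    refine iSup_le fun i z hz => ⟨Pi.single i ⟨z, hz⟩, ?_⟩
    rw [hs, Finset.sum_eq_single i (fun j _ hj => by rw [Pi.single_eq_of_ne hj]; rfl)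
      (fun h => absurd (Finset.mem_univ i) h), Pi.single_eq_same]
  have hbij : Function.Bijective s := Module.bijective_of_surjective_of_rankAtStalk_eq hsurj
    fun m _ => by
      rw [Module.rankAtStalk_pi, finsum_eq_sum_of_fintype, t.sum_rankAtStalk_sub,
        Module.rankAtStalk_baseChange, IsAzumayaOfDegree.rank_eq (n := n)]
  obtain ⟨e, he⟩ := hbij.surjective 1
  refine ⟨fun i => e i, ⟨fun i => (e i).2, by rw [← hs, he]⟩, fun e' he' => ?_⟩
  have h1 : (fun i => ⟨e' i, he'.1 i⟩ : ∀ i, t.sub i) = e := hbij.injective (by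
    rw [he, hs]
    exact he'.2)
  funext i
  rw [← h1]

lemma iSup_sub_toTarget [IsAzumayaOfDegree R L n]
    (ρ : A ⊗[R] PathAlgebra R Δ →ₐ[A] A ⊗[R] L) : ⨆ i, (toTarget n ρ).sub i = ⊤ := by
  refine top_le_iff.1 fun z _ => ?_
  have h : ∑ i : Δ, ρ (1 ⊗ₜ PathAlgebra.e R i) = 1 := by
    rw [← map_sum, ← tmul_sum, PathAlgebra.sum_e]
    exact map_one ρ
  rw [← one_mul z, ← h, Finset.sum_mul]
  exact sum_mem fun i _ => Submodule.mem_iSup_of_mem i ⟨z, rfl⟩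

lemma decomposition_toTarget [IsAzumayaOfDegree R L n]
    (ρ : A ⊗[R] PathAlgebra R Δ →ₐ[A] A ⊗[R] L) :
    (∀ i, genValue ρ (Sum.inl i) ∈ (toTarget n ρ).sub i) ∧
      ∑ i : Δ, genValue ρ (Sum.inl i) = 1 := by
  refine ⟨fun i => ⟨1, mul_one _⟩, ?_⟩
  refine Eq.trans ?_ (map_one ρ)
  refine (map_sum ρ _ _).symm.trans (congrArg ρ ?_)
  rw [← tmul_sum]
  exact congrArg _ (PathAlgebra.sum_e R Δ)

end Decomposition

/-! ### The embedding -/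

section Embedding

variable {R : Type u} [CommRing R] {L : Type u} [Ring L] [Algebra R L]
  {n : ℕ} [IsAzumayaOfDegree R L n] {Δ : Type u} [Quiver.{u} Δ] [Fintype Δ]

lemma toTarget_smul {A : Type u} [CommRing A] [Algebra R A] (σ : Aut R L A)
    (ρ : SchurRep R (PathAlgebra R Δ) L A) :
    toTarget n (σ • ρ).1 = σ • toTarget n ρ.1 :=
  TargetPoint.ext (funext fun _ => (map_rightIdeal σ _).symm) rfl

variable {r : ℕ} (β : DualFamily R L r)

/-- A morphism that on points sends a Schur representation to the associated right ideals and
vectors is an immersion. -/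
theorem isImmersion_of_quiverMorphism {X Y : Over (Spec (.of R))}
    (eX : points X ≅ schurFunctor R (PathAlgebra R Δ) L) (eY : points Y ≅ targetFunctor R L n Δ)
    (f : X ⟶ Y) (hf : pointsMap f ≫ eY.hom = eX.hom ≫ quiverMorphism R L n Δ)
    {B : CommAlgCat.{u} R} (ρ : B ⊗[R] PathAlgebra R Δ →ₐ[B] B ⊗[R] L)
    (hρ : Algebra.adjoin R (Set.range fun x : (Δ ⊕ Quiver.Total Δ) × Fin r =>
      β.co B x.2 (genValue ρ x.1)) = ⊤) (u : X ⟶ specOver B) [IsOpenImmersion u.left]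
    (hu : ∀ (A : CommAlgCat.{u} R) (y : specOver A ⟶ X) (φ : B ⟶ A), y ≫ u = specOverMap φ →
      (eX.hom.app A y : SchurRep R (PathAlgebra R Δ) L A).1 =
        repMap (PathAlgebra R Δ) L φ.hom ρ) : IsImmersion f.left := by
  have : IsAzumaya R L := IsAzumayaOfDegree.toIsAzumaya n
  let rep (A : CommAlgCat.{u} R) (y : specOver A ⟶ X) :
      A ⊗[R] PathAlgebra R Δ →ₐ[A] A ⊗[R] L :=
    (eX.hom.app A y : SchurRep R (PathAlgebra R Δ) L A).1
  let pt (A : CommAlgCat.{u} R) (y : specOver A ⟶ Y) : TargetPoint R L n Δ A := eY.hom.app A y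
  have hpt (A A' : CommAlgCat.{u} R) (φ : A ⟶ A') (y : specOver A ⟶ Y) :
      pt A' (specOverMap φ ≫ y) = (pt A y).map φ.hom := NatTrans.naturality_apply eY.hom φ y
  have hfpt (A : CommAlgCat.{u} R) (y : specOver A ⟶ X) : pt A (y ≫ f) = toTarget n (rep A y) :=
    ConcreteCategory.congr_hom (NatTrans.congr_app hf A) y
  let P (A : CommAlgCat.{u} R) (y : specOver A ⟶ Y) : Prop := ⨆ i, (pt A y).sub i = ⊤
  -- The submodules span away from the support of a finite module, and the support is closed and
  -- compatible with base change.
  have hP : IsOpenCondition P := by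
    intro A y
    refine ⟨_, (Module.isClosed_support (R := A)
      (M := (A ⊗[R] L) ⧸ ⨆ i, (pt A y).sub i)).isOpen_compl, fun A' φ => ?_⟩
    have h := (pt A y).iSup_sub_map_eq_top_iff φ.hom
    rw [← hpt] at h
    exact h
  obtain ⟨V, hV⟩ := hP.exists_opens
  let U : Over (Spec (.of R)) := Over.mk (V.ι ≫ Y.hom)
  let v : U ⟶ Y := Over.homMk V.ι rfl
  have hv : IsOpenImmersion v.left := inferInstanceAs (IsOpenImmersion V.ι)
  have hvr : Set.range v.left = V := V.range_ι
  have hUP (A : CommAlgCat.{u} R) (y : specOver A ⟶ U) : P A (y ≫ v) := by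
    rw [hV, ← hvr]
    rintro _ ⟨p, rfl⟩
    exact ⟨y.left p, rfl⟩
  obtain ⟨g, hg⟩ : ∃ g : X ⟶ U, g ≫ v = f := by
    refine exists_lift_of_range_subset v f ?_
    rintro _ ⟨s, rfl⟩
    obtain ⟨K, x, ⟨p⟩, -, hx⟩ := exists_point_range_eq X s
    have h1 : P K (x ≫ f) := by
      change ⨆ i, (pt K (x ≫ f)).sub i = ⊤
      rw [hfpt]
      exact iSup_sub_toTarget _
    rw [hV, ← hvr] at h1
    have h2 : x.left p = s := by
      have : x.left p ∈ Set.range x.left := ⟨p, rfl⟩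
      rwa [hx] at this
    rw [← h2]
    exact h1 ⟨p, rfl⟩
  let σ : Type u := (Δ ⊕ Quiver.Total Δ) × ULift.{u} (Fin r)
  let W : CommAlgCat.{u} R := CommAlgCat.of R (MvPolynomial σ R)
  have hWext {A : CommAlgCat.{u} R} {φ ψ : W ⟶ A}
      (h : ∀ x : σ, φ.hom (MvPolynomial.X x) = ψ.hom (MvPolynomial.X x)) : φ = ψ :=
    CommAlgCat.hom_ext (MvPolynomial.algHom_ext h)
  -- The value is stated for every decomposition of `1` rather than a chosen one. Naturality and the
  -- comparison with `ρ` then only need some decomposition at the point in question.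
  have hex (A : CommAlgCat.{u} R) (y : specOver A ⟶ U) : ∃ φ : W ⟶ A, ∀ e : Δ → A ⊗[R] L,
      ((∀ i, e i ∈ (pt A (y ≫ v)).sub i) ∧ ∑ i, e i = 1) → ∀ x : σ,
        φ.hom (MvPolynomial.X x) = β.co A x.2.down (Sum.elim e (pt A (y ≫ v)).vec x.1) := by
    obtain ⟨e, he, he'⟩ := (pt A (y ≫ v)).existsUnique_decomposition (hUP A y)
    refine ⟨CommAlgCat.ofHom (MvPolynomial.aeval fun x : σ =>
      β.co A x.2.down (Sum.elim e (pt A (y ≫ v)).vec x.1)), fun e₁ he₁ x => ?_⟩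
    rw [he' e₁ he₁]
    exact MvPolynomial.aeval_X _ _
  choose θ hθ using hex
  obtain ⟨w, hw⟩ := exists_hom_of_natural (S := U) (T := specOver W)
    (fun A y => specOverMap (θ A y)) fun A A' φ y => by
      rw [← specOverMap_comp]
      refine congrArg specOverMap (hWext fun x => ?_)
      obtain ⟨e, he, -⟩ := (pt A (y ≫ v)).existsUnique_decomposition (hUP A y)
      have h1 : pt A' ((specOverMap φ ≫ y) ≫ v) = (pt A (y ≫ v)).map φ.hom := by
        rw [Category.assoc, hpt]
      rw [hθ A' (specOverMap φ ≫ y) (fun i => bc L φ.hom (e i)) (by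
        rw [h1, ← map_sum, he.2, map_one]
        exact ⟨fun i => bc_mem_subMap φ.hom (he.1 i), rfl⟩) x, h1]
      refine Eq.trans ?_ (congrArg φ.hom (hθ A y e he x)).symm
      rw [← β.co_bc]
      obtain ⟨i | α, j⟩ := x
      · rfl
      · rfl
  let π : W ⟶ B := CommAlgCat.ofHom (MvPolynomial.aeval fun x : σ =>
    β.co B x.2.down (genValue ρ x.1))
  have hπ : Function.Surjective π.hom := by
    refine (AlgHom.range_eq_top π.hom).1 ?_
    rw [← top_le_iff, ← hρ, Algebra.adjoin_le_iff]
    rintro _ ⟨⟨a, j⟩, rfl⟩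
    exact ⟨MvPolynomial.X (a, ⟨j⟩), MvPolynomial.aeval_X _ _⟩
  have hcl : IsClosedImmersion (specOverMap π).left := IsClosedImmersion.spec_of_surjective _ hπ
  -- At the image of a representation, the components of `1` are the values on the idempotents, so
  -- both composites record the coordinates of the values on all generators.
  have hgw : g ≫ w = u ≫ specOverMap π := hom_ext_of_points fun A y => by
    obtain ⟨φ, hφ⟩ := exists_specOverMap (y ≫ u)
    have h1 : (y ≫ g) ≫ v = y ≫ f := by rw [Category.assoc, hg]
    have h2 : rep A y = repMap (PathAlgebra R Δ) L φ.hom ρ := hu A y φ hφ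
    rw [← Category.assoc, hw, ← Category.assoc, hφ, ← specOverMap_comp]
    refine congrArg specOverMap (hWext fun x => ?_)
    rw [hθ A (y ≫ g) (fun i => genValue (rep A y) (Sum.inl i)) (by
      rw [h1, hfpt]
      exact decomposition_toTarget _) x, h1, hfpt]
    refine Eq.trans ?_ (congrArg φ.hom (MvPolynomial.aeval_X _ x)).symm
    rw [← β.co_bc, ← genValue_repMap, ← h2]
    obtain ⟨i | α, j⟩ := x
    · rfl
    · rfl
  have himm : IsImmersion (g.left ≫ w.left) := by
    have h1 : g.left ≫ w.left = u.left ≫ (specOverMap π).left := congrArg CommaMorphism.left hgw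
    rw [h1]
    infer_instance
  -- The composite is an open immersion followed by a closed one, so its first factor is an
  -- immersion too.
  have hgi : IsImmersion g.left := IsImmersion.of_comp g.left w.left
  have hfi : IsImmersion (g.left ≫ v.left) := inferInstance
  have h : g.left ≫ v.left = f.left := congrArg CommaMorphism.left hg
  rwa [h] at hfi

end Embedding

end QuiverRep

end

theorem mainTheorem10 {R : Type u} [CommRing R] {L : Type u} [Ring L] [Algebra R L] (n : ℕ)
    [QuiverRep.IsAzumayaOfDegree R L n] (Δ : Type u) [Quiver.{u} Δ] [Fintype Δ]
    [Finite (Quiver.Total Δ)] :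
    (∀ (A : CommAlgCat.{u} R) (σ : (QuiverRep.autFunctor R L).obj A)
        (ρ : (QuiverRep.schurFunctor R (QuiverRep.PathAlgebra R Δ) L).obj A),
      (QuiverRep.quiverMorphism R L n Δ).app A (σ • ρ) =
        σ • (QuiverRep.quiverMorphism R L n Δ).app A ρ) ∧
    ∃ (𝒢 : ℕ → Over (Spec (.of R)))
      (γ : ∀ d, QuiverRep.points (𝒢 d) ≅ Module.Grassmannian.functor.{u, u, u} (R := R) (M := L) d)
      (eY : QuiverRep.points (QuiverRep.targetScheme L n Δ 𝒢) ≅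
        QuiverRep.targetFunctor R L n Δ)
      (X : Over (Spec (.of R)))
      (eX : QuiverRep.points X ≅ QuiverRep.schurFunctor R (QuiverRep.PathAlgebra R Δ) L)
      (f : X ⟶ QuiverRep.targetScheme L n Δ 𝒢),
      QuiverRep.IsCanonical L γ eY ∧
      QuiverRep.pointsMap f ≫ eY.hom = eX.hom ≫ QuiverRep.quiverMorphism R L n Δ ∧
      QuiverRep.IsQuasiProjective X ∧
      QuiverRep.IsQuasiProjective (QuiverRep.targetScheme L n Δ 𝒢) ∧
      IsImmersion f.left := by
  have : IsAzumaya R L := QuiverRep.IsAzumayaOfDegree.toIsAzumaya n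
  refine ⟨fun A σ ρ => QuiverRep.toTarget_smul σ ρ, ?_⟩
  choose 𝒢 h𝒢 using fun d => QuiverRep.exists_represents_grassmannian (R := R) (L := L) d
  let γ d := (h𝒢 d).some
  obtain ⟨Y, ⟨h⟩, hY⟩ := QuiverRep.exists_represents_targetFunctor (R := R) (L := L) n Δ
  obtain ⟨φ, hφ⟩ := QuiverRep.exists_targetScheme_iso γ Y h
  obtain ⟨r, ⟨β⟩⟩ := QuiverRep.exists_dualFamily (R := R) (L := L)
  obtain ⟨B, ρ, hgen, hsurj⟩ := QuiverRep.exists_universal_rep Δ β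
  obtain ⟨X, u, eX, _, _, hu⟩ := QuiverRep.exists_schurScheme n β ρ
    (QuiverRep.eq_of_repMap_eq β hgen) hsurj
  let eY : QuiverRep.points (QuiverRep.targetScheme L n Δ 𝒢) ≅ QuiverRep.targetFunctor R L n Δ :=
    QuiverRep.pointsIso φ ≪≫ h
  -- Both functors being representable, the natural transformation is induced by a morphism of
  -- schemes.
  obtain ⟨f, hf⟩ := QuiverRep.exists_pointsMap_eq
    (eX.hom ≫ QuiverRep.quiverMorphism R L n Δ ≫ eY.inv)
  have hf' : QuiverRep.pointsMap f ≫ eY.hom = eX.hom ≫ QuiverRep.quiverMorphism R L n Δ := by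
    rw [hf, Category.assoc, Category.assoc, Iso.inv_hom_id, Category.comp_id]
  refine ⟨𝒢, γ, eY, X, eX, f, fun A m y => ?_, hf',
    QuiverRep.isQuasiProjective_of_isOpenImmersion u _ hgen, hY.of_iso φ,
    QuiverRep.isImmersion_of_quiverMorphism β eX eY f hf' ρ hgen u hu⟩
  have ht : eY.hom.app A (y ≫ Sigma.ι (QuiverRep.targetComponent L 𝒢) m) =
      QuiverRep.componentPoint γ y := by
    refine Eq.trans ?_ (hφ A m y)
    exact congrArg (fun z : QuiverRep.specOver A ⟶ Y => h.hom.app A z)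
      (Category.assoc y (Sigma.ι (QuiverRep.targetComponent L 𝒢) m) φ.hom)
  exact ⟨fun i => congrFun (congrArg QuiverRep.TargetPoint.sub ht) i, fun α =>
    (QuiverRep.bundlePoint_componentVec y α).symm.trans
      (congrArg (QuiverRep.bundlePoint A) (congrFun (congrArg QuiverRep.TargetPoint.vec ht) α)).symm⟩
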